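/- Let $\Omega\subset\mathbb R^n$ be a bounded open set. Let $H_0^1(\Omega)$ be the closure of $\mathscr D(\Omega)$ in $H^1(\Omega)$, let $\mathcal U=H^2(\Omega)\cap H_0^1(\Omega)$ with the $H^2$-norm, and let $(\cdot,\cdot)$ and $\|\cdot\|$ be the inner product and norm of $L^2(\Omega)$. On $H_0^1(\Omega)$ let $$a(u,v)=\sum_{i,j}\int_\Omega a_{ij}\,\partial_iu\,\partial_jv\,dx+\sum_i\int_\Omega a_i\,\partial_iu\,v\,dx+\int_\Omega a_0uv\,dx ,$$ where $a_{ij},a_i,a_0\in L^\infty(\Omega)$, the $a_{ij}$ are Lipschitz continuous on $\Omega$, $a_0\ge0$ a.e., $\sum_{i,j}a_{ij}\theta_i\theta_j\ge m\sum_i\theta_i^2$ a.e. in $\Omega$ for all $\theta\in\mathbb R^n$, with some $m>0$, and $a(u,u)\ge m'\|u\|_{H^1}^2$ on $H_0^1(\Omega)$, with some $m'>0$. Let $f,z\in L^2(\Omega)$, let $\nu>0$, and let $\mathcal U_{ad}\subset\mathcal U$ be closed and convex. For $\varphi\in\mathcal U$ let $\mathcal T(\varphi)=y\in H_0^1(\Omega)$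 be the solution of the obstacle problem: $y\ge\varphi$ a.e. and $a(y,v-y)\ge(f,v-y)$ for all $v\in H_0^1(\Omega)$ with $v\ge\varphi$ a.e. For $\delta>0$ let $\beta_\delta(r)=0$ for $r\ge0$, $\beta_\delta(r)=-r^2/\delta$ for $-\frac12\le r\le0$, $\beta_\delta(r)=(r+\frac14)/\delta$ for $r\le-\frac12$, and let $\mathcal T^\delta(\varphi)=y\in H_0^1(\Omega)$ be the solution of $a(y,v)+(\beta_\delta(y-\varphi),v)=(f,v)$ for all $v\in H_0^1(\Omega)$. Let $\varphi^*$ minimize $J(\varphi)=\frac12\|\mathcal T(\varphi)-z\|^2+\frac\nu2\|\Delta\varphi\|^2$ over $\mathcal U_{ad}$, and let $y^*=\mathcal T(\varphi^*)$. For every $\delta>0$ let $\varphi^\delta$ minimize $J_\delta(\varphi)=\frac12\|\mathcal T^\delta(\varphi)-z\|^2+\frac\nu2\|\Delta\varphi\|^2+\frac12\|\varphi-\varphi^*\|^2$ over $\mathcal U_{ad}$, let $y^\delta=\mathcal T^\delta(\varphi^\delta)$ and $\xi^\delta=\beta_\delta(y^\delta-\varphi^\delta)$, and let $p^\delta\in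 H_0^1(\Omega)$ be the adjoint state: $a(w,p^\delta)+(\beta_\delta'(y^\delta-\varphi^\delta)p^\delta,w)=(y^\delta-z,w)$ for all $w\in H_0^1(\Omega)$. Then there is $\xi^*\in L^2(\Omega)$ such that the following hold. 1. $\xi^*\le0$ a.e., and $a(y^*,v)+(\xi^*,v)=(f,v)$ for all $v\in H_0^1(\Omega)$. 2. As $\delta\to0^+$, $(\xi^\delta,v)\to(\xi^*,v)$ for every $v\in H_0^1(\Omega)$. If moreover there is $C$ with $\|\varphi\|_{H^2}\le C(1+\|\Delta\varphi\|)$ for all $\varphi\in\mathcal U_{ad}$, then $\xi^\delta\to\xi^*$ weakly in $L^2(\Omega)$. 3. $(\xi^\delta,p^\delta)\to0$ as $\delta\to0^+$. 4. Every sequence $\delta_k\to0^+$ has a subsequence along which $p^{\delta_k}$ converges weakly in $H_0^1(\Omega)$. Whenever $\delta_k\to0^+$ and $p^{\delta_k}\to p^*$ weakly in $H_0^1(\Omega)$, one has $(\xi^{\delta_k},p^{\delta_k})\to\langle\xi^*,p^*\rangle$ and $\langle\xi^*,p^*\rangle=0$, where $\langle\xi^*,p^*\rangle=(\xi^*,p^*)$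 because $\xi^*\in L^2(\Omega)$. 5. If $\mathcal U_{ad}=\mathcal U$, then the whole family $p^\delta$ converges weakly in $H_0^1(\Omega)$ to some $p^*$ as $\delta\to0^+$, and $(\xi^\delta,p^\delta)\to\langle\xi^*,p^*\rangle=0$. -/

import Mathlib

open MeasureTheory Filter Topology
open scoped ContDiff

namespace ObstacleControl

/-- The real Hilbert space `L²(Ω)` for Lebesgue measure restricted to `Ω`. -/
abbrev L2 {n : ℕ} (Ω : Set (EuclideanSpace ℝ (Fin n))) : Type :=
  Lp ℝ 2 ((volume : Measure (EuclideanSpace ℝ (Fin n))).restrict Ω)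

/-- `ψ ∈ 𝒟(Ω)`: smooth with compact support contained in `Ω`. -/
def IsTest {n : ℕ} (Ω : Set (EuclideanSpace ℝ (Fin n)))
    (ψ : EuclideanSpace ℝ (Fin n) → ℝ) : Prop :=
  ContDiff ℝ ∞ ψ ∧ HasCompactSupport ψ ∧ tsupport ψ ⊆ Ω

/-- The classical partial derivative `∂ψ/∂xᵢ`. -/
noncomputable def partialD {n : ℕ} (i : Fin n) (ψ : EuclideanSpace ℝ (Fin n) → ℝ)
    (x : EuclideanSpace ℝ (Fin n)) : ℝ :=
  fderiv ℝ ψ x (EuclideanSpace.single i (1 : ℝ))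

/-- `g ∈ L²(Ω)` is the weak partial derivative `∂u/∂xᵢ` of `u ∈ L²(Ω)` in `Ω`. -/
def HasWeakPartial {n : ℕ} {Ω : Set (EuclideanSpace ℝ (Fin n))} (i : Fin n)
    (u g : L2 Ω) : Prop :=
  ∀ ψ, IsTest Ω ψ → ∫ x in Ω, u x * partialD i ψ x = -∫ x in Ω, g x * ψ x

/-- The Hilbert space `L²(Ω) × L²(Ω)ⁿ` of pairs (function, candidate gradient), with the norm
`(‖u‖² + ∑ᵢ ‖gᵢ‖²)^{1/2}`, which is the `H¹`-norm on the pairs `(u, ∇u)`. -/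
abbrev H1Ambient {n : ℕ} (Ω : Set (EuclideanSpace ℝ (Fin n))) : Type :=
  WithLp 2 (L2 Ω × PiLp 2 (fun _ : Fin n => L2 Ω))

/-- The pairs `(ψ, ∇ψ)`, `ψ ∈ 𝒟(Ω)`. -/
def testPairs {n : ℕ} (Ω : Set (EuclideanSpace ℝ (Fin n))) : Set (H1Ambient Ω) :=
  {w | ∃ ψ, IsTest Ω ψ ∧ w.fst =ᵐ[volume.restrict Ω] ψ ∧
    ∀ i, w.snd i =ᵐ[volume.restrict Ω] partialD i ψ}

/-- `H₀¹(Ω)`, the closure of `𝒟(Ω)` for the `H¹`-norm; an element is stored together with its weak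
gradient (see `H10.hasWeakPartial`), which the function determines
(see `HasWeakPartial.unique`). -/
noncomputable def H10 {n : ℕ} (Ω : Set (EuclideanSpace ℝ (Fin n))) :
    Submodule ℝ (H1Ambient Ω) :=
  (Submodule.span ℝ (testPairs Ω)).topologicalClosure

/-- The underlying function in `L²(Ω)` of an element of `H₀¹(Ω)`. -/
noncomputable def fnOf {n : ℕ} {Ω : Set (EuclideanSpace ℝ (Fin n))} (u : H10 Ω) : L2 Ω :=
  (u : H1Ambient Ω).fst

/-- The weak partial derivative `∂u/∂xᵢ` of an element of `H₀¹(Ω)`. -/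
noncomputable def gradOf {n : ℕ} {Ω : Set (EuclideanSpace ℝ (Fin n))} (u : H10 Ω)
    (i : Fin n) : L2 Ω :=
  (u : H1Ambient Ω).snd i

theorem IsTest.memLp {n : ℕ} {Ω : Set (EuclideanSpace ℝ (Fin n))}
    {ψ : EuclideanSpace ℝ (Fin n) → ℝ} (h : IsTest Ω ψ) :
    MemLp ψ 2 (volume.restrict Ω) :=
  (h.1.continuous.memLp_of_hasCompactSupport h.2.1).restrict Ω

theorem IsTest.partial_isTest {n : ℕ} {Ω : Set (EuclideanSpace ℝ (Fin n))}
    {ψ : EuclideanSpace ℝ (Fin n) → ℝ} (h : IsTest Ω ψ) (i : Fin n) :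
    IsTest Ω (partialD i ψ) := by
  refine ⟨?_, ?_, ?_⟩
  · exact (h.1.fderiv_right (by simp)).clm_apply contDiff_const
  · exact h.2.1.fderiv_apply (𝕜 := ℝ) _
  · exact (tsupport_fderiv_apply_subset ℝ _).trans h.2.2

theorem integrable_mul_test {n : ℕ} {Ω : Set (EuclideanSpace ℝ (Fin n))} (u : L2 Ω)
    {ψ : EuclideanSpace ℝ (Fin n) → ℝ} (h : IsTest Ω ψ) :
    Integrable (fun x => u x * ψ x) (volume.restrict Ω) :=
  (Lp.memLp u).integrable_mul h.memLp

theorem integral_mul_test {n : ℕ} {Ω : Set (EuclideanSpace ℝ (Fin n))} (u : L2 Ω)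
    {ψ : EuclideanSpace ℝ (Fin n) → ℝ} (h : IsTest Ω ψ) :
    ∫ x in Ω, u x * ψ x = inner ℝ h.memLp.toLp u := by
  rw [L2.inner_def]
  refine integral_congr_ae ?_
  filter_upwards [h.memLp.coeFn_toLp] with x hx
  simp [hx]

theorem HasWeakPartial.iff_inner {n : ℕ} {Ω : Set (EuclideanSpace ℝ (Fin n))} {i : Fin n}
    {u g : L2 Ω} : HasWeakPartial i u g ↔ ∀ ψ (h : IsTest Ω ψ),
      inner ℝ (h.partial_isTest i).memLp.toLp u = -inner ℝ h.memLp.toLp g := by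
  refine forall_congr' fun ψ => forall_congr' fun h => ?_
  rw [integral_mul_test u (h.partial_isTest i), integral_mul_test g h]

theorem HasWeakPartial.unique {n : ℕ} {Ω : Set (EuclideanSpace ℝ (Fin n))} (hΩ : IsOpen Ω)
    {i : Fin n} {u g g' : L2 Ω} (h : HasWeakPartial i u g) (h' : HasWeakPartial i u g') :
    g = g' := by
  have key : ∀ᵐ x ∂(volume : Measure (EuclideanSpace ℝ (Fin n))), x ∈ Ω → (g - g') x = 0 := by
    refine hΩ.ae_eq_zero_of_integral_contDiff_smul_eq_zero ?_ ?_
    · exact locallyIntegrableOn_of_locallyIntegrable_restrict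
        ((Lp.memLp (g - g')).locallyIntegrable (by norm_num))
    · intro ψ hψ hc hs
      have ht : IsTest Ω ψ := ⟨hψ, hc, hs⟩
      have h0 : ∫ x in Ω, (g - g') x * ψ x = 0 := by
        rw [integral_mul_test _ ht, inner_sub_right]
        have a := HasWeakPartial.iff_inner.1 h ψ ht
        have b := HasWeakPartial.iff_inner.1 h' ψ ht
        linarith
      rw [← h0, ← setIntegral_eq_integral_of_forall_compl_eq_zero (s := Ω)]
      · simp [mul_comm]
      · intro x hx
        have : ψ x = 0 := image_eq_zero_of_notMem_tsupport fun hx' => hx (hs hx')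
        simp [this]
  have : (g - g' : L2 Ω) = 0 := by
    rw [Lp.eq_zero_iff_ae_eq_zero]
    exact (ae_restrict_iff' hΩ.measurableSet).2 key
  exact sub_eq_zero.1 this

theorem hasWeakPartial_of_mem_testPairs {n : ℕ} {Ω : Set (EuclideanSpace ℝ (Fin n))}
    {w : H1Ambient Ω} (hw : w ∈ testPairs Ω) (i : Fin n) : HasWeakPartial i w.fst (w.snd i) := by
  obtain ⟨ψ, hψ, h0, h1⟩ := hw
  intro χ hχ
  have e1 : ∫ x in Ω, w.fst x * partialD i χ x = ∫ x, ψ x * partialD i χ x := by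
    refine Eq.trans (integral_congr_ae ?_)
      (setIntegral_eq_integral_of_forall_compl_eq_zero (s := Ω) fun x hx => ?_)
    · filter_upwards [h0] with x hx
      rw [hx]
    · rw [image_eq_zero_of_notMem_tsupport fun hx' => hx (hψ.2.2 hx'), zero_mul]
  have e2 : ∫ x in Ω, w.snd i x * χ x = ∫ x, partialD i ψ x * χ x := by
    refine Eq.trans (integral_congr_ae ?_)
      (setIntegral_eq_integral_of_forall_compl_eq_zero (s := Ω) fun x hx => ?_)
    · filter_upwards [h1 i] with x hx
      rw [hx]
    · rw [image_eq_zero_of_notMem_tsupport fun hx' => hx (hχ.2.2 hx'), mul_zero]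
  rw [e1, e2]
  have ci : ∀ {φ₁ φ₂ : EuclideanSpace ℝ (Fin n) → ℝ}, IsTest Ω φ₁ → IsTest Ω φ₂ →
      Integrable (fun x => φ₁ x * φ₂ x) := fun h₁ h₂ =>
    (h₁.1.continuous.mul h₂.1.continuous).integrable_of_hasCompactSupport h₁.2.1.mul_right
  exact integral_mul_fderiv_eq_neg_fderiv_mul_of_integrable (ci (hψ.partial_isTest i) hχ)
    (ci hψ (hχ.partial_isTest i)) (ci hψ hχ) (fun x _ => hψ.1.differentiable (by simp) x)
    (fun x _ => hχ.1.differentiable (by simp) x)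

theorem H10.hasWeakPartial {n : ℕ} {Ω : Set (EuclideanSpace ℝ (Fin n))} (u : H10 Ω)
    (i : Fin n) : HasWeakPartial i (fnOf u) (gradOf u i) := by
  let S : Submodule ℝ (H1Ambient Ω) :=
    { carrier := {w | HasWeakPartial i w.fst (w.snd i)}
      add_mem' := by
        intro w w' h h'
        simp only [Set.mem_ofPred_eq, HasWeakPartial.iff_inner] at *
        intro ψ hψ
        have h1 := h ψ hψ
        have h2 := h' ψ hψ
        simp only [WithLp.add_fst, WithLp.add_snd, PiLp.add_apply, inner_add_right]
        linarith
      zero_mem' := by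
        simp [HasWeakPartial.iff_inner]
      smul_mem' := by
        intro c w h
        simp only [Set.mem_ofPred_eq, HasWeakPartial.iff_inner] at *
        intro ψ hψ
        have h1 := h ψ hψ
        simp only [WithLp.smul_fst, WithLp.smul_snd, PiLp.smul_apply, inner_smul_right, h1]
        ring }
  have hS : IsClosed (S : Set (H1Ambient Ω)) := by
    have : (S : Set (H1Ambient Ω)) = ⋂ ψ, ⋂ h : IsTest Ω ψ,
        {w : H1Ambient Ω | inner ℝ (h.partial_isTest i).memLp.toLp w.fst =
          -inner ℝ h.memLp.toLp (w.snd i)} := by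
      ext w
      simp only [Set.mem_iInter, Set.mem_ofPred_eq]
      exact HasWeakPartial.iff_inner
    rw [this]
    refine isClosed_iInter fun ψ => isClosed_iInter fun h => isClosed_eq ?_ ?_ <;> fun_prop
  exact Submodule.topologicalClosure_minimal _
    (Submodule.span_le.2 fun w hw => hasWeakPartial_of_mem_testPairs hw i) hS u.2

/-- `H²(Ω) ∩ H₀¹(Ω)`: an element is stored as `u ∈ H₀¹(Ω)` together with its (uniquely determined)
second weak derivatives `∂²u/∂xᵢ∂xⱼ`; the inherited Hilbert norm is the `H²`-norm
`(‖u‖² + ∑ᵢ ‖∂ᵢu‖² + ∑ᵢⱼ ‖∂ᵢⱼu‖²)^{1/2}`. -/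
noncomputable def H2H10 {n : ℕ} (Ω : Set (EuclideanSpace ℝ (Fin n))) :
    Submodule ℝ (WithLp 2 (H10 Ω × PiLp 2 (fun _ : Fin n × Fin n => L2 Ω))) where
  carrier := {w | ∀ i j, HasWeakPartial j (gradOf w.fst i) (w.snd (i, j))}
  add_mem' := by
    intro w w' h h'
    simp only [Set.mem_ofPred_eq, HasWeakPartial.iff_inner] at *
    intro i j ψ hψ
    have h1 := h i j ψ hψ
    have h2 := h' i j ψ hψ
    simp only [gradOf, WithLp.add_fst, WithLp.add_snd, PiLp.add_apply, inner_add_right,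
      Submodule.coe_add] at *
    linarith
  zero_mem' := by
    simp [HasWeakPartial.iff_inner, gradOf]
  smul_mem' := by
    intro c w h
    simp only [Set.mem_ofPred_eq, HasWeakPartial.iff_inner] at *
    intro i j ψ hψ
    have h1 := h i j ψ hψ
    simp only [gradOf, WithLp.smul_fst, WithLp.smul_snd, PiLp.smul_apply, inner_smul_right,
      Submodule.coe_smul] at *
    rw [h1]
    ring

/-- The inclusion `H²(Ω) ∩ H₀¹(Ω) → H₀¹(Ω)`. -/
noncomputable def toH10 {n : ℕ} {Ω : Set (EuclideanSpace ℝ (Fin n))} (φ : H2H10 Ω) :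
    H10 Ω :=
  (φ : WithLp 2 (H10 Ω × PiLp 2 (fun _ : Fin n × Fin n => L2 Ω))).fst

/-- The Laplacian `Δφ ∈ L²(Ω)` of `φ ∈ H²(Ω) ∩ H₀¹(Ω)`. -/
noncomputable def laplacianOf {n : ℕ} {Ω : Set (EuclideanSpace ℝ (Fin n))} (φ : H2H10 Ω) :
    L2 Ω :=
  ∑ i, (φ : WithLp 2 (H10 Ω × PiLp 2 (fun _ : Fin n × Fin n => L2 Ω))).snd (i, i)

/-- The coefficients `aᵢⱼ`, `aᵢ`, `a₀` of the differential operator. -/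
structure Coeffs (n : ℕ) where
  /-- the second order coefficients `aᵢⱼ` -/
  principal : Fin n → Fin n → EuclideanSpace ℝ (Fin n) → ℝ
  /-- the first order coefficients `aᵢ` -/
  drift : Fin n → EuclideanSpace ℝ (Fin n) → ℝ
  /-- the zeroth order coefficient `a₀` -/
  zeroth : EuclideanSpace ℝ (Fin n) → ℝ

/-- The bilinear form
`a(u,v) = ∑ᵢⱼ ∫ aᵢⱼ ∂ᵢu ∂ⱼv + ∑ᵢ ∫ aᵢ ∂ᵢu v + ∫ a₀ u v` on `H₀¹(Ω)`. -/
noncomputable def Coeffs.form {n : ℕ} {Ω : Set (EuclideanSpace ℝ (Fin n))} (a : Coeffs n)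
    (u v : H10 Ω) : ℝ :=
  (∑ i, ∑ j, ∫ x in Ω, a.principal i j x * gradOf u i x * gradOf v j x) +
    (∑ i, ∫ x in Ω, a.drift i x * gradOf u i x * fnOf v x) +
    ∫ x in Ω, a.zeroth x * fnOf u x * fnOf v x

/-- The standing assumptions on the coefficients: they are in `L^∞(Ω)`, the `aᵢⱼ` are Lipschitz,
`a₀ ≥ 0`, the principal part is uniformly elliptic, and the form is coercive on `H₀¹(Ω)`. -/
structure Coeffs.Admissible {n : ℕ} (a : Coeffs n) (Ω : Set (EuclideanSpace ℝ (Fin n))) :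
    Prop where
  principal_bdd : ∀ i j, MemLp (a.principal i j) ⊤ (volume.restrict Ω)
  principal_lip : ∀ i j, ∃ K, LipschitzOnWith K (a.principal i j) Ω
  drift_bdd : ∀ i, MemLp (a.drift i) ⊤ (volume.restrict Ω)
  zeroth_bdd : MemLp a.zeroth ⊤ (volume.restrict Ω)
  zeroth_nonneg : ∀ᵐ x ∂(volume.restrict Ω), 0 ≤ a.zeroth x
  elliptic : ∃ m : ℝ, 0 < m ∧ ∀ᵐ x ∂(volume.restrict Ω), ∀ θ : Fin n → ℝ,
    m * ∑ i, θ i ^ 2 ≤ ∑ i, ∑ j, a.principal i j x * θ i * θ j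
  coercive : ∃ m : ℝ, 0 < m ∧ ∀ u : H10 Ω, m * ‖u‖ ^ 2 ≤ a.form u u

/-- `y = 𝒯(φ)`: `y ∈ H₀¹(Ω)` solves the variational inequality with lower obstacle `φ`, that is
`y ≥ φ` a.e. and `a(y, v - y) ≥ (f, v - y)` for all `v ∈ H₀¹(Ω)` with `v ≥ φ` a.e. -/
def IsObstacleState {n : ℕ} {Ω : Set (EuclideanSpace ℝ (Fin n))} (a : Coeffs n) (f : L2 Ω)
    (φ y : H10 Ω) : Prop :=
  (∀ᵐ x ∂(volume.restrict Ω), fnOf φ x ≤ fnOf y x) ∧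
    ∀ v : H10 Ω, (∀ᵐ x ∂(volume.restrict Ω), fnOf φ x ≤ fnOf v x) →
      inner ℝ f (fnOf (v - y)) ≤ a.form y (v - y)

/-- The approximation `β_δ` of the maximal monotone graph of the obstacle. -/
noncomputable def beta (δ r : ℝ) : ℝ :=
  1 / δ * if 0 ≤ r then 0 else if -(1 / 2) ≤ r then -r ^ 2 else r + 1 / 4

/-- The derivative `β_δ'`. -/
noncomputable def betaDeriv (δ r : ℝ) : ℝ :=
  1 / δ * if 0 ≤ r then 0 else if -(1 / 2) ≤ r then -2 * r else 1

/-- `y = 𝒯^δ(φ)`: `y ∈ H₀¹(Ω)` is the weak solution of `Ay + β_δ(y - φ) = f`. -/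
def IsPenalizedState {n : ℕ} {Ω : Set (EuclideanSpace ℝ (Fin n))} (a : Coeffs n) (f : L2 Ω)
    (δ : ℝ) (φ y : H10 Ω) : Prop :=
  ∀ v : H10 Ω, a.form y v + ∫ x in Ω, beta δ (fnOf y x - fnOf φ x) * fnOf v x = inner ℝ f (fnOf v)

/-- `p ∈ H₀¹(Ω)` is the weak solution of the adjoint equation
`A*p + β_δ'(y - φ) p = y - z`. -/
def IsAdjointState {n : ℕ} {Ω : Set (EuclideanSpace ℝ (Fin n))} (a : Coeffs n) (z : L2 Ω)
    (δ : ℝ) (φ y p : H10 Ω) : Prop :=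
  ∀ w : H10 Ω, a.form w p + ∫ x in Ω, betaDeriv δ (fnOf y x - fnOf φ x) * fnOf p x * fnOf w x =
    inner ℝ (fnOf y - z) (fnOf w)

/-- The cost `½ ∫ (y - z)² + ν/2 ∫ (Δφ)²` of a control `φ` with state `y`. -/
noncomputable def cost {n : ℕ} {Ω : Set (EuclideanSpace ℝ (Fin n))} (ν : ℝ) (z : L2 Ω)
    (φ : H2H10 Ω) (y : H10 Ω) : ℝ :=
  1 / 2 * ‖fnOf y - z‖ ^ 2 + ν / 2 * ‖laplacianOf φ‖ ^ 2

/-- `φ` solves problem `(𝒫)`, with optimal state `y = 𝒯(φ)`. -/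
def IsOptimal {n : ℕ} {Ω : Set (EuclideanSpace ℝ (Fin n))} (a : Coeffs n) (f z : L2 Ω) (ν : ℝ)
    (Uad : Set (H2H10 Ω)) (φ : H2H10 Ω) (y : H10 Ω) : Prop :=
  φ ∈ Uad ∧ IsObstacleState a f (toH10 φ) y ∧
    ∀ φ' ∈ Uad, ∀ y', IsObstacleState a f (toH10 φ') y' → cost ν z φ y ≤ cost ν z φ' y'

/-- `φ` solves the approximate problem `(𝒫^δ)`, whose cost is the cost of `(𝒫)` for the state
`𝒯^δ(φ)` plus `½ ‖φ - φ*‖²`; the optimal state is `y = 𝒯^δ(φ)`. -/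
def IsPenalizedOptimal {n : ℕ} {Ω : Set (EuclideanSpace ℝ (Fin n))} (a : Coeffs n) (f z : L2 Ω)
    (ν : ℝ) (Uad : Set (H2H10 Ω)) (φs : H2H10 Ω) (δ : ℝ) (φ : H2H10 Ω) (y : H10 Ω) : Prop :=
  φ ∈ Uad ∧ IsPenalizedState a f δ (toH10 φ) y ∧
    ∀ φ' ∈ Uad, ∀ y', IsPenalizedState a f δ (toH10 φ') y' →
      cost ν z φ y + 1 / 2 * ‖fnOf (toH10 φ) - fnOf (toH10 φs)‖ ^ 2 ≤
        cost ν z φ' y' + 1 / 2 * ‖fnOf (toH10 φ') - fnOf (toH10 φs)‖ ^ 2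

/-- Weak convergence in a Hilbert space. -/
def WeaklyTendsto {ι H : Type*} [NormedAddCommGroup H] [InnerProductSpace ℝ H] (u : ι → H)
    (l : Filter ι) (u₀ : H) : Prop :=
  ∀ w : H, Tendsto (fun k => inner ℝ (u k) w) l (𝓝 (inner ℝ u₀ w))

/-- The pairing `(ξ, v) = ∫ ξ v` over `Ω` of `ξ = β_δ(y - φ)` with `v ∈ L²(Ω)`. -/
noncomputable def xiPairing {n : ℕ} {Ω : Set (EuclideanSpace ℝ (Fin n))} (δ : ℝ) (φ y : H10 Ω)
    (v : L2 Ω) : ℝ :=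
  ∫ x in Ω, beta δ (fnOf y x - fnOf φ x) * v x

end ObstacleControl

open ObstacleControl

namespace ObstacleControl

variable {n : ℕ} {Ω : Set (EuclideanSpace ℝ (Fin n))}

/-! ### The spaces `H₀¹(Ω)` and `H²(Ω) ∩ H₀¹(Ω)` -/

/-! The penalty term stays bounded in `L²` as `δ → 0` when the obstacle is bounded in `H²`. Testing
the state equation with `β_δ(y - φ)` makes the principal part contribute `∫ β_δ' aᵢⱼ ∂ᵢw ∂ⱼw ≥ 0`
with `w = y - φ`. The zeroth order part is also nonnegative. The drift costs only `‖w‖` times the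
`L²`-norm of the penalty, and `a(φ, ·)` extends continuously to `L²` because the `aᵢⱼ` are Lipschitz
(`Coeffs.Admissible.exists_norm_betaL_le`). For a fixed obstacle this bound makes the penalized
states Cauchy in `H₀¹`. They converge to the obstacle state, and a weak `L²` limit of the penalties
is the multiplier `ξ*`.

States depend on obstacles in a Lipschitz way in `H₀¹`, with a constant independent of `δ`. Controls
with bounded `‖φ‖ + ‖Δφ‖` are relatively compact in `H₀¹`, by Green's formula and Rellich's theorem.
Hence the penalization error vanishes along the controls `φ^δ`. Comparing the two optimality
statements, with the Laplacian terms cancelling, forces `‖φ^δ - φ*‖ → 0`, and then `φ^δ → φ*` and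
`y^δ → y*` strongly in `H₀¹` (`tendsto_penalizedOptimal`). The state equation turns every limit of
`ξ^δ` into a limit of `y^δ`, so `(ξ^δ, q^δ) → (ξ*, q)` whenever `q^δ → q` weakly and the `q^δ` are
bounded (`tendsto_xiPairing`).

That `(ξ^δ, p^δ) → 0` rests on `|β_δ(r)| ≤ β_δ'(r)|r|` and `β_δ'(r) r² ≤ 2 β_δ(r) r`. Young's
inequality bounds the pairing by `τ ∫ β_δ' p² + (ξ^δ, y^δ - φ^δ)/τ`. The first integral is bounded
by the adjoint equation, and the second pairing tends to the complementarity term `(ξ*, y* - φ*) =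
0` (`abs_inner_betaL_le`, `tendsto_xiPairing_adjoint`).

Without control constraints, stationarity of the penalized cost expresses `a(ψ, p^δ)` through
quantities that converge for every test function `ψ`. Such values determine a weak limit point
uniquely, so the bounded family `p^δ` converges as a whole (`IsPenalizedOptimal.form_adjoint_eq`,
`exists_weaklyTendsto_adjoint`). -/

instance : CompleteSpace (H10 Ω) :=
  (Submodule.isClosed_topologicalClosure _).completeSpace_coe

/-- The embedding `H₀¹(Ω) → L²(Ω)`. -/
noncomputable def fnL : H10 Ω →L[ℝ] L2 Ω :=
  (WithLp.fstL 2 ℝ (L2 Ω) (PiLp 2 (fun _ : Fin n => L2 Ω))).comp (H10 Ω).subtypeL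

/-- The weak partial derivative as a continuous linear map `H₀¹(Ω) → L²(Ω)`. -/
noncomputable def gradL (i : Fin n) : H10 Ω →L[ℝ] L2 Ω :=
  ((PiLp.proj 2 (fun _ : Fin n => L2 Ω) i).comp
    (WithLp.sndL 2 ℝ (L2 Ω) (PiLp 2 (fun _ : Fin n => L2 Ω)))).comp (H10 Ω).subtypeL

theorem fnL_apply (u : H10 Ω) : fnL u = fnOf u := rfl

theorem gradL_apply (i : Fin n) (u : H10 Ω) : gradL i u = gradOf u i := rfl

@[simp] theorem fnOf_add (u v : H10 Ω) : fnOf (u + v) = fnOf u + fnOf v := map_add fnL u v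
@[simp] theorem fnOf_sub (u v : H10 Ω) : fnOf (u - v) = fnOf u - fnOf v := map_sub fnL u v
@[simp] theorem fnOf_smul (c : ℝ) (u : H10 Ω) : fnOf (c • u) = c • fnOf u := map_smul fnL c u
@[simp] theorem fnOf_zero : fnOf (0 : H10 Ω) = 0 := map_zero fnL
theorem H10.norm_sq (u : H10 Ω) : ‖u‖ ^ 2 = ‖fnOf u‖ ^ 2 + ∑ i, ‖gradOf u i‖ ^ 2 := by
  have h : ‖u‖ = ‖(u : H1Ambient Ω)‖ := rfl
  rw [h, WithLp.prod_norm_sq_eq_of_L2, PiLp.norm_sq_eq_of_L2]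
  rfl

theorem H10.inner_eq (u v : H10 Ω) :
    inner ℝ u v = inner ℝ (fnOf u) (fnOf v) + ∑ i, inner ℝ (gradOf u i) (gradOf v i) := by
  have h : inner ℝ u v = inner ℝ (u : H1Ambient Ω) (v : H1Ambient Ω) := rfl
  rw [h, WithLp.prod_inner_apply, PiLp.inner_apply]
  rfl

theorem norm_fnOf_le (u : H10 Ω) : ‖fnOf u‖ ≤ ‖u‖ := by
  refine le_of_sq_le_sq ?_ (norm_nonneg _)
  rw [H10.norm_sq]
  have : 0 ≤ ∑ i, ‖gradOf u i‖ ^ 2 := Finset.sum_nonneg fun i _ => sq_nonneg _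
  linarith

theorem norm_gradOf_le (u : H10 Ω) (i : Fin n) : ‖gradOf u i‖ ≤ ‖u‖ := by
  refine le_of_sq_le_sq ?_ (norm_nonneg _)
  rw [H10.norm_sq]
  have : ‖gradOf u i‖ ^ 2 ≤ ∑ i, ‖gradOf u i‖ ^ 2 :=
    Finset.single_le_sum (f := fun i => ‖gradOf u i‖ ^ 2) (fun i _ => sq_nonneg _)
      (Finset.mem_univ i)
  nlinarith [sq_nonneg ‖fnOf u‖]

/-- A test function as an element of `L²(Ω)`. -/
noncomputable def IsTest.toL2 {ψ : EuclideanSpace ℝ (Fin n) → ℝ} (h : IsTest Ω ψ) : L2 Ω :=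
  h.memLp.toLp

theorem IsTest.coeFn_toL2 {ψ : EuclideanSpace ℝ (Fin n) → ℝ} (h : IsTest Ω ψ) :
    h.toL2 =ᵐ[volume.restrict Ω] ψ := h.memLp.coeFn_toLp

/-- A test function as an element of `H₀¹(Ω)`. -/
noncomputable def IsTest.toH10 {ψ : EuclideanSpace ℝ (Fin n) → ℝ} (h : IsTest Ω ψ) : H10 Ω :=
  ⟨WithLp.toLp 2 (h.toL2, WithLp.toLp 2 fun i => (h.partial_isTest i).toL2),
    Submodule.le_topologicalClosure _ (Submodule.subset_span
      ⟨ψ, h, h.coeFn_toL2, fun i => (h.partial_isTest i).coeFn_toL2⟩)⟩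

@[simp] theorem IsTest.fnOf_toH10 {ψ : EuclideanSpace ℝ (Fin n) → ℝ} (h : IsTest Ω ψ) :
    fnOf h.toH10 = h.toL2 := rfl

theorem IsTest.zero : IsTest Ω (0 : EuclideanSpace ℝ (Fin n) → ℝ) :=
  ⟨contDiff_const, HasCompactSupport.zero, by simp [tsupport]⟩

theorem IsTest.add {ψ χ : EuclideanSpace ℝ (Fin n) → ℝ} (h : IsTest Ω ψ) (h' : IsTest Ω χ) :
    IsTest Ω (ψ + χ) :=
  ⟨h.1.add h'.1, h.2.1.add h'.2.1,
    (tsupport_add _ _).trans (Set.union_subset h.2.2 h'.2.2)⟩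

theorem IsTest.mul_left {ψ χ : EuclideanSpace ℝ (Fin n) → ℝ} (hχ : ContDiff ℝ ∞ χ)
    (h : IsTest Ω ψ) : IsTest Ω (fun x => χ x * ψ x) :=
  ⟨hχ.mul h.1, h.2.1.mul_left, (tsupport_mul_subset_right).trans h.2.2⟩

theorem IsTest.smul {ψ : EuclideanSpace ℝ (Fin n) → ℝ} (c : ℝ) (h : IsTest Ω ψ) :
    IsTest Ω (c • ψ) :=
  h.mul_left (χ := fun _ => c) contDiff_const

theorem IsTest.differentiable {ψ : EuclideanSpace ℝ (Fin n) → ℝ} (h : IsTest Ω ψ) :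
    Differentiable ℝ ψ := h.1.differentiable (by simp)

theorem partialD_add {ψ χ : EuclideanSpace ℝ (Fin n) → ℝ} (h : IsTest Ω ψ) (h' : IsTest Ω χ)
    (i : Fin n) : partialD i (ψ + χ) = partialD i ψ + partialD i χ := by
  ext x
  simp [partialD, fderiv_add (h.differentiable x) (h'.differentiable x)]

theorem partialD_smul {ψ : EuclideanSpace ℝ (Fin n) → ℝ} (c : ℝ) (h : IsTest Ω ψ)
    (i : Fin n) : partialD i (c • ψ) = c • partialD i ψ := by
  ext x
  simp [partialD, fderiv_const_smul (h.differentiable x)]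

/-- The pairs `(ψ, ∇ψ)` form a subspace. -/
noncomputable def testSubmodule (Ω : Set (EuclideanSpace ℝ (Fin n))) :
    Submodule ℝ (H1Ambient Ω) where
  carrier := testPairs Ω
  add_mem' := by
    rintro w w' ⟨ψ, h, h0, h1⟩ ⟨χ, h', h0', h1'⟩
    refine ⟨ψ + χ, h.add h', ?_, fun i => ?_⟩
    · exact (Lp.coeFn_add _ _).trans (h0.add h0')
    · rw [partialD_add h h']
      exact (Lp.coeFn_add _ _).trans ((h1 i).add (h1' i))
  zero_mem' := by
    refine ⟨0, IsTest.zero, Lp.coeFn_zero _ _ _, fun i => ?_⟩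
    have : partialD i (0 : EuclideanSpace ℝ (Fin n) → ℝ) = 0 := by
      ext x; simp [partialD]
    rw [this]
    exact Lp.coeFn_zero _ _ _
  smul_mem' := by
    rintro c w ⟨ψ, h, h0, h1⟩
    refine ⟨c • ψ, h.smul c, ?_, fun i => ?_⟩
    · exact (Lp.coeFn_smul _ _).trans (h0.const_smul c)
    · rw [partialD_smul c h]
      exact (Lp.coeFn_smul _ _).trans ((h1 i).const_smul c)

/-- The test pairs already form a subspace, so the span in the definition of `H10` adds nothing
before the closure is taken. -/
theorem H10.exists_test_near (u : H10 Ω) {ε : ℝ} (hε : 0 < ε) :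
    ∃ ψ, ∃ h : IsTest Ω ψ, ‖u - h.toH10‖ < ε := by
  have hs : Submodule.span ℝ (testPairs Ω) = testSubmodule Ω :=
    Submodule.span_eq (testSubmodule Ω)
  have hu : (u : H1Ambient Ω) ∈ closure (testPairs Ω) := by
    have : (u : H1Ambient Ω) ∈ (Submodule.span ℝ (testPairs Ω)).topologicalClosure := u.2
    rw [hs] at this
    exact this
  obtain ⟨w, ⟨ψ, h, h0, h1⟩, hw⟩ := Metric.mem_closure_iff.1 hu ε hε
  refine ⟨ψ, h, ?_⟩
  have : w = (h.toH10 : H1Ambient Ω) := by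
    refine (WithLp.equiv _ _).injective (Prod.ext ?_ ?_)
    · exact Lp.ext (h0.trans h.coeFn_toL2.symm)
    · refine (WithLp.equiv _ _).injective (funext fun i => ?_)
      exact Lp.ext ((h1 i).trans (h.partial_isTest i).coeFn_toL2.symm)
  rw [this, dist_eq_norm] at hw
  exact hw

theorem H10.exists_seq_test (u : H10 Ω) : ∃ ψ : ℕ → EuclideanSpace ℝ (Fin n) → ℝ,
    ∃ h : ∀ k, IsTest Ω (ψ k), Tendsto (fun k => (h k).toH10) atTop (𝓝 u) := by
  choose ψ h hd using fun k : ℕ => H10.exists_test_near u (Nat.one_div_pos_of_nat (α := ℝ) (n := k))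
  refine ⟨ψ, h, ?_⟩
  rw [tendsto_iff_norm_sub_tendsto_zero]
  refine squeeze_zero (fun _ => norm_nonneg _) (fun k => ?_) tendsto_one_div_add_atTop_nhds_zero_nat
  rw [norm_sub_rev]
  exact (hd k).le

/-- A closed property that holds for test functions holds on `H₀¹(Ω)`. -/
theorem H10.closed_induction {P : H10 Ω → Prop} (hP : IsClosed {u | P u})
    (h : ∀ ψ (hψ : IsTest Ω ψ), P hψ.toH10) (u : H10 Ω) : P u := by
  obtain ⟨ψ, hψ, ht⟩ := H10.exists_seq_test u
  exact hP.mem_of_tendsto ht (Eventually.of_forall fun k => h _ (hψ k))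

theorem L2.eq_zero_of_forall_test (hΩ : IsOpen Ω) {g : L2 Ω}
    (h : ∀ ψ (hψ : IsTest Ω ψ), inner ℝ hψ.toL2 g = 0) : g = 0 := by
  rw [Lp.eq_zero_iff_ae_eq_zero]
  refine (ae_restrict_iff' hΩ.measurableSet).2 ?_
  refine hΩ.ae_eq_zero_of_integral_contDiff_smul_eq_zero
    (locallyIntegrableOn_of_locallyIntegrable_restrict
      ((Lp.memLp g).locallyIntegrable (by norm_num))) fun ψ hψ hc hs => ?_
  have ht : IsTest Ω ψ := ⟨hψ, hc, hs⟩
  rw [← h ψ ht, IsTest.toL2, ← integral_mul_test g ht,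
    ← setIntegral_eq_integral_of_forall_compl_eq_zero (s := Ω)]
  · simp [mul_comm]
  · intro x hx
    have : ψ x = 0 := image_eq_zero_of_notMem_tsupport fun hx' => hx (hs hx')
    simp [this]

/-- Anything orthogonal to the range is orthogonal to all test functions. Density upgrades
convergence against `H₀¹` to weak `L²` convergence for bounded families. -/
theorem fnOf_denseRange (hΩ : IsOpen Ω) : DenseRange (fnL : H10 Ω → L2 Ω) := by
  have : (LinearMap.range (fnL : H10 Ω →L[ℝ] L2 Ω).toLinearMap).topologicalClosure = ⊤ := by
    rw [@Submodule.topologicalClosure_eq_top_iff _ _ _ _ _ _ (inferInstanceAs (CompleteSpace (L2 Ω))), Submodule.eq_bot_iff]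
    intro g hg
    refine L2.eq_zero_of_forall_test hΩ fun ψ hψ => ?_
    exact (Submodule.mem_orthogonal _ _).1 hg _ ⟨hψ.toH10, rfl⟩
  have h2 := Submodule.dense_iff_topologicalClosure_eq_top.2 this
  exact h2

end ObstacleControl

namespace ObstacleControl

variable {n : ℕ} {Ω : Set (EuclideanSpace ℝ (Fin n))}

/-! ### The penalty function -/

theorem beta_eq (δ r : ℝ) : beta δ r = 1 / δ * beta 1 r := by
  simp [beta]

theorem betaDeriv_eq (δ r : ℝ) : betaDeriv δ r = 1 / δ * betaDeriv 1 r := by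
  simp [betaDeriv]

theorem beta_one_mono_lip {s r : ℝ} (h : s ≤ r) :
    beta 1 s ≤ beta 1 r ∧ beta 1 r - beta 1 s ≤ r - s := by
  simp only [beta]
  constructor <;> split_ifs <;> nlinarith

/-- The derivative is `2`-Lipschitz, so Taylor's formula has constant `2 / 2 = 1`. -/
theorem beta_one_remainder (r s : ℝ) :
    |beta 1 r - beta 1 s - betaDeriv 1 s * (r - s)| ≤ (r - s) ^ 2 := by
  simp only [beta, betaDeriv]
  rw [abs_le]
  constructor <;> split_ifs <;> nlinarith

theorem betaDeriv_one_mem (r : ℝ) : 0 ≤ betaDeriv 1 r ∧ betaDeriv 1 r ≤ 1 := by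
  simp only [betaDeriv]
  constructor <;> split_ifs <;> linarith

theorem betaDeriv_nonneg {δ : ℝ} (hδ : 0 < δ) (r : ℝ) : 0 ≤ betaDeriv δ r := by
  rw [betaDeriv_eq]
  exact mul_nonneg (by positivity) (betaDeriv_one_mem r).1

theorem betaDeriv_le {δ : ℝ} (hδ : 0 < δ) (r : ℝ) : betaDeriv δ r ≤ 1 / δ := by
  rw [betaDeriv_eq]
  exact mul_le_of_le_one_right (by positivity) (betaDeriv_one_mem r).2

theorem abs_betaDeriv_le {δ : ℝ} (hδ : 0 < δ) (r : ℝ) : |betaDeriv δ r| ≤ 1 / δ := by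
  rw [abs_of_nonneg (betaDeriv_nonneg hδ r)]
  exact betaDeriv_le hδ r

@[simp] theorem beta_zero (δ : ℝ) : beta δ 0 = 0 := by simp [beta]

theorem beta_nonpos {δ : ℝ} (hδ : 0 < δ) (r : ℝ) : beta δ r ≤ 0 := by
  rw [beta_eq]
  refine mul_nonpos_of_nonneg_of_nonpos (by positivity) ?_
  simp only [beta]
  split_ifs <;> nlinarith

theorem beta_mono {δ : ℝ} (hδ : 0 < δ) : Monotone (beta δ) := fun s r h => by
  rw [beta_eq, beta_eq δ r]
  exact mul_le_mul_of_nonneg_left (beta_one_mono_lip h).1 (by positivity)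

theorem beta_sub_mul_nonneg {δ : ℝ} (hδ : 0 < δ) (r s : ℝ) :
    0 ≤ (beta δ r - beta δ s) * (r - s) := by
  rcases le_total r s with h | h
  · exact mul_nonneg_of_nonpos_of_nonpos (sub_nonpos.2 (beta_mono hδ h)) (sub_nonpos.2 h)
  · exact mul_nonneg (sub_nonneg.2 (beta_mono hδ h)) (sub_nonneg.2 h)

theorem beta_mul_self_nonneg {δ : ℝ} (hδ : 0 < δ) (r : ℝ) : 0 ≤ beta δ r * r := by
  simpa using beta_sub_mul_nonneg hδ r 0

theorem abs_beta_sub_le {δ : ℝ} (hδ : 0 < δ) (r s : ℝ) :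
    |beta δ r - beta δ s| ≤ 1 / δ * |r - s| := by
  rw [beta_eq, beta_eq δ s, ← mul_sub, abs_mul, abs_of_pos (show 0 < 1 / δ by positivity)]
  refine mul_le_mul_of_nonneg_left ?_ (by positivity)
  rcases le_total r s with h | h
  · rw [abs_sub_comm, abs_sub_comm r, abs_of_nonneg (sub_nonneg.2 (beta_one_mono_lip h).1),
      abs_of_nonneg (sub_nonneg.2 h)]
    exact (beta_one_mono_lip h).2
  · rw [abs_of_nonneg (sub_nonneg.2 (beta_one_mono_lip h).1), abs_of_nonneg (sub_nonneg.2 h)]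
    exact (beta_one_mono_lip h).2

theorem beta_lipschitz {δ : ℝ} (hδ : 0 < δ) : LipschitzWith (Real.toNNReal (1 / δ)) (beta δ) :=
  LipschitzWith.of_dist_le_mul fun r s => by
    rw [Real.dist_eq, Real.dist_eq, Real.coe_toNNReal _ (by positivity)]
    exact abs_beta_sub_le hδ r s

theorem beta_remainder {δ : ℝ} (hδ : 0 < δ) (r s : ℝ) :
    |beta δ r - beta δ s - betaDeriv δ s * (r - s)| ≤ 1 / δ * (r - s) ^ 2 := by
  have : beta δ r - beta δ s - betaDeriv δ s * (r - s) =
      1 / δ * (beta 1 r - beta 1 s - betaDeriv 1 s * (r - s)) := by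
    rw [beta_eq, beta_eq δ s, betaDeriv_eq]; ring
  rw [this, abs_mul, abs_of_pos (show 0 < 1 / δ by positivity)]
  exact mul_le_mul_of_nonneg_left (beta_one_remainder r s) (by positivity)

/-- The quadratic bound only puts the remainder in `L¹`; this linear one controls it in `L²`. -/
theorem beta_remainder' {δ : ℝ} (hδ : 0 < δ) (r s : ℝ) :
    |beta δ r - beta δ s - betaDeriv δ s * (r - s)| ≤ 2 / δ * |r - s| := by
  refine (abs_sub _ _).trans ?_
  rw [abs_mul]
  have h1 := abs_beta_sub_le hδ r s
  have h2 := mul_le_mul_of_nonneg_right (abs_betaDeriv_le hδ s) (abs_nonneg (r - s))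
  calc _ ≤ 1 / δ * |r - s| + 1 / δ * |r - s| := add_le_add h1 h2
    _ = _ := by ring

theorem hasDerivAt_beta {δ : ℝ} (hδ : 0 < δ) (s : ℝ) : HasDerivAt (beta δ) (betaDeriv δ s) s := by
  rw [hasDerivAt_iff_isLittleO]
  refine Asymptotics.IsBigO.trans_isLittleO (g := fun r => (r - s) ^ 2)
    (Asymptotics.IsBigO.of_bound (1 / δ) (Eventually.of_forall fun r => ?_)) ?_
  · rw [Real.norm_eq_abs, Real.norm_eq_abs, abs_of_nonneg (sq_nonneg (r - s)), smul_eq_mul, mul_comm (r - s)]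
    exact beta_remainder hδ r s
  · have : Tendsto (fun r => r - s) (𝓝 s) (𝓝 0) := by
      simpa using (continuous_sub_right s).tendsto s
    exact (Asymptotics.isLittleO_pow_id (𝕜 := ℝ) one_lt_two).comp_tendsto this

theorem betaDeriv_continuous {δ : ℝ} : Continuous (betaDeriv δ) := by
  have : betaDeriv δ = fun r => 1 / δ * (-2 * max (min r 0) (-(1 / 2))) := by
    ext r
    simp only [betaDeriv]
    split_ifs with h1 h2
    · rw [min_eq_right h1]; norm_num
    · rw [min_eq_left (by linarith), max_eq_left h2]
    · rw [min_eq_left (by linarith), max_eq_right (by linarith)]; norm_num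
  rw [this]
  fun_prop

/-- This is concavity of the penalty: its tangent at `r` lies above the value `0` at the origin. -/
theorem abs_beta_le {δ : ℝ} (hδ : 0 < δ) (r : ℝ) : |beta δ r| ≤ betaDeriv δ r * |r| := by
  rw [beta_eq, betaDeriv_eq, abs_mul, abs_of_pos (show 0 < 1 / δ by positivity), mul_assoc]
  refine mul_le_mul_of_nonneg_left ?_ (by positivity)
  rcases le_total 0 r with h | h
  · simp [beta, betaDeriv, h]
  · rw [abs_of_nonpos h, abs_le]
    simp only [beta, betaDeriv]
    constructor <;> split_ifs <;> nlinarith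

/-- Equality holds on the quadratic branch; on the linear branch the claim is `r² + r/2 ≥ 0`, true
for `r ≤ -1/2`. Together with `abs_beta_le` this drives the limit of `(ξ^δ, p^δ)`. -/
theorem betaDeriv_mul_sq_le {δ : ℝ} (hδ : 0 < δ) (r : ℝ) :
    betaDeriv δ r * r ^ 2 ≤ 2 * (beta δ r * r) := by
  have : betaDeriv 1 r * r ^ 2 ≤ 2 * (beta 1 r * r) := by
    simp only [beta, betaDeriv]
    split_ifs with h1 h2
    · simp
    · nlinarith [mul_nonneg (sq_nonneg r) (show 0 ≤ -r by linarith)]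
    · nlinarith
  have h2 := mul_le_mul_of_nonneg_left this (show 0 ≤ 1 / δ by positivity)
  rw [beta_eq, betaDeriv_eq]
  linarith

theorem min_zero_sq_le (r : ℝ) : (min r 0) ^ 2 ≤ |beta 1 r| + 4 * beta 1 r ^ 2 := by
  rw [abs_of_nonpos (beta_nonpos one_pos r)]
  rcases le_total 0 r with h | h
  · simp [beta, h]
  · rw [min_eq_left h]
    simp only [beta]
    split_ifs with h1 h2
    · have : r = 0 := le_antisymm h h1
      simp [this]
    · nlinarith [sq_nonneg (r ^ 2)]
    · nlinarith

/-! ### The bilinear form as a continuous map -/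

section Multiplication

variable {α : Type*} [MeasurableSpace α] {μ : Measure α}

theorem ae_abs_le_of_memLp_top {b : α → ℝ} (hb : MemLp b ⊤ μ) :
    ∀ᵐ x ∂μ, |b x| ≤ (eLpNorm b ⊤ μ).toReal := by
  have h := ae_le_eLpNormEssSup (f := b) (μ := μ)
  rw [← eLpNorm_exponent_top] at h
  filter_upwards [h] with x hx
  rw [← Real.norm_eq_abs, ← toReal_enorm]
  exact ENNReal.toReal_mono hb.2.ne hx

/-- Multiplication by an essentially bounded function on `L²`. -/
noncomputable def mulL {b : α → ℝ} (hb : MemLp b ⊤ μ) : Lp ℝ 2 μ →L[ℝ] Lp ℝ 2 μ :=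
  LinearMap.mkContinuous
    { toFun := fun u => (MemLp.mul (r := 2) (Lp.memLp u) hb).toLp
      map_add' := fun u v => by
        rw [← MemLp.toLp_add]
        refine MemLp.toLp_congr _ _ ?_
        filter_upwards [Lp.coeFn_add u v] with x hx
        simp only [Pi.mul_apply, Pi.add_apply, hx, mul_add]
      map_smul' := fun c u => by
        rw [RingHom.id_apply, ← MemLp.toLp_const_smul]
        refine MemLp.toLp_congr _ _ ?_
        filter_upwards [Lp.coeFn_smul c u] with x hx
        simp only [Pi.mul_apply, hx, Pi.smul_apply, smul_eq_mul]
        ring }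
    (eLpNorm b ⊤ μ).toReal fun u => by
      refine Lp.norm_le_mul_norm_of_ae_le_mul ?_
      filter_upwards [MemLp.coeFn_toLp (MemLp.mul (r := 2) (Lp.memLp u) hb),
        ae_abs_le_of_memLp_top hb] with x hx hbx
      simp only [LinearMap.coe_mk, AddHom.coe_mk, hx, Pi.mul_apply, norm_mul, Real.norm_eq_abs]
      exact mul_le_mul_of_nonneg_right hbx (abs_nonneg _)

theorem coeFn_mulL {b : α → ℝ} (hb : MemLp b ⊤ μ) (u : Lp ℝ 2 μ) :
    mulL hb u =ᵐ[μ] fun x => b x * u x :=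
  MemLp.coeFn_toLp (MemLp.mul (r := 2) (Lp.memLp u) hb)

theorem inner_mulL {b : α → ℝ} (hb : MemLp b ⊤ μ) (u v : Lp ℝ 2 μ) :
    inner ℝ (mulL hb u) v = ∫ x, b x * u x * v x ∂μ := by
  rw [L2.inner_def]
  refine integral_congr_ae ?_
  filter_upwards [coeFn_mulL hb u] with x hx
  simp [hx, mul_comm]

theorem L2_inner_eq (u v : Lp ℝ 2 μ) : inner ℝ u v = ∫ x, u x * v x ∂μ := by
  rw [L2.inner_def]
  simp [mul_comm]

theorem L2_integrable_mul (u v : Lp ℝ 2 μ) : Integrable (fun x => u x * v x) μ :=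
  (Lp.memLp u).integrable_mul (Lp.memLp v)

end Multiplication

/-- The bilinear form `a` as a continuous bilinear map on `H₀¹(Ω)`. -/
noncomputable def Coeffs.formL {a : Coeffs n} (ha : a.Admissible Ω) :
    H10 Ω →L[ℝ] H10 Ω →L[ℝ] ℝ :=
  (∑ i, ∑ j, (innerSL ℝ).bilinearComp ((mulL (ha.principal_bdd i j)).comp (gradL i)) (gradL j)) +
    (∑ i, (innerSL ℝ).bilinearComp ((mulL (ha.drift_bdd i)).comp (gradL i)) fnL) +
    (innerSL ℝ).bilinearComp ((mulL ha.zeroth_bdd).comp fnL) fnL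

theorem Coeffs.formL_apply {a : Coeffs n} (ha : a.Admissible Ω) (u v : H10 Ω) :
    Coeffs.formL ha u v = a.form u v := by
  simp only [formL, form, add_apply, sum_apply,
    ContinuousLinearMap.bilinearComp_apply, ContinuousLinearMap.comp_apply, innerSL_apply_apply,
    inner_mulL, gradL_apply, fnL_apply]

/-! ### The superposition operator of the penalty -/

/-- The superposition operator `u ↦ β_δ(u)` on `L²(Ω)`. -/
noncomputable def betaL {δ : ℝ} (hδ : 0 < δ) (u : L2 Ω) : L2 Ω :=
  (beta_lipschitz hδ).compLp (beta_zero δ) u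

theorem coeFn_betaL {δ : ℝ} (hδ : 0 < δ) (u : L2 Ω) :
    betaL hδ u =ᵐ[volume.restrict Ω] fun x => beta δ (u x) :=
  (beta_lipschitz hδ).coeFn_compLp (beta_zero δ) u

theorem norm_betaL_sub_le {δ : ℝ} (hδ : 0 < δ) (u v : L2 Ω) :
    ‖betaL hδ u - betaL hδ v‖ ≤ 1 / δ * ‖u - v‖ := by
  have := (beta_lipschitz hδ).norm_compLp_sub_le (beta_zero δ) u v
  rwa [Real.coe_toNNReal _ (by positivity)] at this

@[simp] theorem betaL_zero {δ : ℝ} (hδ : 0 < δ) : betaL hδ (0 : L2 Ω) = 0 :=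
  (beta_lipschitz hδ).compLp_zero (beta_zero δ)

theorem norm_betaL_le {δ : ℝ} (hδ : 0 < δ) (u : L2 Ω) : ‖betaL hδ u‖ ≤ 1 / δ * ‖u‖ := by
  simpa using norm_betaL_sub_le hδ u 0

theorem betaL_continuous {δ : ℝ} (hδ : 0 < δ) : Continuous (betaL hδ : L2 Ω → L2 Ω) :=
  (beta_lipschitz hδ).continuous_compLp (beta_zero δ)

theorem inner_betaL_sub_nonneg {δ : ℝ} (hδ : 0 < δ) (u v : L2 Ω) :
    0 ≤ inner ℝ (betaL hδ u - betaL hδ v) (u - v) := by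
  rw [L2_inner_eq]
  refine integral_nonneg_of_ae ?_
  filter_upwards [coeFn_betaL hδ u, coeFn_betaL hδ v, Lp.coeFn_sub u v,
    Lp.coeFn_sub (betaL hδ u) (betaL hδ v)] with x h1 h2 h3 h4
  simp only [h3, h4, Pi.sub_apply, h1, h2, Pi.zero_apply]
  exact beta_sub_mul_nonneg hδ _ _

theorem inner_betaL_self_nonneg {δ : ℝ} (hδ : 0 < δ) (u : L2 Ω) : 0 ≤ inner ℝ (betaL hδ u) u := by
  simpa using inner_betaL_sub_nonneg hδ u 0

theorem betaL_nonpos {δ : ℝ} (hδ : 0 < δ) (u : L2 Ω) :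
    ∀ᵐ x ∂(volume.restrict Ω), betaL hδ u x ≤ 0 := by
  filter_upwards [coeFn_betaL hδ u] with x hx
  rw [hx]
  exact beta_nonpos hδ _

theorem betaL_eq_smul {δ : ℝ} (hδ : 0 < δ) (u : L2 Ω) :
    betaL hδ u = (1 / δ) • betaL one_pos u := by
  refine Lp.ext ?_
  filter_upwards [coeFn_betaL hδ u, coeFn_betaL one_pos u,
    Lp.coeFn_smul (1 / δ) (betaL one_pos u)] with x h1 h2 h3
  rw [h1, h3, Pi.smul_apply, h2, beta_eq, smul_eq_mul]

theorem integral_beta_eq {δ : ℝ} (hδ : 0 < δ) (φ y : H10 Ω) (v : L2 Ω) :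
    ∫ x in Ω, beta δ (fnOf y x - fnOf φ x) * v x = inner ℝ (betaL hδ (fnOf (y - φ))) v := by
  rw [L2_inner_eq]
  refine integral_congr_ae ?_
  filter_upwards [coeFn_betaL hδ (fnOf (y - φ)), Lp.coeFn_sub (fnOf y) (fnOf φ)] with x h1 h2
  rw [h1, fnOf_sub, h2, Pi.sub_apply]

theorem xiPairing_eq {δ : ℝ} (hδ : 0 < δ) (φ y : H10 Ω) (v : L2 Ω) :
    xiPairing δ φ y v = inner ℝ (betaL hδ (fnOf (y - φ))) v := integral_beta_eq hδ φ y v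

theorem isPenalizedState_iff {a : Coeffs n} {f : L2 Ω} {δ : ℝ} (hδ : 0 < δ) {φ y : H10 Ω} :
    IsPenalizedState a f δ φ y ↔
      ∀ v, a.form y v + inner ℝ (betaL hδ (fnOf (y - φ))) (fnOf v) = inner ℝ f (fnOf v) := by
  simp only [IsPenalizedState, integral_beta_eq hδ]

theorem betaDeriv_memLp {δ : ℝ} (hδ : 0 < δ) (w : L2 Ω) :
    MemLp (fun x => betaDeriv δ (w x)) ⊤ (volume.restrict Ω) :=
  memLp_top_of_bound (betaDeriv_continuous.comp_aestronglyMeasurable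
    (Lp.aestronglyMeasurable w)) (1 / δ) (Eventually.of_forall fun x => by
      simpa using abs_betaDeriv_le hδ (w x))

theorem integral_betaDeriv_eq {δ : ℝ} (hδ : 0 < δ) (φ y : H10 Ω) (u v : L2 Ω) :
    ∫ x in Ω, betaDeriv δ (fnOf y x - fnOf φ x) * u x * v x =
      inner ℝ (mulL (betaDeriv_memLp hδ (fnOf (y - φ))) u) v := by
  rw [inner_mulL]
  refine integral_congr_ae ?_
  filter_upwards [Lp.coeFn_sub (fnOf y) (fnOf φ)] with x h2
  rw [fnOf_sub, h2, Pi.sub_apply]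

theorem isAdjointState_iff {a : Coeffs n} {z : L2 Ω} {δ : ℝ} (hδ : 0 < δ) {φ y p : H10 Ω} :
    IsAdjointState a z δ φ y p ↔ ∀ w, a.form w p +
      inner ℝ (mulL (betaDeriv_memLp hδ (fnOf (y - φ))) (fnOf p)) (fnOf w) =
        inner ℝ (fnOf y - z) (fnOf w) := by
  simp only [IsAdjointState, integral_betaDeriv_eq hδ]

end ObstacleControl

namespace ObstacleControl

/-! ### Weak sequential compactness in Hilbert spaces -/

section Weak

variable {H : Type*} [NormedAddCommGroup H] [InnerProductSpace ℝ H]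

theorem WeaklyTendsto.map {ι K : Type*} [NormedAddCommGroup K] [InnerProductSpace ℝ K]
    [CompleteSpace H] [CompleteSpace K] {u : ι → H} {l : Filter ι} {u₀ : H}
    (h : WeaklyTendsto u l u₀) (T : H →L[ℝ] K) :
    WeaklyTendsto (fun k => T (u k)) l (T u₀) := fun w => by
  simpa only [ContinuousLinearMap.adjoint_inner_right] using h (T.adjoint w)

theorem WeaklyTendsto.apply {ι : Type*} [CompleteSpace H] {u : ι → H} {l : Filter ι} {u₀ : H}
    (h : WeaklyTendsto u l u₀) (T : H →L[ℝ] ℝ) :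
    Tendsto (fun k => T (u k)) l (𝓝 (T u₀)) := by
  have key : ∀ x, T x = inner ℝ x ((InnerProductSpace.toDual ℝ H).symm T) := fun x => by
    rw [real_inner_comm, InnerProductSpace.toDual_symm_apply]
  simp only [key]
  exact h _

/-- A weakly convergent sequence paired with a bounded sequence that converges strongly. -/
theorem WeaklyTendsto.apply₂ {ι K : Type*} [CompleteSpace H] [NormedAddCommGroup K]
    [NormedSpace ℝ K] {u : ι → H} {v : ι → K} {l : Filter ι} {u₀ : H} {v₀ : K}
    (h : WeaklyTendsto u l u₀) {C : ℝ} (hC : ∀ᶠ k in l, ‖u k‖ ≤ C) (hv : Tendsto v l (𝓝 v₀))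
    (B : K →L[ℝ] H →L[ℝ] ℝ) : Tendsto (fun k => B (v k) (u k)) l (𝓝 (B v₀ u₀)) := by
  have h1 := h.apply (B v₀)
  have h2 : Tendsto (fun k => B (v k - v₀) (u k)) l (𝓝 0) := by
    have h3 : Tendsto (fun k => ‖B‖ * ‖v k - v₀‖ * C) l (𝓝 0) := by
      have := ((tendsto_iff_norm_sub_tendsto_zero.1 hv).const_mul ‖B‖).mul_const C
      simpa using this
    refine squeeze_zero_norm' ?_ h3
    filter_upwards [hC] with k hk
    refine (B.le_opNorm₂ _ _).trans ?_
    exact mul_le_mul_of_nonneg_left hk (by positivity)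
  have := h1.add h2
  rw [add_zero] at this
  refine this.congr fun k => ?_
  rw [map_sub, sub_apply]
  ring

theorem exists_weaklyTendsto_of_bounded [CompleteSpace H] {u : ℕ → H} {C : ℝ}
    (hC : ∀ k, ‖u k‖ ≤ C) :
    ∃ (u₀ : H) (σ : ℕ → ℕ), StrictMono σ ∧ WeaklyTendsto (fun k => u (σ k)) atTop u₀ := by
  -- Sequential Banach–Alaoglu needs separability, so it is applied in the closed span of the
  -- sequence; a test vector enters only through its projection onto `V`.
  let V : Submodule ℝ H := (Submodule.span ℝ (Set.range u)).topologicalClosure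
  have hVc : CompleteSpace V := (Submodule.isClosed_topologicalClosure _).completeSpace_coe
  have hsep : TopologicalSpace.SeparableSpace V := by
    have : TopologicalSpace.IsSeparable (V : Set H) := by
      rw [Submodule.topologicalClosure_coe]
      exact ((Set.countable_range u).isSeparable.span).closure
    exact this.separableSpace
  have hu : ∀ k, u k ∈ V := fun k =>
    Submodule.le_topologicalClosure _ (Submodule.subset_span ⟨k, rfl⟩)
  let F : ℕ → WeakDual ℝ V := fun k =>
    StrongDual.toWeakDual (InnerProductSpace.toDual ℝ V ⟨u k, hu k⟩)
  obtain ⟨G, -, σ, hσ, hG⟩ := WeakDual.isSeqCompact_closedBall ℝ V 0 C (x := F) fun k => by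
    simp only [Set.mem_preimage, Metric.mem_closedBall, dist_zero_right]
    change ‖InnerProductSpace.toDual ℝ V ⟨u k, hu k⟩‖ ≤ C
    rw [LinearIsometryEquiv.norm_map]
    exact hC k
  let g : V := (InnerProductSpace.toDual ℝ V).symm (WeakDual.toStrongDual G)
  refine ⟨g, σ, hσ, fun w => ?_⟩
  have h1 := (WeakDual.eval_continuous (V.orthogonalProjectionOnto w)).continuousAt.tendsto.comp hG
  have key : ∀ x : V, inner ℝ (x : H) w = inner ℝ x (V.orthogonalProjectionOnto w) := fun x => by
    rw [← Submodule.inner_orthogonalProjectionOnto_eq_of_mem_left]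
  rw [key]
  have h2 : inner ℝ g (V.orthogonalProjectionOnto w) = G (V.orthogonalProjectionOnto w) := by
    simp only [g, InnerProductSpace.toDual_symm_apply]
    rfl
  rw [h2]
  refine h1.congr fun k => ?_
  exact (key ⟨u (σ k), hu _⟩).symm

theorem exists_weaklyTendsto_of_eventually_bounded [CompleteSpace H] {u : ℕ → H} {C : ℝ}
    (hC : ∀ᶠ k in atTop, ‖u k‖ ≤ C) :
    ∃ (u₀ : H) (σ : ℕ → ℕ), StrictMono σ ∧ WeaklyTendsto (fun k => u (σ k)) atTop u₀ := by
  obtain ⟨N, hN⟩ := eventually_atTop.1 hC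
  obtain ⟨u₀, σ, hσ, h⟩ := exists_weaklyTendsto_of_bounded (u := fun k => u (k + N)) (C := C)
    fun k => hN _ (by omega)
  exact ⟨u₀, fun k => σ k + N, fun i j hij => by simpa using hσ hij, h⟩

end Weak

end ObstacleControl

namespace ObstacleControl

/-! ### Solvability and stability of the state equations -/

/-- A Lipschitz, strongly monotone map of a Hilbert space has a zero. -/
theorem exists_eq_zero_of_strongly_monotone {H : Type*} [NormedAddCommGroup H]
    [InnerProductSpace ℝ H] [CompleteSpace H] (F : H → H) {K m : ℝ} (hm : 0 < m)
    (hK : ∀ x y, ‖F x - F y‖ ≤ K * ‖x - y‖)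
    (hF : ∀ x y, m * ‖x - y‖ ^ 2 ≤ inner ℝ (F x - F y) (x - y)) : ∃ x, F x = 0 := by
  -- Enlarging the Lipschitz constant to at least `m` makes `q ≥ 0`. The step `ρ = m / L²` minimizes
  -- the contraction factor `1 - 2ρm + ρ²L²`.
  set L := max K m with hL
  have hLm : m ≤ L := le_max_right _ _
  have hLpos : 0 < L := hm.trans_le hLm
  set ρ := m / L ^ 2 with hρ
  have hρpos : 0 < ρ := by positivity
  set q := 1 - m ^ 2 / L ^ 2 with hq
  have hq0 : 0 ≤ q := by
    rw [hq, sub_nonneg, div_le_one (by positivity)]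
    exact pow_le_pow_left₀ hm.le hLm 2
  have hq1 : q < 1 := by
    have : 0 < m ^ 2 / L ^ 2 := by positivity
    linarith
  have key : ∀ x y, ‖(x - ρ • F x) - (y - ρ • F y)‖ ^ 2 ≤ q * ‖x - y‖ ^ 2 := fun x y => by
    have e : (x - ρ • F x) - (y - ρ • F y) = (x - y) - ρ • (F x - F y) := by
      rw [smul_sub]; abel
    have hk : ‖F x - F y‖ ^ 2 ≤ L ^ 2 * ‖x - y‖ ^ 2 := by
      rw [← mul_pow]
      exact pow_le_pow_left₀ (norm_nonneg _) ((hK x y).trans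
        (mul_le_mul_of_nonneg_right (le_max_left _ _) (norm_nonneg _))) 2
    rw [e, norm_sub_sq_real, norm_smul, mul_pow, inner_smul_right, real_inner_comm,
      Real.norm_eq_abs, sq_abs]
    have h1 := mul_le_mul_of_nonneg_left (hF x y) hρpos.le
    have h2 := mul_le_mul_of_nonneg_left hk (sq_nonneg ρ)
    have e1 : ρ * (m * ‖x - y‖ ^ 2) = m ^ 2 / L ^ 2 * ‖x - y‖ ^ 2 := by rw [hρ]; ring
    have e2 : ρ ^ 2 * (L ^ 2 * ‖x - y‖ ^ 2) = m ^ 2 / L ^ 2 * ‖x - y‖ ^ 2 := by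
      rw [hρ]; field_simp
    rw [e1] at h1
    rw [e2] at h2
    rw [hq]
    nlinarith
  have hcon : ContractingWith (Real.toNNReal (Real.sqrt q)) (fun x => x - ρ • F x) := by
    refine ⟨?_, LipschitzWith.of_dist_le_mul fun x y => ?_⟩
    · rw [← NNReal.coe_lt_coe, Real.coe_toNNReal _ (Real.sqrt_nonneg _), NNReal.coe_one]
      rw [Real.sqrt_lt' one_pos]; simpa using hq1
    · rw [Real.coe_toNNReal _ (Real.sqrt_nonneg _), dist_eq_norm, dist_eq_norm]
      refine le_of_sq_le_sq ?_ (by positivity)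
      rw [mul_pow, Real.sq_sqrt hq0]
      exact key x y
  refine ⟨hcon.fixedPoint, ?_⟩
  have h := hcon.fixedPoint_isFixedPt
  simp only [Function.IsFixedPt, sub_eq_self] at h
  exact (smul_eq_zero.1 h).resolve_left hρpos.ne'

variable {n : ℕ} {Ω : Set (EuclideanSpace ℝ (Fin n))} {a : Coeffs n} {f : L2 Ω}

/-- Bilinearity, boundedness with constant `M` and coercivity with constant `m` of the form. -/
structure Coeffs.IsCoerciveForm (a : Coeffs n) (Ω : Set (EuclideanSpace ℝ (Fin n)))
    (M m : ℝ) : Prop where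
  form_sub_left : ∀ u v w : H10 Ω, a.form (u - v) w = a.form u w - a.form v w
  form_sub_right : ∀ u v w : H10 Ω, a.form u (v - w) = a.form u v - a.form u w
  nonneg : 0 ≤ M
  abs_form_le : ∀ u v : H10 Ω, |a.form u v| ≤ M * ‖u‖ * ‖v‖
  pos : 0 < m
  coercive : ∀ u : H10 Ω, m * ‖u‖ ^ 2 ≤ a.form u u

theorem exists_bound_of_bilinear {E : Type*} [SeminormedAddCommGroup E] [NormedSpace ℝ E]
    (B : E →L[ℝ] E →L[ℝ] ℝ) : ∃ M, 0 ≤ M ∧ ∀ u v, |B u v| ≤ M * ‖u‖ * ‖v‖ :=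
  ⟨‖B‖, B.opNorm_nonneg, B.le_opNorm₂⟩

theorem Coeffs.Admissible.exists_isCoerciveForm (ha : a.Admissible Ω) :
    ∃ M m, a.IsCoerciveForm Ω M m := by
  obtain ⟨m, hm, hB.coercive⟩ := ha.coercive
  obtain ⟨M, hM, hb⟩ := exists_bound_of_bilinear (formL ha)
  refine ⟨M, m, fun u v w => ?_, fun u v w => ?_, hM, fun u v => ?_, hm, hB.coercive⟩
  · simp only [← formL_apply ha, map_sub, sub_apply]
  · simp only [← formL_apply ha, map_sub]
  · rw [← formL_apply ha]
    exact hb u v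

/-- The Riesz representative `R y` of the residual is Lipschitz, with constant `M + 1/δ`. Coercivity
and monotonicity of the penalty make it strongly monotone with constant `m`. -/
theorem exists_isPenalizedState (ha : a.Admissible Ω) (f : L2 Ω) {δ : ℝ} (hδ : 0 < δ)
    (φ : H10 Ω) : ∃ y, IsPenalizedState a f δ φ y := by
  obtain ⟨M, m, hB⟩ := ha.exists_isCoerciveForm
  let R : H10 Ω → H10 Ω := fun y => (InnerProductSpace.toDual ℝ (H10 Ω)).symm
    (a.formL ha y + (innerSL ℝ (betaL hδ (fnOf (y - φ)) - f)).comp fnL)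
  have hR : ∀ y v, inner ℝ (R y) v =
      a.form y v + inner ℝ (betaL hδ (fnOf (y - φ)) - f) (fnOf v) := fun y v => by
    simp only [R, InnerProductSpace.toDual_symm_apply, add_apply, Coeffs.formL_apply,
      ContinuousLinearMap.comp_apply, innerSL_apply_apply, fnL_apply]
  have hR' : ∀ y y' v, inner ℝ (R y - R y') v = a.form (y - y') v +
      inner ℝ (betaL hδ (fnOf (y - φ)) - betaL hδ (fnOf (y' - φ))) (fnOf v) := fun y y' v => by
    rw [inner_sub_left, hR, hR, hB.form_sub_left, inner_sub_left, inner_sub_left, inner_sub_left]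
    ring
  have hsub : ∀ y y' : H10 Ω, fnOf (y - φ) - fnOf (y' - φ) = fnOf (y - y') := fun y y' => by
    simp
  have hLip : ∀ y y', ‖R y - R y'‖ ≤ (M + 1 / δ) * ‖y - y'‖ := fun y y' => by
    by_cases h0 : ‖R y - R y'‖ = 0
    · rw [h0]; exact mul_nonneg (add_nonneg hB.nonneg (by positivity)) (norm_nonneg _)
    have hpos : 0 < ‖R y - R y'‖ := lt_of_le_of_ne (norm_nonneg _) (Ne.symm h0)
    refine le_of_mul_le_mul_right ?_ hpos
    rw [← real_inner_self_eq_norm_mul_norm, hR']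
    have h1 := (le_abs_self _).trans (hB.abs_form_le (y - y') (R y - R y'))
    have h2 := (real_inner_le_norm (betaL hδ (fnOf (y - φ)) - betaL hδ (fnOf (y' - φ)))
      (fnOf (R y - R y')))
    have h3 := norm_betaL_sub_le hδ (fnOf (y - φ)) (fnOf (y' - φ))
    rw [hsub] at h3
    have h4 := norm_fnOf_le (y - y')
    have h5 := norm_fnOf_le (R y - R y')
    have h6 : ‖betaL hδ (fnOf (y - φ)) - betaL hδ (fnOf (y' - φ))‖ ≤ 1 / δ * ‖y - y'‖ :=
      h3.trans (mul_le_mul_of_nonneg_left h4 (by positivity))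
    have h7 := mul_le_mul h6 h5 (norm_nonneg _) (by positivity)
    calc _ ≤ M * ‖y - y'‖ * ‖R y - R y'‖ + 1 / δ * ‖y - y'‖ * ‖R y - R y'‖ := by
          linarith
      _ = _ := by ring
  have hMono : ∀ y y', m * ‖y - y'‖ ^ 2 ≤ inner ℝ (R y - R y') (y - y') := fun y y' => by
    have := inner_betaL_sub_nonneg hδ (fnOf (y - φ)) (fnOf (y' - φ))
    rw [hsub] at this
    rw [hR']
    linarith [hB.coercive (y - y')]
  obtain ⟨y, hy⟩ := exists_eq_zero_of_strongly_monotone R hB.pos hLip hMono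
  refine ⟨y, (isPenalizedState_iff hδ).2 fun v => ?_⟩
  have := hR y v
  rw [hy, inner_zero_left, inner_sub_left] at this
  linarith

theorem le_div_of_mul_sq_le {m t c : ℝ} (hm : 0 < m) (ht : 0 ≤ t) (hc : 0 ≤ c)
    (h : m * t ^ 2 ≤ c * t) : t ≤ c / m := by
  rcases ht.eq_or_lt with h0 | h0
  · rw [← h0]; positivity
  · rw [le_div_iff₀ hm]
    nlinarith

/-! ### Bounds and Lipschitz dependence of the states on the obstacle -/

section Stability

variable {M m : ℝ} (hB : a.IsCoerciveForm Ω M m)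

include hB

/-- Subtracting the equations and testing with `(y - φ) - (y' - φ')` gives the penalty difference a
sign, so it can be dropped and the constant does not see `δ`. -/
theorem IsPenalizedState.norm_sub_le {δ : ℝ} (hδ : 0 < δ) {φ φ' y y' : H10 Ω}
    (h : IsPenalizedState a f δ φ y) (h' : IsPenalizedState a f δ φ' y') :
    ‖y - y'‖ ≤ M / m * ‖φ - φ'‖ := by
  rw [isPenalizedState_iff hδ] at h h'
  have e : (y - y') - (φ - φ') = (y - φ) - (y' - φ') := by abel
  have h1 := h ((y - y') - (φ - φ'))
  have h2 := h' ((y - y') - (φ - φ'))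
  have h3 := inner_betaL_sub_nonneg hδ (fnOf (y - φ)) (fnOf (y' - φ'))
  rw [← fnOf_sub (y - φ), ← e, inner_sub_left] at h3
  have h4 : a.form (y - y') ((y - y') - (φ - φ')) ≤ 0 := by
    rw [hB.form_sub_left]; linarith
  rw [hB.form_sub_right] at h4
  have h5 := (le_abs_self _).trans (hB.abs_form_le (y - y') (φ - φ'))
  have h6 := hB.coercive (y - y')
  have := le_div_of_mul_sq_le hB.pos (norm_nonneg (y - y')) (c := M * ‖φ - φ'‖)
    (mul_nonneg hB.nonneg (norm_nonneg _)) (by linarith)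
  rwa [mul_div_right_comm] at this

/-- Shifting each state by `±(φ - φ')` makes it a competitor in the other inequality. -/
theorem IsObstacleState.norm_sub_le {φ φ' y y' : H10 Ω}
    (h : IsObstacleState a f φ y) (h' : IsObstacleState a f φ' y') :
    ‖y - y'‖ ≤ M / m * ‖φ - φ'‖ := by
  have h1 := h.2 (y' + (φ - φ')) (by
    filter_upwards [h'.1, Lp.coeFn_add (fnOf y') (fnOf (φ - φ')),
      Lp.coeFn_sub (fnOf φ) (fnOf φ')] with x h1 h2 h3
    rw [fnOf_add, h2, Pi.add_apply, fnOf_sub, h3, Pi.sub_apply]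
    linarith)
  have h2 := h'.2 (y - (φ - φ')) (by
    filter_upwards [h.1, Lp.coeFn_sub (fnOf y) (fnOf (φ - φ')),
      Lp.coeFn_sub (fnOf φ) (fnOf φ')] with x h1 h2 h3
    rw [fnOf_sub y, h2, Pi.sub_apply, fnOf_sub φ, h3, Pi.sub_apply]
    linarith)
  have e1 : y' + (φ - φ') - y = (φ - φ') - (y - y') := by abel
  have e2 : y - (φ - φ') - y' = (y - y') - (φ - φ') := by abel
  rw [e1] at h1
  rw [e2] at h2
  rw [hB.form_sub_right y, fnOf_sub (φ - φ'), inner_sub_right] at h1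
  rw [hB.form_sub_right y', fnOf_sub (y - y'), inner_sub_right] at h2
  have h4 : a.form (y - y') (y - y') ≤ a.form (y - y') (φ - φ') := by
    rw [hB.form_sub_left y y' (y - y'), hB.form_sub_left y y' (φ - φ')]; linarith
  have h5 := (le_abs_self _).trans (hB.abs_form_le (y - y') (φ - φ'))
  have h6 := hB.coercive (y - y')
  have := le_div_of_mul_sq_le hB.pos (norm_nonneg (y - y')) (c := M * ‖φ - φ'‖)
    (mul_nonneg hB.nonneg (norm_nonneg _)) (by linarith)
  rwa [mul_div_right_comm] at this

theorem IsObstacleState.unique {φ y y' : H10 Ω}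
    (h : IsObstacleState a f φ y) (h' : IsObstacleState a f φ y') : y = y' := by
  have := h.norm_sub_le hB h'
  rw [sub_self, norm_zero, mul_zero] at this
  exact sub_eq_zero.1 (norm_le_zero_iff.1 this)

theorem IsPenalizedState.norm_sub_obstacle_le {δ : ℝ} (hδ : 0 < δ) {φ y : H10 Ω}
    (h : IsPenalizedState a f δ φ y) : ‖y - φ‖ ≤ (‖f‖ + M * ‖φ‖) / m := by
  have h1 := (isPenalizedState_iff hδ).1 h (y - φ)
  have h2 := inner_betaL_self_nonneg hδ (fnOf (y - φ))
  have h3 := hB.coercive (y - φ)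
  rw [hB.form_sub_left] at h3
  have h4 := (neg_le_abs _).trans (hB.abs_form_le φ (y - φ))
  have h5 := real_inner_le_norm f (fnOf (y - φ))
  have h6 := mul_le_mul_of_nonneg_left (norm_fnOf_le (y - φ)) (norm_nonneg f)
  refine le_div_of_mul_sq_le hB.pos (norm_nonneg _) (add_nonneg (norm_nonneg _)
    (mul_nonneg hB.nonneg (norm_nonneg _))) ?_
  linarith

end Stability

end ObstacleControl

namespace ObstacleControl

variable {n : ℕ} {Ω : Set (EuclideanSpace ℝ (Fin n))}

/-! ### The chain rule for test functions -/

/-- A continuous function is uniformly close, on a compact interval, to the derivative of a smooth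
function that vanishes at zero. -/
theorem exists_contDiff_deriv_near {g : ℝ → ℝ} (hg : Continuous g) (R : ℝ) {ε : ℝ} (hε : 0 < ε) :
    ∃ B : ℝ → ℝ, ContDiff ℝ ∞ B ∧ B 0 = 0 ∧ ∀ r ∈ Set.Icc (-R) R, |deriv B r - g r| ≤ ε := by
  obtain ⟨p, hp⟩ := exists_polynomial_near_of_continuousOn (-R) R g hg.continuousOn ε hε
  have hd : ∀ r, HasDerivAt (fun r => ∫ t in (0 : ℝ)..r, p.eval t) (p.eval r) r := fun r =>
    (p.continuous.integral_hasStrictDerivAt 0 r).hasDerivAt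
  have hd' : deriv (fun r => ∫ t in (0 : ℝ)..r, p.eval t) = fun r => p.eval r :=
    funext fun r => (hd r).deriv
  refine ⟨fun r => ∫ t in (0 : ℝ)..r, p.eval t, ?_, by simp, fun r hr => ?_⟩
  · rw [contDiff_infty_iff_deriv, hd']
    exact ⟨fun r => (hd r).differentiableAt, by simpa using p.contDiff_aeval (𝕜 := ℝ) ∞⟩
  · rw [hd']
    exact (hp r hr).le

theorem IsTest.comp {ψ : EuclideanSpace ℝ (Fin n) → ℝ} (h : IsTest Ω ψ) {B : ℝ → ℝ}
    (hB : ContDiff ℝ ∞ B) (h0 : B 0 = 0) : IsTest Ω (B ∘ ψ) :=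
  ⟨hB.comp h.1, h.2.1.comp_left h0,
    (closure_mono (Function.support_comp_subset h0 ψ)).trans h.2.2⟩

theorem partialD_comp {ψ : EuclideanSpace ℝ (Fin n) → ℝ} (h : IsTest Ω ψ) {B : ℝ → ℝ}
    (hB : ContDiff ℝ ∞ B) (i : Fin n) (x : EuclideanSpace ℝ (Fin n)) :
    partialD i (B ∘ ψ) x = deriv B (ψ x) * partialD i ψ x := by
  have h1 : HasFDerivAt (B ∘ ψ) (deriv B (ψ x) • fderiv ℝ ψ x) x :=
    ((hB.differentiable (by simp)) (ψ x)).hasDerivAt.comp_hasFDerivAt x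
      (h.differentiable x).hasFDerivAt
  simp [partialD, h1.fderiv]

theorem norm_sub_le_of_ae {α : Type*} [MeasurableSpace α] {μ : Measure α} {u v w : Lp ℝ 2 μ}
    {ε : ℝ} (h : ∀ᵐ x ∂μ, |u x - v x| ≤ ε * |w x|) : ‖u - v‖ ≤ ε * ‖w‖ := by
  refine Lp.norm_le_mul_norm_of_ae_le_mul ?_
  filter_upwards [h, Lp.coeFn_sub u v] with x hx h1
  rwa [h1]

/-- `β_δ(ψ) ∈ H₀¹(Ω)` with `∂ᵢ β_δ(ψ) = β_δ'(ψ) ∂ᵢψ` for a test function `ψ`. -/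
theorem IsTest.exists_beta_comp {δ : ℝ} (hδ : 0 < δ) {ψ : EuclideanSpace ℝ (Fin n) → ℝ}
    (h : IsTest Ω ψ) : ∃ b : H10 Ω, fnOf b = betaL hδ h.toL2 ∧
      ∀ i, gradOf b i = mulL (betaDeriv_memLp hδ h.toL2) (h.partial_isTest i).toL2 := by
  let w : H1Ambient Ω := WithLp.toLp 2 (betaL hδ h.toL2, WithLp.toLp 2 fun i =>
    mulL (betaDeriv_memLp hδ h.toL2) (h.partial_isTest i).toL2)
  suffices hw : w ∈ H10 Ω from ⟨⟨w, hw⟩, rfl, fun i => rfl⟩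
  obtain ⟨R, hR⟩ : ∃ R, ∀ x, |ψ x| ≤ R := by
    obtain ⟨R, hR⟩ := h.1.continuous.bounded_above_of_compact_support h.2.1
    exact ⟨R, hR⟩
  have hcl : IsClosed (H10 Ω : Set (H1Ambient Ω)) := Submodule.isClosed_topologicalClosure _
  refine hcl.closure_subset (Metric.mem_closure_iff.2 fun η hη => ?_)
  -- The approximation error will be at most `ε ‖h.toH10‖`, in the function and in the gradient at
  -- once; the `+ 1` covers the zero function.
  set ε := η / (2 * (‖h.toH10‖ + 1)) with hεdef
  have hε : 0 < ε := by positivity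
  obtain ⟨B, hB, hB0, hBd⟩ := exists_contDiff_deriv_near (betaDeriv_continuous (δ := δ)) R hε
  have hBv : ∀ r ∈ Set.Icc (-R) R, |B r - beta δ r| ≤ ε * |r| := fun r hr => by
    have h0 : (0 : ℝ) ∈ Set.Icc (-R) R := by
      have := hr.1.trans hr.2
      constructor <;> linarith
    have := (convex_Icc (-R) R).norm_image_sub_le_of_norm_hasDerivWithin_le
      (f := fun r => B r - beta δ r) (f' := fun r => deriv B r - betaDeriv δ r) (C := ε)
      (fun r _ => (((hB.differentiable (by simp)) r).hasDerivAt.sub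
        (hasDerivAt_beta hδ r)).hasDerivWithinAt) (fun r hr => hBd r hr) h0 hr
    simpa [hB0] using this
  have ht := h.comp hB hB0
  refine ⟨(ht.toH10 : H1Ambient Ω), ht.toH10.2, ?_⟩
  have hfn : ‖w.fst - ht.toL2‖ ≤ ε * ‖h.toL2‖ := by
    refine norm_sub_le_of_ae ?_
    filter_upwards [coeFn_betaL hδ h.toL2, h.coeFn_toL2, ht.coeFn_toL2] with x h1 h2 h3
    have : w.fst x = beta δ (h.toL2 x) := h1
    rw [this, h2, h3, abs_sub_comm]
    exact hBv _ (abs_le.1 (hR x))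
  have hgr : ∀ i, ‖w.snd i - (ht.partial_isTest i).toL2‖ ≤ ε * ‖(h.partial_isTest i).toL2‖ := by
    intro i
    refine norm_sub_le_of_ae ?_
    filter_upwards [coeFn_mulL (betaDeriv_memLp hδ h.toL2) (h.partial_isTest i).toL2, h.coeFn_toL2,
      (ht.partial_isTest i).coeFn_toL2, (h.partial_isTest i).coeFn_toL2] with x h1 h2 h3 h4
    have : w.snd i x = betaDeriv δ (h.toL2 x) * (h.partial_isTest i).toL2 x := h1
    rw [this, h2, h3, h4, partialD_comp h hB, ← sub_mul, abs_mul, abs_sub_comm]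
    exact mul_le_mul_of_nonneg_right (hBd _ (abs_le.1 (hR x))) (abs_nonneg _)
  have hsq : ‖w - (ht.toH10 : H1Ambient Ω)‖ ^ 2 ≤ (ε * ‖h.toH10‖) ^ 2 := by
    rw [WithLp.prod_norm_sq_eq_of_L2, PiLp.norm_sq_eq_of_L2, mul_pow, H10.norm_sq, mul_add,
      Finset.mul_sum]
    refine add_le_add ?_ (Finset.sum_le_sum fun i _ => ?_)
    · rw [← mul_pow]
      exact pow_le_pow_left₀ (norm_nonneg _) hfn 2
    · rw [← mul_pow]
      exact pow_le_pow_left₀ (norm_nonneg _) (hgr i) 2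
  rw [dist_eq_norm]
  refine (le_of_sq_le_sq hsq (by positivity)).trans_lt ?_
  rw [hεdef, div_mul_eq_mul_div, div_lt_iff₀ (by positivity)]
  nlinarith [norm_nonneg h.toH10]

theorem norm_mulL_le {α : Type*} [MeasurableSpace α] {μ : Measure α} {b : α → ℝ}
    (hb : MemLp b ⊤ μ) {c : ℝ} (hc : ∀ᵐ x ∂μ, |b x| ≤ c) (u : Lp ℝ 2 μ) :
    ‖mulL hb u‖ ≤ c * ‖u‖ := by
  refine Lp.norm_le_mul_norm_of_ae_le_mul ?_
  filter_upwards [hc, coeFn_mulL hb u] with x hx h1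
  rw [h1, norm_mul]
  exact mul_le_mul_of_nonneg_right hx (norm_nonneg _)

/-! ### Lipschitz coefficients -/

/-- A Lipschitz function is a uniform limit of smooth functions with the same Lipschitz constant. -/
theorem LipschitzWith.exists_contDiff_near {g : EuclideanSpace ℝ (Fin n) → ℝ} {K : NNReal}
    (hg : LipschitzWith K g) {ε : ℝ} (hε : 0 < ε) :
    ∃ h : EuclideanSpace ℝ (Fin n) → ℝ, ContDiff ℝ ∞ h ∧ LipschitzWith K h ∧
      ∀ x, |h x - g x| ≤ ε := by
  have hr : 0 < ε / (K + 1) := by positivity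
  -- Averaging over radius `ε / (K + 1)` moves a `K`-Lipschitz function by at most `ε`, also when `K
  -- = 0`.
  let b : ContDiffBump (0 : EuclideanSpace ℝ (Fin n)) :=
    ⟨ε / (K + 1) / 2, ε / (K + 1), by positivity, by linarith⟩
  let h := MeasureTheory.convolution (b.normed volume) g (ContinuousLinearMap.lsmul ℝ ℝ) volume
  have hloc : LocallyIntegrable g (volume : Measure (EuclideanSpace ℝ (Fin n))) :=
    hg.continuous.locallyIntegrable
  have hint : ∀ x, Integrable (fun t => b.normed volume t * g (x - t)) := fun x =>
    (b.continuous_normed.mul (hg.continuous.comp (continuous_sub_left x))).integrable_of_hasCompactSupport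
      (b.hasCompactSupport_normed.mul_right)
  have hh : ∀ x, h x = ∫ t, b.normed volume t * g (x - t) := fun x => by
    simp [h, MeasureTheory.convolution]
  refine ⟨h, ?_, ?_, fun x => ?_⟩
  · exact b.hasCompactSupport_normed.contDiff_convolution_left _ b.contDiff_normed hloc
  · refine LipschitzWith.of_dist_le_mul fun x y => ?_
    rw [hh, hh, dist_eq_norm, ← integral_sub (hint x) (hint y)]
    have hb1 : ∫ t, b.normed volume t * (K * dist x y) = K * dist x y := by
      rw [integral_mul_const, b.integral_normed, one_mul]
    rw [← hb1]
    refine norm_integral_le_of_norm_le (b.integrable_normed.mul_const _)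
      (Eventually.of_forall fun t => ?_)
    rw [← mul_sub, norm_mul, Real.norm_of_nonneg (b.nonneg_normed t)]
    refine mul_le_mul_of_nonneg_left ?_ (b.nonneg_normed t)
    rw [← dist_eq_norm]
    refine (hg.dist_le_mul _ _).trans_eq ?_
    rw [dist_sub_right]
  · rw [← Real.dist_eq]
    refine b.dist_normed_convolution_le hg.continuous.aestronglyMeasurable fun t ht => ?_
    refine (hg.dist_le_mul _ _).trans ?_
    have h1 : dist t x ≤ ε / (K + 1) := (Metric.mem_ball.1 ht).le
    calc (K : ℝ) * dist t x ≤ K * (ε / (K + 1)) := mul_le_mul_of_nonneg_left h1 K.2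
      _ ≤ (K + 1) * (ε / (K + 1)) := mul_le_mul_of_nonneg_right (by linarith) hr.le
      _ = ε := by field_simp

theorem abs_partialD_le_of_lipschitz {h : EuclideanSpace ℝ (Fin n) → ℝ} {K : NNReal}
    (hh : LipschitzWith K h) (i : Fin n) (x : EuclideanSpace ℝ (Fin n)) :
    |partialD i h x| ≤ K := by
  refine ((fderiv ℝ h x).le_opNorm _).trans ?_
  simpa using norm_fderiv_le_of_lipschitz ℝ hh

theorem partialD_mul {h ψ : EuclideanSpace ℝ (Fin n) → ℝ} (hh : ContDiff ℝ ∞ h)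
    (hψ : IsTest Ω ψ) (i : Fin n) (x : EuclideanSpace ℝ (Fin n)) :
    partialD i (fun x => h x * ψ x) x = h x * partialD i ψ x + partialD i h x * ψ x := by
  have h1 := ((hh.differentiable (by simp)) x).hasFDerivAt.mul (hψ.differentiable x).hasFDerivAt
  have h2 := h1.fderiv
  simp only [partialD]
  change (fderiv ℝ (fun x => h x * ψ x) x) _ = _
  erw [h2]
  simp [mul_comm]

/-- The product rule for a weakly differentiable function and a Lipschitz coefficient, in the
integrated form of an `L²`-bound. -/
theorem HasWeakPartial.abs_inner_mulL_le (hΩ : IsOpen Ω) {b : EuclideanSpace ℝ (Fin n) → ℝ}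
    (hb : MemLp b ⊤ (volume.restrict Ω)) {K : NNReal} (hK : LipschitzOnWith K b Ω) {i : Fin n}
    {g g' : L2 Ω} (hg : HasWeakPartial i g g') {ψ : EuclideanSpace ℝ (Fin n) → ℝ}
    (hψ : IsTest Ω ψ) :
    |inner ℝ (mulL hb g) (hψ.partial_isTest i).toL2| ≤
      ((eLpNorm b ⊤ (volume.restrict Ω)).toReal * ‖g'‖ + K * ‖g‖) * ‖hψ.toL2‖ := by
  set c := (eLpNorm b ⊤ (volume.restrict Ω)).toReal
  -- Mollification needs a Lipschitz function on the whole space. The mollified coefficients are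
  -- smooth with partial derivatives bounded by `K`, so the classical product rule applies before `ε
  -- → 0`.
  obtain ⟨b', hb', hbb'⟩ := hK.extend_real
  have key : ∀ ε : ℝ, 0 < ε → |inner ℝ (mulL hb g) (hψ.partial_isTest i).toL2| ≤
      ε * ‖g‖ * ‖(hψ.partial_isTest i).toL2‖ + ((c + ε) * ‖g'‖ + K * ‖g‖) * ‖hψ.toL2‖ := by
    intro ε hε
    obtain ⟨h, hh, hhK, hhb⟩ := hb'.exists_contDiff_near hε
    have hae : ∀ᵐ x ∂(volume.restrict Ω), |h x - b x| ≤ ε := by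
      refine (ae_restrict_iff' hΩ.measurableSet).2 (Eventually.of_forall fun x hx => ?_)
      rw [hbb' hx]
      exact hhb x
    have hc : ∀ᵐ x ∂(volume.restrict Ω), |h x| ≤ c + ε := by
      filter_upwards [hae, ae_abs_le_of_memLp_top hb] with x h1 h2
      have := abs_sub_abs_le_abs_sub (h x) (b x)
      linarith
    have hmem : MemLp h ⊤ (volume.restrict Ω) :=
      memLp_top_of_bound hh.continuous.aestronglyMeasurable _ hc
    have hdc : Continuous (partialD i h) :=
      (hh.continuous_fderiv (by simp)).clm_apply continuous_const
    have hdmem : MemLp (partialD i h) ⊤ (volume.restrict Ω) :=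
      memLp_top_of_bound hdc.aestronglyMeasurable K
        (Eventually.of_forall fun x => abs_partialD_le_of_lipschitz hhK i x)
    have h1 := hg _ (hψ.mul_left hh)
    have e1 : ∫ x in Ω, g x * partialD i (fun x => h x * ψ x) x =
        inner ℝ (mulL hmem g) (hψ.partial_isTest i).toL2 + inner ℝ (mulL hdmem g) hψ.toL2 := by
      rw [L2_inner_eq, L2_inner_eq, ← integral_add (L2_integrable_mul _ _) (L2_integrable_mul _ _)]
      refine integral_congr_ae ?_
      filter_upwards [coeFn_mulL hmem g, coeFn_mulL hdmem g, hψ.coeFn_toL2,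
        (hψ.partial_isTest i).coeFn_toL2] with x a1 a2 a3 a4
      rw [a1, a2, a3, a4, partialD_mul hh hψ]
      ring
    have e2 : ∫ x in Ω, g' x * (h x * ψ x) = inner ℝ (mulL hmem g') hψ.toL2 := by
      rw [L2_inner_eq]
      refine integral_congr_ae ?_
      filter_upwards [coeFn_mulL hmem g', hψ.coeFn_toL2] with x a1 a2
      rw [a1, a2]
      ring
    rw [e1, e2] at h1
    have h2 : ‖mulL hb g - mulL hmem g‖ ≤ ε * ‖g‖ := by
      refine norm_sub_le_of_ae ?_
      filter_upwards [coeFn_mulL hmem g, coeFn_mulL hb g, hae] with x a1 a2 a3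
      rw [a1, a2, ← sub_mul, abs_mul, abs_sub_comm]
      exact mul_le_mul_of_nonneg_right a3 (abs_nonneg _)
    have h3 : inner ℝ (mulL hb g) (hψ.partial_isTest i).toL2 =
        inner ℝ (mulL hb g - mulL hmem g) (hψ.partial_isTest i).toL2
          - inner ℝ (mulL hmem g') hψ.toL2 - inner ℝ (mulL hdmem g) hψ.toL2 := by
      rw [inner_sub_left]
      linarith
    rw [h3]
    have b1 := (abs_real_inner_le_norm (mulL hb g - mulL hmem g) (hψ.partial_isTest i).toL2).trans
      (mul_le_mul_of_nonneg_right h2 (norm_nonneg _))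
    have b2 := (abs_real_inner_le_norm (mulL hmem g') hψ.toL2).trans
      (mul_le_mul_of_nonneg_right (norm_mulL_le hmem hc g') (norm_nonneg _))
    have b3 := (abs_real_inner_le_norm (mulL hdmem g) hψ.toL2).trans
      (mul_le_mul_of_nonneg_right (norm_mulL_le hdmem (c := K)
        (Eventually.of_forall fun x => abs_partialD_le_of_lipschitz hhK i x) g) (norm_nonneg _))
    refine (abs_sub _ _).trans ((add_le_add ((abs_sub _ _).trans (add_le_add b1 b2)) b3).trans_eq ?_)
    ring
  have hlim : Tendsto (fun ε : ℝ => ε * ‖g‖ * ‖(hψ.partial_isTest i).toL2‖ +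
      ((c + ε) * ‖g'‖ + K * ‖g‖) * ‖hψ.toL2‖) (𝓝[>] 0)
      (𝓝 (0 * ‖g‖ * ‖(hψ.partial_isTest i).toL2‖ +
      ((c + 0) * ‖g'‖ + K * ‖g‖) * ‖hψ.toL2‖)) := by
    refine Tendsto.mono_left (Continuous.tendsto ?_ 0) nhdsWithin_le_nhds
    fun_prop
  rw [zero_mul, zero_mul, zero_add, add_zero] at hlim
  exact ge_of_tendsto hlim (eventually_nhdsWithin_of_forall key)

end ObstacleControl

namespace ObstacleControl

variable {n : ℕ} {Ω : Set (EuclideanSpace ℝ (Fin n))} {a : Coeffs n}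

/-! ### The `L²`-bound of the penalty term -/

theorem norm_toH10_le (φ : H2H10 Ω) : ‖toH10 φ‖ ≤ ‖φ‖ := by
  have h : ‖φ‖ = ‖(φ : WithLp 2 (H10 Ω × PiLp 2 (fun _ : Fin n × Fin n => L2 Ω)))‖ := rfl
  refine le_of_sq_le_sq ?_ (norm_nonneg _)
  rw [h, WithLp.prod_norm_sq_eq_of_L2]
  exact le_add_of_nonneg_right (sq_nonneg _)

/-- The second weak partial derivative `∂²φ/∂xᵢ∂xⱼ`. -/
noncomputable def hessOf (φ : H2H10 Ω) (i j : Fin n) : L2 Ω :=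
  (φ : WithLp 2 (H10 Ω × PiLp 2 (fun _ : Fin n × Fin n => L2 Ω))).snd (i, j)

theorem norm_hessOf_le (φ : H2H10 Ω) (i j : Fin n) : ‖hessOf φ i j‖ ≤ ‖φ‖ := by
  have h : ‖φ‖ = ‖(φ : WithLp 2 (H10 Ω × PiLp 2 (fun _ : Fin n × Fin n => L2 Ω)))‖ := rfl
  refine le_of_sq_le_sq ?_ (norm_nonneg _)
  rw [h, WithLp.prod_norm_sq_eq_of_L2]
  refine le_trans ?_ (le_add_of_nonneg_left (sq_nonneg _))
  exact pow_le_pow_left₀ (norm_nonneg _) (PiLp.norm_apply_le _ _) 2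

theorem H2H10.hasWeakPartial (φ : H2H10 Ω) (i j : Fin n) :
    HasWeakPartial j (gradOf (toH10 φ) i) (hessOf φ i j) := φ.2 i j

theorem Coeffs.Admissible.form_eq (ha : a.Admissible Ω) (u v : H10 Ω) : a.form u v =
    (∑ i, ∑ j, inner ℝ (mulL (ha.principal_bdd i j) (gradOf u i)) (gradOf v j)) +
      (∑ i, inner ℝ (mulL (ha.drift_bdd i) (gradOf u i)) (fnOf v)) +
      inner ℝ (mulL ha.zeroth_bdd (fnOf u)) (fnOf v) := by
  simp only [Coeffs.form, inner_mulL]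

theorem continuous_fnOf : Continuous (fnOf : H10 Ω → L2 Ω) := fnL.continuous

theorem continuous_gradOf (i : Fin n) : Continuous (fun u : H10 Ω => gradOf u i) :=
  (gradL i).continuous

theorem Coeffs.Admissible.continuous_form (ha : a.Admissible Ω) :
    Continuous fun q : H10 Ω × H10 Ω => a.form q.1 q.2 := by
  simp only [← Coeffs.formL_apply ha]
  exact ((Coeffs.formL ha).continuous.comp continuous_fst).clm_apply continuous_snd

/-- The elliptic operator is bounded from `H²(Ω) ∩ H₀¹(Ω)` to `L²(Ω)`. -/
theorem Coeffs.Admissible.exists_abs_form_le_H2 (hΩ : IsOpen Ω) (ha : a.Admissible Ω) :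
    ∃ C, 0 ≤ C ∧ ∀ (φ : H2H10 Ω) (v : H10 Ω), |a.form (toH10 φ) v| ≤ C * ‖φ‖ * ‖fnOf v‖ := by
  choose K hK using ha.principal_lip
  let c : Fin n → Fin n → ℝ := fun i j =>
    (eLpNorm (a.principal i j) ⊤ (volume.restrict Ω)).toReal + K i j
  let d : Fin n → ℝ := fun i => (eLpNorm (a.drift i) ⊤ (volume.restrict Ω)).toReal
  let e : ℝ := (eLpNorm a.zeroth ⊤ (volume.restrict Ω)).toReal
  have hc : ∀ i j, 0 ≤ c i j := fun i j => by positivity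
  refine ⟨(∑ i, ∑ j, c i j) + (∑ i, d i) + e, by positivity, fun φ v => ?_⟩
  -- Both sides are continuous in `v`, so it is enough to integrate by parts against test functions.
  induction v using H10.closed_induction with
  | hP =>
    refine isClosed_le ?_ (continuous_const.mul continuous_fnOf.norm)
    exact (ha.continuous_form.comp (Continuous.prodMk_right _)).abs
  | h ψ hψ =>
    have hφ := norm_toH10_le φ
    rw [ha.form_eq, add_mul, add_mul, add_mul, add_mul, Finset.sum_mul, Finset.sum_mul,
      Finset.sum_mul, Finset.sum_mul]
    refine (abs_add_three _ _ _).trans (add_le_add_three ?_ ?_ ?_)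
    · refine (Finset.abs_sum_le_sum_abs _ _).trans (Finset.sum_le_sum fun i _ => ?_)
      rw [Finset.sum_mul, Finset.sum_mul]
      refine (Finset.abs_sum_le_sum_abs _ _).trans (Finset.sum_le_sum fun j _ => ?_)
      refine (HasWeakPartial.abs_inner_mulL_le hΩ (ha.principal_bdd i j) (hK i j)
        (H2H10.hasWeakPartial φ i j) hψ).trans ?_
      refine mul_le_mul_of_nonneg_right ?_ (norm_nonneg _)
      rw [add_mul]
      exact add_le_add (mul_le_mul_of_nonneg_left (norm_hessOf_le φ i j) ENNReal.toReal_nonneg)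
        (mul_le_mul_of_nonneg_left ((norm_gradOf_le _ i).trans hφ) (K i j).2)
    · refine (Finset.abs_sum_le_sum_abs _ _).trans (Finset.sum_le_sum fun i _ => ?_)
      refine (abs_real_inner_le_norm _ _).trans (mul_le_mul_of_nonneg_right ?_ (norm_nonneg _))
      exact (norm_mulL_le _ (ae_abs_le_of_memLp_top (ha.drift_bdd i)) _).trans
        (mul_le_mul_of_nonneg_left ((norm_gradOf_le _ i).trans hφ) ENNReal.toReal_nonneg)
    · refine (abs_real_inner_le_norm _ _).trans (mul_le_mul_of_nonneg_right ?_ (norm_nonneg _))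
      exact (norm_mulL_le _ (ae_abs_le_of_memLp_top ha.zeroth_bdd) _).trans
        (mul_le_mul_of_nonneg_left ((norm_fnOf_le _).trans hφ) ENNReal.toReal_nonneg)

/-- Ellipticity and `β_δ' ≥ 0` make the principal part nonnegative, and `a₀ ≥ 0` with `β_δ(r) r ≥ 0`
does the same for the zeroth order part. Only the drift remains, and it sees just the `L²`-norm of
`b`, so `C` is independent of `δ`. -/
theorem Coeffs.Admissible.exists_form_beta_ge (ha : a.Admissible Ω) :
    ∃ C, 0 ≤ C ∧ ∀ {δ : ℝ} (hδ : 0 < δ) {ψ : EuclideanSpace ℝ (Fin n) → ℝ} (hψ : IsTest Ω ψ)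
      {b : H10 Ω}, fnOf b = betaL hδ hψ.toL2 →
      (∀ i, gradOf b i = mulL (betaDeriv_memLp hδ hψ.toL2) (hψ.partial_isTest i).toL2) →
      -(C * ‖hψ.toH10‖ * ‖fnOf b‖) ≤ a.form hψ.toH10 b := by
  obtain ⟨m, hm, hell⟩ := ha.elliptic
  let d : Fin n → ℝ := fun i => (eLpNorm (a.drift i) ⊤ (volume.restrict Ω)).toReal
  refine ⟨∑ i, d i, Finset.sum_nonneg fun i _ => ENNReal.toReal_nonneg,
    fun {δ} hδ ψ hψ b h0 h1 => ?_⟩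
  rw [ha.form_eq]
  have t1 : 0 ≤ ∑ i, ∑ j,
      inner ℝ (mulL (ha.principal_bdd i j) (gradOf hψ.toH10 i)) (gradOf b j) := by
    simp only [h1, L2_inner_eq]
    rw [← Finset.sum_congr rfl fun i _ => integral_finsetSum _ fun j _ => L2_integrable_mul _ _,
      ← integral_finsetSum _ fun i _ => integrable_finsetSum _ fun j _ => L2_integrable_mul _ _]
    refine integral_nonneg_of_ae ?_
    have e1 : ∀ᵐ x ∂(volume.restrict Ω), ∀ i j,
        mulL (ha.principal_bdd i j) (gradOf hψ.toH10 i) x =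
          a.principal i j x * gradOf hψ.toH10 i x :=
      ae_all_iff.2 fun i => ae_all_iff.2 fun j => coeFn_mulL _ _
    have e2 : ∀ᵐ x ∂(volume.restrict Ω), ∀ j,
        mulL (betaDeriv_memLp hδ hψ.toL2) (hψ.partial_isTest j).toL2 x =
          betaDeriv δ (hψ.toL2 x) * gradOf hψ.toH10 j x :=
      ae_all_iff.2 fun j => coeFn_mulL _ _
    filter_upwards [e1, e2, hell] with x e1 e2 e3
    simp only [e1, e2, Pi.zero_apply]
    have e4 := e3 fun i => gradOf hψ.toH10 i x
    have e5 : 0 ≤ ∑ i, (gradOf hψ.toH10 i x) ^ 2 := Finset.sum_nonneg fun i _ => sq_nonneg _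
    have e6 := mul_nonneg (betaDeriv_nonneg hδ (hψ.toL2 x)) ((mul_nonneg hm.le e5).trans e4)
    refine e6.trans_eq ?_
    rw [Finset.mul_sum]
    refine Finset.sum_congr rfl fun i _ => ?_
    rw [Finset.mul_sum]
    refine Finset.sum_congr rfl fun j _ => ?_
    ring
  have t2 : |∑ i, inner ℝ (mulL (ha.drift_bdd i) (gradOf hψ.toH10 i)) (fnOf b)| ≤
      (∑ i, d i) * ‖hψ.toH10‖ * ‖fnOf b‖ := by
    rw [Finset.sum_mul, Finset.sum_mul]
    refine (Finset.abs_sum_le_sum_abs _ _).trans (Finset.sum_le_sum fun i _ => ?_)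
    refine (abs_real_inner_le_norm _ _).trans (mul_le_mul_of_nonneg_right ?_ (norm_nonneg _))
    exact (norm_mulL_le _ (ae_abs_le_of_memLp_top (ha.drift_bdd i)) _).trans
      (mul_le_mul_of_nonneg_left (norm_gradOf_le _ i) ENNReal.toReal_nonneg)
  have t3 : 0 ≤ inner ℝ (mulL ha.zeroth_bdd (fnOf hψ.toH10)) (fnOf b) := by
    rw [L2_inner_eq, h0]
    refine integral_nonneg_of_ae ?_
    filter_upwards [coeFn_mulL ha.zeroth_bdd (fnOf hψ.toH10), coeFn_betaL hδ hψ.toL2,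
      ha.zeroth_nonneg] with x e1 e2 e3
    rw [e1, e2, Pi.zero_apply, mul_assoc]
    refine mul_nonneg e3 ?_
    rw [mul_comm]
    exact beta_mul_self_nonneg hδ _
  have := neg_abs_le (∑ i, inner ℝ (mulL (ha.drift_bdd i) (gradOf hψ.toH10 i)) (fnOf b))
  linarith

/-- The factor `1 / δ` is harmless: for fixed `δ` this norm only multiplies an approximation error
that tends to zero. -/
theorem norm_beta_comp_le {δ : ℝ} (hδ : 0 < δ) {ψ : EuclideanSpace ℝ (Fin n) → ℝ}
    (hψ : IsTest Ω ψ) {b : H10 Ω} (h0 : fnOf b = betaL hδ hψ.toL2)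
    (h1 : ∀ i, gradOf b i = mulL (betaDeriv_memLp hδ hψ.toL2) (hψ.partial_isTest i).toL2) :
    ‖b‖ ≤ 1 / δ * ‖hψ.toH10‖ := by
  refine le_of_sq_le_sq ?_ (by positivity)
  rw [mul_pow, H10.norm_sq, H10.norm_sq, mul_add, Finset.mul_sum]
  refine add_le_add ?_ (Finset.sum_le_sum fun i _ => ?_)
  · rw [← mul_pow, h0]
    exact pow_le_pow_left₀ (norm_nonneg _) (norm_betaL_le hδ _) 2
  · rw [← mul_pow, h1]
    exact pow_le_pow_left₀ (norm_nonneg _) (norm_mulL_le _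
      (Eventually.of_forall fun x => abs_betaDeriv_le hδ _) _) 2

/-- The `L²`-bound of `β_δ(y - φ)`, uniform in `δ`. -/
theorem Coeffs.Admissible.exists_norm_betaL_le (hΩ : IsOpen Ω) (ha : a.Admissible Ω) :
    ∃ C, 0 ≤ C ∧ ∀ {δ : ℝ} (hδ : 0 < δ) (f : L2 Ω) (φ : H2H10 Ω) (y : H10 Ω),
      IsPenalizedState a f δ (toH10 φ) y →
      ‖betaL hδ (fnOf (y - toH10 φ))‖ ≤ ‖f‖ + C * (‖φ‖ + ‖y - toH10 φ‖) := by
  obtain ⟨M, m, hB⟩ := ha.exists_isCoerciveForm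
  obtain ⟨C₁, hC₁, h₁⟩ := ha.exists_form_beta_ge
  obtain ⟨C₂, hC₂, h₂⟩ := ha.exists_abs_form_le_H2 hΩ
  refine ⟨C₁ + C₂, by positivity, fun {δ} hδ f φ y hy => ?_⟩
  rw [isPenalizedState_iff hδ] at hy
  set w := y - toH10 φ with hw
  set ξ := betaL hδ (fnOf w) with hξ
  -- The admissible test elements `b k` replace `β_δ(w)`. They need to converge to it only in `L²`,
  -- since their `H₀¹`-norms are bounded for fixed `δ`.
  obtain ⟨ψ, hψ, hlim⟩ := H10.exists_seq_test w
  choose b hb0 hb1 using fun k => (hψ k).exists_beta_comp hδ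
  have hblim : Tendsto (fun k => fnOf (b k)) atTop (𝓝 ξ) := by
    simp only [hb0]
    exact (((betaL_continuous hδ).comp continuous_fnOf).tendsto w).comp hlim
  have hdiff : Tendsto (fun k => ‖w - (hψ k).toH10‖) atTop (𝓝 0) := by
    have := (tendsto_const_nhds (x := w)).sub hlim
    simpa using this.norm
  -- Split `y = φ + (w - ψ_k) + ψ_k` in the form. The three parts are handled by the `H²` bound, by
  -- continuity and by the sign estimate.
  have hineq : ∀ k, inner ℝ ξ (fnOf (b k)) ≤ ‖f‖ * ‖fnOf (b k)‖ + C₂ * ‖φ‖ * ‖fnOf (b k)‖ +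
      M * ‖w - (hψ k).toH10‖ * (1 / δ * ‖(hψ k).toH10‖) +
      C₁ * ‖(hψ k).toH10‖ * ‖fnOf (b k)‖ := fun k => by
    have e := hy (b k)
    have e1 := real_inner_le_norm f (fnOf (b k))
    have e2 := (neg_le_abs _).trans (h₂ φ (b k))
    have e3 := (neg_le_abs _).trans (hB.abs_form_le (w - (hψ k).toH10) (b k))
    have e4 := h₁ hδ (hψ k) (hb0 k) (hb1 k)
    have e5 := mul_le_mul_of_nonneg_left (norm_beta_comp_le hδ (hψ k) (hb0 k) (hb1 k))
      (mul_nonneg hB.nonneg (norm_nonneg (w - (hψ k).toH10)))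
    rw [hB.form_sub_left, hw, hB.form_sub_left, ← hw] at e3
    linarith
  have hl : Tendsto (fun k => inner ℝ ξ (fnOf (b k))) atTop (𝓝 (inner ℝ ξ ξ)) :=
    tendsto_const_nhds.inner hblim
  have hr : Tendsto (fun k => ‖f‖ * ‖fnOf (b k)‖ + C₂ * ‖φ‖ * ‖fnOf (b k)‖ +
      M * ‖w - (hψ k).toH10‖ * (1 / δ * ‖(hψ k).toH10‖) +
      C₁ * ‖(hψ k).toH10‖ * ‖fnOf (b k)‖) atTop (𝓝 (‖f‖ * ‖ξ‖ + C₂ * ‖φ‖ * ‖ξ‖ +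
      M * 0 * (1 / δ * ‖w‖) + C₁ * ‖w‖ * ‖ξ‖)) :=
    (((hblim.norm.const_mul _).add (hblim.norm.const_mul _)).add
      ((hdiff.const_mul _).mul (hlim.norm.const_mul _))).add
      ((hlim.norm.const_mul _).mul hblim.norm)
  have hfin := le_of_tendsto_of_tendsto' hl hr hineq
  rw [real_inner_self_eq_norm_sq] at hfin
  have := le_div_of_mul_sq_le one_pos (norm_nonneg ξ) (c := ‖f‖ + C₂ * ‖φ‖ + C₁ * ‖w‖)
    (by positivity) (by linarith)
  rw [div_one] at this
  nlinarith [mul_nonneg hC₁ (norm_nonneg φ), mul_nonneg hC₂ (norm_nonneg w)]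

end ObstacleControl

namespace ObstacleControl

variable {n : ℕ} {Ω : Set (EuclideanSpace ℝ (Fin n))} {a : Coeffs n} {f : L2 Ω}

/-! ### Convergence of the penalized states for a fixed obstacle -/

theorem Coeffs.Admissible.tendsto_form (ha : a.Admissible Ω) {ι : Type*} {l : Filter ι}
    {u v : ι → H10 Ω} {u₀ v₀ : H10 Ω} (hu : Tendsto u l (𝓝 u₀)) (hv : Tendsto v l (𝓝 v₀)) :
    Tendsto (fun k => a.form (u k) (v k)) l (𝓝 (a.form u₀ v₀)) := by
  have h := ha.continuous_form.tendsto (u₀, v₀)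
  have h2 := h.comp (hu.prodMk_nhds hv)
  exact h2

theorem inner_le_of_nonpos {ξ u : L2 Ω} (hξ : ∀ᵐ x ∂(volume.restrict Ω), ξ x ≤ 0) :
    inner ℝ ξ u ≤ ‖ξ‖ * ‖u ⊓ 0‖ := by
  refine le_trans ?_ (real_inner_le_norm ξ (u ⊓ 0))
  rw [L2_inner_eq, L2_inner_eq]
  refine integral_mono_ae (L2_integrable_mul _ _) (L2_integrable_mul _ _) ?_
  filter_upwards [hξ, Lp.coeFn_inf u 0] with x h1 h2
  rw [h2]
  exact mul_le_mul_of_nonpos_left inf_le_left h1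

theorem inner_nonpos_of_ae {ξ u : L2 Ω} (hξ : ∀ᵐ x ∂(volume.restrict Ω), ξ x ≤ 0)
    (hu : ∀ᵐ x ∂(volume.restrict Ω), 0 ≤ u x) : inner ℝ ξ u ≤ 0 := by
  rw [L2_inner_eq]
  refine integral_nonpos_of_ae ?_
  filter_upwards [hξ, hu] with x h1 h2
  exact mul_nonpos_of_nonpos_of_nonneg h1 h2

/-- The negative part is controlled by the penalty. -/
theorem exists_norm_inf_zero_sq_le (hΩb : Bornology.IsBounded Ω) :
    ∃ V, 0 ≤ V ∧ ∀ w : L2 Ω, ‖w ⊓ 0‖ ^ 2 ≤ V * ‖betaL one_pos w‖ + 4 * ‖betaL one_pos w‖ ^ 2 := by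
  have hfin : volume Ω ≠ ⊤ := hΩb.measure_lt_top.ne
  have : IsFiniteMeasure ((volume : Measure (EuclideanSpace ℝ (Fin n))).restrict Ω) :=
    isFiniteMeasure_restrict.2 hfin
  -- As the penalty is nonpositive, its inner product with `-1` is its `L¹`-norm; this is where the
  -- finite measure of `Ω` enters.
  have hone : MemLp (fun _ : EuclideanSpace ℝ (Fin n) => (-1 : ℝ)) 2 (volume.restrict Ω) :=
    memLp_const _
  refine ⟨‖hone.toLp‖, norm_nonneg _, fun w => ?_⟩
  have h1 := real_inner_le_norm (betaL one_pos w) hone.toLp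
  rw [mul_comm] at h1
  refine le_trans ?_ (add_le_add_left h1 _)
  rw [← real_inner_self_eq_norm_sq, ← real_inner_self_eq_norm_sq, L2_inner_eq, L2_inner_eq,
    L2_inner_eq, ← integral_const_mul,
    ← integral_add (L2_integrable_mul _ _) ((L2_integrable_mul _ _).const_mul _)]
  refine integral_mono_ae (L2_integrable_mul _ _)
    ((L2_integrable_mul _ _).add ((L2_integrable_mul _ _).const_mul _)) ?_
  filter_upwards [Lp.coeFn_inf w 0, coeFn_betaL one_pos w, hone.coeFn_toLp,
    Lp.coeFn_zero ℝ 2 (volume.restrict Ω)] with x e1 e2 e3 e4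
  simp only [e1, e2, e3, Pi.inf_apply, e4, Pi.zero_apply]
  have := min_zero_sq_le (w x)
  rw [abs_of_nonpos (beta_nonpos one_pos _)] at this
  change min (w x) 0 * min (w x) 0 ≤ _
  linarith

/-- By scaling, `‖β_1(w)‖ = δ ‖β_δ(w)‖ ≤ δ X`, so bounded penalties force the violation of the
constraint to vanish at a uniform rate. -/
theorem exists_norm_inf_zero_le (hΩb : Bornology.IsBounded Ω) (X : ℝ) :
    ∃ s : ℝ → ℝ, Tendsto s (𝓝[>] 0) (𝓝 0) ∧ ∀ {δ : ℝ} (hδ : 0 < δ) (w : L2 Ω),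
      ‖betaL hδ w‖ ≤ X → ‖w ⊓ 0‖ ≤ s δ := by
  obtain ⟨V, hV, h⟩ := exists_norm_inf_zero_sq_le hΩb
  refine ⟨fun δ => √(V * (δ * X) + 4 * (δ * X) ^ 2), ?_, fun {δ} hδ w hw => ?_⟩
  · have : Continuous fun δ : ℝ => √(V * (δ * X) + 4 * (δ * X) ^ 2) := by fun_prop
    have := this.tendsto 0
    simp only [zero_mul, mul_zero, zero_pow two_ne_zero, add_zero, Real.sqrt_zero] at this
    exact this.mono_left nhdsWithin_le_nhds
  · refine Real.le_sqrt_of_sq_le ((h w).trans ?_)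
    have h1 : ‖betaL one_pos w‖ ≤ δ * X := by
      rw [betaL_eq_smul hδ, norm_smul, Real.norm_of_nonneg (by positivity), one_div,
        inv_mul_le_iff₀ hδ] at hw
      exact hw
    gcongr

/-- In the difference tested with `y - y'`, the diagonal penalty terms have the good sign. The cross
terms pair a nonpositive function with `y - φ` or `y' - φ`, so only the negative parts of these
matter. -/
theorem IsPenalizedState.sq_norm_sub_le {M m : ℝ} (hB : a.IsCoerciveForm Ω M m) {δ ε : ℝ}
    (hδ : 0 < δ) (hε : 0 < ε) {φ y y' : H10 Ω} (h : IsPenalizedState a f δ φ y)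
    (h' : IsPenalizedState a f ε φ y') {X s t : ℝ} (hX : ‖betaL hδ (fnOf (y - φ))‖ ≤ X)
    (hX' : ‖betaL hε (fnOf (y' - φ))‖ ≤ X) (hs : ‖fnOf (y - φ) ⊓ 0‖ ≤ s)
    (ht : ‖fnOf (y' - φ) ⊓ 0‖ ≤ t) : ‖y - y'‖ ^ 2 ≤ X * (s + t) / m := by
  rw [isPenalizedState_iff hδ] at h
  rw [isPenalizedState_iff hε] at h'
  have h1 := h (y - y')
  have h2 := h' (y - y')
  have h3 := hB.coercive (y - y')
  rw [hB.form_sub_left] at h3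
  have e : fnOf (y - y') = fnOf (y - φ) - fnOf (y' - φ) := by simp
  rw [e, inner_sub_right, inner_sub_right] at h1 h2
  have p1 := inner_betaL_self_nonneg hδ (fnOf (y - φ))
  have p2 := inner_betaL_self_nonneg hε (fnOf (y' - φ))
  have hX0 : 0 ≤ X := (norm_nonneg _).trans hX
  have q1 := (inner_le_of_nonpos (u := fnOf (y' - φ)) (betaL_nonpos hδ (fnOf (y - φ)))).trans
    (mul_le_mul hX ht (norm_nonneg _) hX0)
  have q2 := (inner_le_of_nonpos (u := fnOf (y - φ)) (betaL_nonpos hε (fnOf (y' - φ)))).trans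
    (mul_le_mul hX' hs (norm_nonneg _) hX0)
  rw [le_div_iff₀ hB.pos]
  nlinarith

theorem exists_norm_betaL_bound (hΩ : IsOpen Ω) (ha : a.Admissible Ω) (f : L2 Ω) (φ : H2H10 Ω) :
    ∃ X, 0 ≤ X ∧ ∀ {δ : ℝ} (hδ : 0 < δ) {y : H10 Ω}, IsPenalizedState a f δ (toH10 φ) y →
      ‖betaL hδ (fnOf (y - toH10 φ))‖ ≤ X := by
  obtain ⟨M, m, hB⟩ := ha.exists_isCoerciveForm
  obtain ⟨C, hC, h⟩ := ha.exists_norm_betaL_le hΩ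
  have h0 : 0 ≤ (‖f‖ + M * ‖toH10 φ‖) / m :=
    div_nonneg (add_nonneg (norm_nonneg _) (mul_nonneg hB.nonneg (norm_nonneg _))) hB.pos.le
  refine ⟨‖f‖ + C * (‖φ‖ + (‖f‖ + M * ‖toH10 φ‖) / m), by positivity, fun {δ} hδ y hy => ?_⟩
  refine (h hδ f φ y hy).trans ?_
  have := hy.norm_sub_obstacle_le hB hδ
  gcongr

/-- Feasibility holds because `β_1(y - φ)` tends to zero and `β_1` vanishes only on `[0, ∞)`. The
inequality survives because `(ξ, v - φ) ≤ 0 ≤ (ξ, y - φ)` for each penalty `ξ` and feasible `v`. -/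
theorem isObstacleState_of_tendsto (ha : a.Admissible Ω) {ι : Type*} {l : Filter ι} [l.NeBot]
    {φ yb : H10 Ω} {d : ι → ℝ} {y : ι → H10 Ω} (hd : ∀ᶠ k in l, 0 < d k)
    (hd0 : Tendsto d l (𝓝 0)) {X : ℝ}
    (hX : ∀ᶠ k in l, ∀ hδ : 0 < d k, ‖betaL hδ (fnOf (y k - φ))‖ ≤ X)
    (hy : ∀ᶠ k in l, IsPenalizedState a f (d k) φ (y k)) (hlim : Tendsto y l (𝓝 yb)) :
    IsObstacleState a f φ yb := by
  have hw : Tendsto (fun k => fnOf (y k - φ)) l (𝓝 (fnOf (yb - φ))) :=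
    (continuous_fnOf.tendsto _).comp (hlim.sub_const φ)
  refine ⟨?_, fun v hv => ?_⟩
  · have h1 : Tendsto (fun k => betaL one_pos (fnOf (y k - φ))) l (𝓝 0) := by
      have h2 : Tendsto (fun k => d k * X) l (𝓝 0) := by simpa using hd0.mul_const X
      refine squeeze_zero_norm' ?_ h2
      filter_upwards [hd, hX] with k hk hXk
      have := hXk hk
      rwa [betaL_eq_smul hk, norm_smul, Real.norm_of_nonneg (by positivity), one_div,
        inv_mul_le_iff₀ hk] at this
    have h3 : betaL one_pos (fnOf (yb - φ)) = 0 :=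
      tendsto_nhds_unique (((betaL_continuous one_pos).tendsto _).comp hw) h1
    filter_upwards [coeFn_betaL one_pos (fnOf (yb - φ)), Lp.coeFn_sub (fnOf yb) (fnOf φ),
      Lp.coeFn_zero ℝ 2 (volume.restrict Ω)] with x e1 e2 e3
    rw [h3, e3, fnOf_sub, e2, Pi.zero_apply, Pi.sub_apply] at e1
    have := min_zero_sq_le (fnOf yb x - fnOf φ x)
    rw [← e1, abs_zero, zero_pow two_ne_zero, mul_zero, add_zero] at this
    have := pow_eq_zero_iff two_ne_zero |>.1 (le_antisymm this (sq_nonneg _))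
    have := min_eq_right_iff.1 this
    linarith
  · have h1 : Tendsto (fun k => inner ℝ f (fnOf (v - y k))) l (𝓝 (inner ℝ f (fnOf (v - yb)))) :=
      tendsto_const_nhds.inner ((continuous_fnOf.tendsto _).comp (hlim.const_sub v))
    have h2 : Tendsto (fun k => a.form (y k) (v - y k)) l (𝓝 (a.form yb (v - yb))) :=
      ha.tendsto_form hlim (hlim.const_sub v)
    refine le_of_tendsto_of_tendsto h1 h2 ?_
    filter_upwards [hd, hy] with k hk hyk
    have e := (isPenalizedState_iff hk).1 hyk (v - y k)
    have e1 : fnOf (v - y k) = fnOf (v - φ) - fnOf (y k - φ) := by simp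
    have e2 : inner ℝ (betaL hk (fnOf (y k - φ))) (fnOf (v - φ)) ≤ 0 := by
      refine inner_nonpos_of_ae (betaL_nonpos hk _) ?_
      filter_upwards [hv, Lp.coeFn_sub (fnOf v) (fnOf φ)] with x h1 h2
      rw [fnOf_sub, h2, Pi.sub_apply]
      linarith
    have e3 := inner_betaL_self_nonneg hk (fnOf (y k - φ))
    have e4 : inner ℝ (betaL hk (fnOf (y k - φ))) (fnOf (v - y k)) ≤ 0 := by
      rw [e1, inner_sub_right]; linarith
    linarith

/-- For an obstacle in `H²(Ω) ∩ H₀¹(Ω)` the penalized states converge strongly to the solution of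
the obstacle problem. -/
theorem exists_tendsto_penalizedState (hΩ : IsOpen Ω) (hΩb : Bornology.IsBounded Ω)
    (ha : a.Admissible Ω) (f : L2 Ω) (φ : H2H10 Ω) {y : ℝ → H10 Ω}
    (hy : ∀ δ > 0, IsPenalizedState a f δ (toH10 φ) (y δ)) :
    ∃ yb, IsObstacleState a f (toH10 φ) yb ∧ Tendsto y (𝓝[>] 0) (𝓝 yb) := by
  obtain ⟨M, m, hB⟩ := ha.exists_isCoerciveForm
  obtain ⟨X, hX0, hX⟩ := exists_norm_betaL_bound hΩ ha f φ
  obtain ⟨s, hs0, hs⟩ := exists_norm_inf_zero_le hΩb X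
  have hpos : ∀ᶠ δ : ℝ in 𝓝[>] 0, 0 < δ := eventually_mem_nhdsWithin
  have hC : Cauchy (map y (𝓝[>] 0)) := by
    rw [cauchy_map_iff]
    refine ⟨inferInstance, ?_⟩
    rw [Metric.uniformity_eq_comap_nhds_zero, tendsto_comap_iff]
    have hlim : Tendsto (fun q : ℝ × ℝ => √(X * (s q.1 + s q.2) / m)) (𝓝[>] 0 ×ˢ 𝓝[>] 0)
        (𝓝 0) := by
      have h1 := (((hs0.comp tendsto_fst).add (hs0.comp tendsto_snd)).const_mul X).div_const m
        |>.sqrt (α := ℝ × ℝ) (l := 𝓝[>] 0 ×ˢ 𝓝[>] 0)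
      simpa using h1
    refine squeeze_zero' (Eventually.of_forall fun q => dist_nonneg) ?_ hlim
    filter_upwards [hpos.prod_mk hpos] with q ⟨h1, h2⟩
    rw [Function.comp_apply, dist_eq_norm]
    refine Real.le_sqrt_of_sq_le ?_
    exact (hy _ h1).sq_norm_sub_le hB h1 h2 (hy _ h2) (hX h1 (hy _ h1)) (hX h2 (hy _ h2))
      (hs h1 _ (hX h1 (hy _ h1))) (hs h2 _ (hX h2 (hy _ h2)))
  obtain ⟨yb, hyb⟩ := cauchy_map_iff_exists_tendsto.1 hC
  refine ⟨yb, ?_, hyb⟩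
  exact isObstacleState_of_tendsto ha (d := id) (X := X) hpos
    (tendsto_id.mono_left nhdsWithin_le_nhds)
    (hpos.mono fun δ h hδ => hX hδ (hy _ h)) (hpos.mono fun δ h => hy _ h) hyb

theorem exists_isObstacleState (hΩ : IsOpen Ω) (hΩb : Bornology.IsBounded Ω)
    (ha : a.Admissible Ω) (f : L2 Ω) (φ : H2H10 Ω) : ∃ y, IsObstacleState a f (toH10 φ) y := by
  have : ∀ δ : ℝ, ∃ y, 0 < δ → IsPenalizedState a f δ (toH10 φ) y := fun δ => by
    by_cases h : 0 < δ
    · obtain ⟨y, hy⟩ := exists_isPenalizedState ha f h (toH10 φ)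
      exact ⟨y, fun _ => hy⟩
    · exact ⟨0, fun h' => absurd h' h⟩
  choose y hy using this
  obtain ⟨yb, h, -⟩ := exists_tendsto_penalizedState hΩ hΩb ha f φ fun δ hδ => hy δ hδ
  exact ⟨yb, h⟩

theorem tendsto_penalizedState (hΩ : IsOpen Ω) (hΩb : Bornology.IsBounded Ω)
    (ha : a.Admissible Ω) {φ : H2H10 Ω} {y : ℝ → H10 Ω} {yb : H10 Ω}
    (hy : ∀ δ > 0, IsPenalizedState a f δ (toH10 φ) (y δ))
    (hyb : IsObstacleState a f (toH10 φ) yb) : Tendsto y (𝓝[>] 0) (𝓝 yb) := by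
  obtain ⟨M, m, hB⟩ := ha.exists_isCoerciveForm
  obtain ⟨y', h, h'⟩ := exists_tendsto_penalizedState hΩ hΩb ha f φ hy
  rwa [h.unique hB hyb] at h'

/-- The multiplier of the obstacle problem is a nonpositive function in `L²(Ω)`. -/
theorem IsObstacleState.exists_multiplier (hΩ : IsOpen Ω) (hΩb : Bornology.IsBounded Ω)
    (ha : a.Admissible Ω) {φ : H2H10 Ω} {yb : H10 Ω} (hyb : IsObstacleState a f (toH10 φ) yb) :
    ∃ ξ : L2 Ω, (∀ᵐ x ∂(volume.restrict Ω), ξ x ≤ 0) ∧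
      ∀ v : H10 Ω, a.form yb v + inner ℝ ξ (fnOf v) = inner ℝ f (fnOf v) := by
  obtain ⟨X, hX0, hX⟩ := exists_norm_betaL_bound hΩ ha f φ
  have : ∀ δ : ℝ, ∃ y, 0 < δ → IsPenalizedState a f δ (toH10 φ) y := fun δ => by
    by_cases h : 0 < δ
    · obtain ⟨y, hy⟩ := exists_isPenalizedState ha f h (toH10 φ)
      exact ⟨y, fun _ => hy⟩
    · exact ⟨0, fun h' => absurd h' h⟩
  choose y hy using this
  have hlim := tendsto_penalizedState hΩ hΩb ha (fun δ hδ => hy δ hδ) hyb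
  have hpos : ∀ k : ℕ, (0 : ℝ) < 1 / (k + 1) := fun k => Nat.one_div_pos_of_nat
  have hd : Tendsto (fun k : ℕ => (1 : ℝ) / (k + 1)) atTop (𝓝[>] 0) :=
    tendsto_nhdsWithin_iff.2 ⟨tendsto_one_div_add_atTop_nhds_zero_nat, Eventually.of_forall hpos⟩
  obtain ⟨ξ, σ, hσ, hξ⟩ := exists_weaklyTendsto_of_bounded
    (u := fun k => betaL (hpos k) (fnOf (y (1 / (k + 1)) - toH10 φ)))
    fun k => hX (hpos k) (hy _ (hpos k))
  refine ⟨ξ, ?_, fun v => ?_⟩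
  -- The sign passes to the weak limit by testing with its own positive part, which gives `‖ξ⁺‖² ≤
  -- 0`.
  · have h1 : inner ℝ ξ (ξ ⊔ 0) ≤ 0 := by
      refine le_of_tendsto' (hξ (ξ ⊔ 0)) fun k => inner_nonpos_of_ae (betaL_nonpos _ _) ?_
      filter_upwards [Lp.coeFn_sup ξ 0, Lp.coeFn_zero ℝ 2 (volume.restrict Ω)] with x e1 e2
      rw [e1, Pi.sup_apply, e2, Pi.zero_apply]
      exact le_sup_right
    have h2 : inner ℝ ξ (ξ ⊔ 0) = ‖ξ ⊔ 0‖ ^ 2 := by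
      rw [← real_inner_self_eq_norm_sq, L2_inner_eq, L2_inner_eq]
      refine integral_congr_ae ?_
      filter_upwards [Lp.coeFn_sup ξ 0, Lp.coeFn_zero ℝ 2 (volume.restrict Ω)] with x e1 e2
      rw [e1, Pi.sup_apply, e2, Pi.zero_apply]
      rcases le_total (ξ x) 0 with h | h
      · simp [h]
      · simp [h]
    have h3 : ξ ⊔ 0 = 0 := by
      rw [h2] at h1
      exact norm_eq_zero.1 (pow_eq_zero_iff two_ne_zero |>.1 (le_antisymm h1 (sq_nonneg _)))
    filter_upwards [Lp.coeFn_sup ξ 0, Lp.coeFn_zero ℝ 2 (volume.restrict Ω)] with x e1 e2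
    rw [h3, e2, Pi.sup_apply, e2, Pi.zero_apply] at e1
    rw [e1]
    exact le_sup_left
  · have h1 : Tendsto (fun k => a.form (y (1 / (σ k + 1))) v) atTop (𝓝 (a.form yb v)) :=
      ha.tendsto_form (hlim.comp (hd.comp hσ.tendsto_atTop)) tendsto_const_nhds
    refine tendsto_nhds_unique (h1.add (hξ (fnOf v))) (tendsto_const_nhds.congr fun k => ?_)
    exact ((isPenalizedState_iff (hpos _)).1 (hy _ (hpos _)) v).symm

end ObstacleControl

namespace ObstacleControl

variable {n : ℕ} {Ω : Set (EuclideanSpace ℝ (Fin n))}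

/-! ### Compactness of the embedding `H₀¹(Ω) → L²(Ω)` -/

section Rellich

open scoped FourierTransform SchwartzMap LineDeriv

/-- A test function as a complex-valued Schwartz function. -/
noncomputable def IsTest.toSchwartz {ψ : EuclideanSpace ℝ (Fin n) → ℝ} (h : IsTest Ω ψ) :
    𝓢(EuclideanSpace ℝ (Fin n), ℂ) :=
  HasCompactSupport.toSchwartzMap (f := fun x => (ψ x : ℂ))
    (h.2.1.comp_left (g := ((↑) : ℝ → ℂ)) Complex.ofReal_zero) (Complex.ofRealCLM.contDiff.comp h.1)

@[simp] theorem IsTest.toSchwartz_apply {ψ : EuclideanSpace ℝ (Fin n) → ℝ} (h : IsTest Ω ψ)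
    (x : EuclideanSpace ℝ (Fin n)) : h.toSchwartz x = (ψ x : ℂ) := rfl

theorem IsTest.eq_zero_of_notMem {ψ : EuclideanSpace ℝ (Fin n) → ℝ} (h : IsTest Ω ψ)
    {x : EuclideanSpace ℝ (Fin n)} (hx : x ∉ Ω) : ψ x = 0 :=
  image_eq_zero_of_notMem_tsupport fun hx' => hx (h.2.2 hx')

theorem IsTest.integral_norm_sq_toSchwartz {ψ : EuclideanSpace ℝ (Fin n) → ℝ} (h : IsTest Ω ψ) :
    ∫ x, ‖h.toSchwartz x‖ ^ 2 = ‖h.toL2‖ ^ 2 := by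
  rw [← real_inner_self_eq_norm_sq, L2_inner_eq,
    ← setIntegral_eq_integral_of_forall_compl_eq_zero (s := Ω)]
  · refine integral_congr_ae ?_
    filter_upwards [h.coeFn_toL2] with x hx
    rw [hx, h.toSchwartz_apply, Complex.norm_real, Real.norm_eq_abs, sq_abs, sq]
  · intro x hx
    simp [h.eq_zero_of_notMem hx]

theorem IsTest.lineDeriv_toSchwartz {ψ : EuclideanSpace ℝ (Fin n) → ℝ} (h : IsTest Ω ψ)
    (i : Fin n) : ∂_{EuclideanSpace.single i (1 : ℝ)} h.toSchwartz =
      (h.partial_isTest i).toSchwartz := by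
  ext x
  have h1 : HasFDerivAt (fun x => (ψ x : ℂ)) (Complex.ofRealCLM.comp (fderiv ℝ ψ x)) x :=
    Complex.ofRealCLM.hasFDerivAt.comp x (h.differentiable x).hasFDerivAt
  rw [SchwartzMap.lineDerivOp_apply_eq_fderiv]
  change fderiv ℝ (fun x => (ψ x : ℂ)) x _ = _
  rw [h1.fderiv]
  simp [partialD]

theorem IsTest.norm_fourier_partial {ψ : EuclideanSpace ℝ (Fin n) → ℝ} (h : IsTest Ω ψ)
    (ξ : EuclideanSpace ℝ (Fin n)) :
    ∑ i, ‖𝓕 (h.partial_isTest i).toSchwartz ξ‖ ^ 2 =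
      (2 * Real.pi) ^ 2 * ‖ξ‖ ^ 2 * ‖𝓕 h.toSchwartz ξ‖ ^ 2 := by
  have key : ∀ i, ‖𝓕 (h.partial_isTest i).toSchwartz ξ‖ ^ 2 =
      (2 * Real.pi) ^ 2 * ‖𝓕 h.toSchwartz ξ‖ ^ 2 * ‖ξ i‖ ^ 2 := fun i => by
    have ht : (fun x : EuclideanSpace ℝ (Fin n) =>
      inner ℝ x (EuclideanSpace.single i (1 : ℝ))).HasTemperateGrowth := by fun_prop
    rw [← h.lineDeriv_toSchwartz, SchwartzMap.fourier_lineDerivOp_eq, smul_apply,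
      SchwartzMap.smulLeftCLM_apply_apply ht]
    simp only [EuclideanSpace.inner_single_right, norm_smul, norm_mul, Complex.norm_I,
      Complex.norm_real, Complex.norm_ofNat, Real.norm_eq_abs, abs_of_pos Real.pi_pos]
    simp only [mul_pow, sq_abs]
    simp
    ring
  simp only [key]
  rw [← Finset.mul_sum, EuclideanSpace.norm_sq_eq ξ]
  ring

/-- Written as real `L²(Ω)` inner products, each Fourier value becomes accessible to weak
convergence. -/
theorem IsTest.fourier_toSchwartz {ψ : EuclideanSpace ℝ (Fin n) → ℝ} (h : IsTest Ω ψ)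
    {ξ : EuclideanSpace ℝ (Fin n)}
    (hc : MemLp (fun x => Real.cos (-2 * Real.pi * inner ℝ x ξ)) 2 (volume.restrict Ω))
    (hs : MemLp (fun x => Real.sin (-2 * Real.pi * inner ℝ x ξ)) 2 (volume.restrict Ω)) :
    𝓕 h.toSchwartz ξ = (inner ℝ hc.toLp h.toL2 : ℝ) + (inner ℝ hs.toLp h.toL2 : ℝ) * Complex.I := by
  have e1 : inner ℝ hc.toLp h.toL2 = ∫ x in Ω, Real.cos (-2 * Real.pi * inner ℝ x ξ) * ψ x := by
    rw [L2_inner_eq]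
    refine integral_congr_ae ?_
    filter_upwards [hc.coeFn_toLp, h.coeFn_toL2] with x h1 h2
    rw [h1, h2]
  have e2 : inner ℝ hs.toLp h.toL2 = ∫ x in Ω, Real.sin (-2 * Real.pi * inner ℝ x ξ) * ψ x := by
    rw [L2_inner_eq]
    refine integral_congr_ae ?_
    filter_upwards [hs.coeFn_toLp, h.coeFn_toL2] with x h1 h2
    rw [h1, h2]
  have i1 : Integrable (fun x => Real.cos (-2 * Real.pi * inner ℝ x ξ) * ψ x)
      (volume.restrict Ω) := hc.integrable_mul h.memLp
  have i2 : Integrable (fun x => Real.sin (-2 * Real.pi * inner ℝ x ξ) * ψ x)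
      (volume.restrict Ω) := hs.integrable_mul h.memLp
  rw [e1, e2, ← integral_complex_ofReal, ← integral_complex_ofReal, ← integral_mul_const,
    ← integral_add i1.ofReal (i2.ofReal.mul_const _), SchwartzMap.fourier_coe, Real.fourier_eq',
    ← setIntegral_eq_integral_of_forall_compl_eq_zero (s := Ω)]
  · refine integral_congr_ae (Eventually.of_forall fun x => ?_)
    simp only [h.toSchwartz_apply, Complex.exp_mul_I, smul_eq_mul]
    push_cast
    ring
  · intro x hx
    simp [h.eq_zero_of_notMem hx]

/-- Plancherel: outside the ball, `|𝓕ψ|²` is at most `R⁻²` times the transformed gradient squared,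
as `2π ≥ 1`. -/
theorem IsTest.norm_sq_le_fourier {ψ : EuclideanSpace ℝ (Fin n) → ℝ} (h : IsTest Ω ψ) {R : ℝ}
    (hR : 0 < R) : ‖h.toL2‖ ^ 2 ≤
      (∫ ξ in Metric.ball 0 R, ‖𝓕 h.toSchwartz ξ‖ ^ 2) + ‖h.toH10‖ ^ 2 / R ^ 2 := by
  have hint : ∀ F : 𝓢(EuclideanSpace ℝ (Fin n), ℂ), Integrable fun ξ => ‖F ξ‖ ^ 2 := fun F =>
    (F.memLp 2 volume).integrable_norm_pow two_ne_zero
  have hgrad : ∑ i, ‖(h.partial_isTest i).toL2‖ ^ 2 ≤ ‖h.toH10‖ ^ 2 := by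
    rw [H10.norm_sq]
    exact le_add_of_nonneg_left (sq_nonneg _)
  have hpi : 1 ≤ (2 * Real.pi) ^ 2 := by nlinarith [Real.pi_gt_three]
  refine le_trans ?_ (add_le_add_right (div_le_div_of_nonneg_right hgrad (sq_nonneg R)) _)
  rw [← h.integral_norm_sq_toSchwartz, ← SchwartzMap.integral_norm_sq_fourier]
  have hp : ∀ i, ‖(h.partial_isTest i).toL2‖ ^ 2 =
      ∫ ξ, ‖𝓕 (h.partial_isTest i).toSchwartz ξ‖ ^ 2 := fun i => by
    rw [SchwartzMap.integral_norm_sq_fourier, IsTest.integral_norm_sq_toSchwartz]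
  simp only [hp]
  rw [← integral_finsetSum _ fun i _ => hint _, ← integral_div,
    ← integral_indicator Metric.isOpen_ball.measurableSet,
    ← integral_add ((hint _).indicator Metric.isOpen_ball.measurableSet)
      ((integrable_finsetSum _ fun i _ => hint _).div_const _)]
  refine integral_mono (hint _) (((hint _).indicator Metric.isOpen_ball.measurableSet).add
      ((integrable_finsetSum _ fun i _ => hint _).div_const _)) fun ξ => ?_
  simp only [h.norm_fourier_partial]
  by_cases hξ : ξ ∈ Metric.ball (0 : EuclideanSpace ℝ (Fin n)) R
  · rw [Set.indicator_of_mem hξ]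
    exact le_add_of_nonneg_right (by positivity)
  · rw [Set.indicator_of_notMem hξ, zero_add, le_div_iff₀ (by positivity)]
    have h1 : R ≤ ‖ξ‖ := by simpa using hξ
    have h2 : R ^ 2 ≤ ‖ξ‖ ^ 2 := pow_le_pow_left₀ hR.le h1 2
    have h3 : R ^ 2 ≤ (2 * Real.pi) ^ 2 * ‖ξ‖ ^ 2 := by nlinarith
    rw [mul_comm]
    exact mul_le_mul_of_nonneg_right h3 (sq_nonneg _)

/-- High frequencies are uniformly small by the `H¹` bound. Low ones vanish by dominated
convergence, since weak convergence gives pointwise convergence of the transforms and boundedness of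
`Ω` a uniform bound. -/
theorem tendsto_toL2_of_weaklyTendsto_zero (hΩb : Bornology.IsBounded Ω)
    {ψ : ℕ → EuclideanSpace ℝ (Fin n) → ℝ} (hψ : ∀ k, IsTest Ω (ψ k)) {C : ℝ}
    (hC : ∀ k, ‖(hψ k).toH10‖ ≤ C) (hw : WeaklyTendsto (fun k => (hψ k).toL2) atTop 0) :
    Tendsto (fun k => (hψ k).toL2) atTop (𝓝 0) := by
  have hfin : volume Ω ≠ ⊤ := hΩb.measure_lt_top.ne
  have : IsFiniteMeasure ((volume : Measure (EuclideanSpace ℝ (Fin n))).restrict Ω) :=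
    isFiniteMeasure_restrict.2 hfin
  have hone : MemLp (fun _ : EuclideanSpace ℝ (Fin n) => (1 : ℝ)) 2 (volume.restrict Ω) :=
    memLp_const _
  have hc : ∀ ξ : EuclideanSpace ℝ (Fin n),
      MemLp (fun x => Real.cos (-2 * Real.pi * inner ℝ x ξ)) 2 (volume.restrict Ω) := fun ξ =>
    hone.mono (by fun_prop) (Eventually.of_forall fun x => by
      simpa using Real.abs_cos_le_one _)
  have hs : ∀ ξ : EuclideanSpace ℝ (Fin n),
      MemLp (fun x => Real.sin (-2 * Real.pi * inner ℝ x ξ)) 2 (volume.restrict Ω) := fun ξ =>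
    hone.mono (by fun_prop) (Eventually.of_forall fun x => by
      simpa using Real.abs_sin_le_one _)
  have hcn : ∀ ξ, ‖(hc ξ).toLp‖ ≤ ‖hone.toLp‖ := fun ξ => by
    refine Lp.norm_le_norm_of_ae_le ?_
    filter_upwards [(hc ξ).coeFn_toLp, hone.coeFn_toLp] with x h1 h2
    rw [h1, h2]
    simpa using Real.abs_cos_le_one _
  have hsn : ∀ ξ, ‖(hs ξ).toLp‖ ≤ ‖hone.toLp‖ := fun ξ => by
    refine Lp.norm_le_norm_of_ae_le ?_
    filter_upwards [(hs ξ).coeFn_toLp, hone.coeFn_toLp] with x h1 h2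
    rw [h1, h2]
    simpa using Real.abs_sin_le_one _
  have hC2 : ∀ k, ‖(hψ k).toL2‖ ≤ C := fun k => (norm_fnOf_le (hψ k).toH10).trans (hC k)
  have hpt : ∀ ξ, Tendsto (fun k => 𝓕 (hψ k).toSchwartz ξ) atTop (𝓝 0) := fun ξ => by
    have h1 := hw (hc ξ).toLp
    have h2 := hw (hs ξ).toLp
    simp only [inner_zero_left] at h1 h2
    have h3 := ((Complex.continuous_ofReal.tendsto 0).comp h1).add
      (((Complex.continuous_ofReal.tendsto 0).comp h2).mul_const Complex.I)
    simp only [Complex.ofReal_zero, zero_mul, add_zero] at h3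
    refine h3.congr fun k => ?_
    rw [(hψ k).fourier_toSchwartz (hc ξ) (hs ξ), real_inner_comm, real_inner_comm (hψ k).toL2]
    rfl
  have hbd : ∀ k ξ, ‖𝓕 (hψ k).toSchwartz ξ‖ ≤ 2 * (‖hone.toLp‖ * C) := fun k ξ => by
    rw [(hψ k).fourier_toSchwartz (hc ξ) (hs ξ)]
    refine (norm_add_le _ _).trans ?_
    rw [norm_mul, Complex.norm_I, mul_one, Complex.norm_real, Complex.norm_real, two_mul]
    exact add_le_add
      ((norm_inner_le_norm _ _).trans (mul_le_mul (hcn ξ) (hC2 k) (norm_nonneg _) (norm_nonneg _)))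
      ((norm_inner_le_norm _ _).trans (mul_le_mul (hsn ξ) (hC2 k) (norm_nonneg _) (norm_nonneg _)))
  have hball : ∀ R : ℝ, Tendsto (fun k => ∫ ξ in Metric.ball 0 R, ‖𝓕 (hψ k).toSchwartz ξ‖ ^ 2)
      atTop (𝓝 0) := fun R => by
    have : IsFiniteMeasure ((volume : Measure (EuclideanSpace ℝ (Fin n))).restrict
        (Metric.ball 0 R)) := isFiniteMeasure_restrict.2 Metric.isBounded_ball.measure_lt_top.ne
    have h1 := tendsto_integral_of_dominated_convergence
      (μ := (volume : Measure (EuclideanSpace ℝ (Fin n))).restrict (Metric.ball 0 R))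
      (F := fun k ξ => ‖𝓕 (hψ k).toSchwartz ξ‖ ^ 2) (f := fun _ => (0 : ℝ))
      (fun _ => (2 * (‖hone.toLp‖ * C)) ^ 2)
      (fun k => ((SchwartzMap.continuous _).norm.pow 2).aestronglyMeasurable)
      (integrable_const _) (fun k => Eventually.of_forall fun ξ => ?_)
      (Eventually.of_forall fun ξ => ?_)
    · simpa using h1
    · rw [Real.norm_of_nonneg (sq_nonneg _)]
      exact pow_le_pow_left₀ (norm_nonneg _) (hbd k ξ) 2
    · simpa using (hpt ξ).norm.pow 2
  rw [tendsto_zero_iff_norm_tendsto_zero]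
  suffices hsq : Tendsto (fun k => ‖(hψ k).toL2‖ ^ 2) atTop (𝓝 0) by
    have := hsq.sqrt
    simpa [Real.sqrt_sq (norm_nonneg _)] using this
  refine tendsto_order.2 ⟨fun ε hε => Eventually.of_forall fun k => hε.trans_le (sq_nonneg _),
    fun ε hε => ?_⟩
  have hRlim : Tendsto (fun R : ℝ => C ^ 2 / R ^ 2) atTop (𝓝 0) :=
    (tendsto_pow_atTop two_ne_zero).const_div_atTop _
  obtain ⟨R, hR1, hR⟩ := ((hRlim.eventually_lt_const (half_pos hε)).and
    (eventually_gt_atTop 0)).exists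
  filter_upwards [(hball R).eventually_lt_const (half_pos hε)] with k hk
  have h1 := (hψ k).norm_sq_le_fourier hR
  have h2 : ‖(hψ k).toH10‖ ^ 2 / R ^ 2 ≤ C ^ 2 / R ^ 2 :=
    div_le_div_of_nonneg_right (pow_le_pow_left₀ (norm_nonneg _) (hC k) 2) (sq_nonneg R)
  linarith

/-- **Rellich's theorem**: bounded weakly convergent sequences of `H₀¹(Ω)` converge in `L²(Ω)`. -/
theorem WeaklyTendsto.tendsto_fnOf (hΩb : Bornology.IsBounded Ω) {u : ℕ → H10 Ω} {u₀ : H10 Ω}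
    (hu : WeaklyTendsto u atTop u₀) {C : ℝ} (hC : ∀ k, ‖u k‖ ≤ C) :
    Tendsto (fun k => fnOf (u k)) atTop (𝓝 (fnOf u₀)) := by
  -- Replacing `u k - u₀` by a test function within `1 / (k + 1)` changes neither the weak limit nor
  -- the conclusion.
  choose ψ hψ hd using fun k : ℕ =>
    H10.exists_test_near (u k - u₀) (Nat.one_div_pos_of_nat (α := ℝ) (n := k))
  have hzero : Tendsto (fun k => u k - u₀ - (hψ k).toH10) atTop (𝓝 0) :=
    squeeze_zero_norm (fun k => (hd k).le) tendsto_one_div_add_atTop_nhds_zero_nat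
  have hfz : Tendsto (fun k => fnOf (u k) - fnOf u₀ - (hψ k).toL2) atTop (𝓝 0) := by
    have h := (continuous_fnOf.tendsto _).comp hzero
    rw [fnOf_zero] at h
    refine h.congr fun k => ?_
    simp
  have hw : WeaklyTendsto (fun k => (hψ k).toL2) atTop 0 := fun w => by
    have h1 := hu.map fnL w
    have h2 := (h1.sub_const (inner ℝ (fnL u₀) w)).sub (hfz.inner (tendsto_const_nhds (x := w)))
    rw [sub_self, inner_zero_left, sub_zero] at h2
    rw [inner_zero_left]
    refine h2.congr fun k => ?_
    simp only [fnL_apply, inner_sub_left]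
    ring
  have hb : ∀ k, ‖(hψ k).toH10‖ ≤ C + ‖u₀‖ + 1 := fun k => by
    have h1 : (hψ k).toH10 = (u k - u₀) - (u k - u₀ - (hψ k).toH10) := by abel
    rw [h1]
    have h2 := hd k
    have h3 : (1 : ℝ) / (k + 1) ≤ 1 := by
      rw [div_le_one (by positivity)]
      have : (0 : ℝ) ≤ k := Nat.cast_nonneg k
      linarith
    linarith [norm_sub_le (u k - u₀) (u k - u₀ - (hψ k).toH10), norm_sub_le (u k) u₀, hC k]
  have h1 := (hfz.add (tendsto_toL2_of_weaklyTendsto_zero hΩb hψ hb hw)).add_const (fnOf u₀)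
  simpa using h1

end Rellich

end ObstacleControl

namespace ObstacleControl

variable {n : ℕ} {Ω : Set (EuclideanSpace ℝ (Fin n))} {a : Coeffs n} {f z : L2 Ω}

/-! ### Controls with bounded Laplacian -/

@[simp] theorem toH10_add (φ ψ : H2H10 Ω) : toH10 (φ + ψ) = toH10 φ + toH10 ψ := rfl
@[simp] theorem toH10_smul (c : ℝ) (φ : H2H10 Ω) : toH10 (c • φ) = c • toH10 φ := rfl

theorem laplacianOf_eq (φ : H2H10 Ω) : laplacianOf φ = ∑ i, hessOf φ i i := rfl

theorem laplacianOf_add (φ ψ : H2H10 Ω) :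
    laplacianOf (φ + ψ) = laplacianOf φ + laplacianOf ψ := by
  rw [laplacianOf_eq, laplacianOf_eq, laplacianOf_eq, ← Finset.sum_add_distrib]
  rfl

theorem laplacianOf_smul (c : ℝ) (φ : H2H10 Ω) :
    laplacianOf (c • φ) = c • laplacianOf φ := by
  rw [laplacianOf_eq, laplacianOf_eq, Finset.smul_sum]
  rfl

/-- Green's formula. -/
theorem sum_inner_gradOf (φ : H2H10 Ω) (v : H10 Ω) :
    ∑ i, inner ℝ (gradOf (toH10 φ) i) (gradOf v i) = -inner ℝ (laplacianOf φ) (fnOf v) := by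
  induction v using H10.closed_induction with
  | hP =>
    refine isClosed_eq ?_ ?_
    · exact continuous_finsetSum _ fun i _ => continuous_const.inner (continuous_gradOf i)
    · exact (continuous_const.inner continuous_fnOf).neg
  | h ψ hψ =>
    rw [laplacianOf_eq, sum_inner, ← Finset.sum_neg_distrib]
    refine Finset.sum_congr rfl fun i _ => ?_
    have := HasWeakPartial.iff_inner.1 (H2H10.hasWeakPartial φ i i) ψ hψ
    rw [real_inner_comm, real_inner_comm _ (hessOf φ i i)]
    exact this

theorem inner_toH10 (φ : H2H10 Ω) (v : H10 Ω) :
    inner ℝ (toH10 φ) v = inner ℝ (fnOf (toH10 φ) - laplacianOf φ) (fnOf v) := by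
  rw [H10.inner_eq, sum_inner_gradOf, inner_sub_left]
  ring

theorem inner_toH10_le (φ : H2H10 Ω) (v : H10 Ω) :
    |inner ℝ (toH10 φ) v| ≤ (‖fnOf (toH10 φ)‖ + ‖laplacianOf φ‖) * ‖fnOf v‖ := by
  rw [inner_toH10]
  exact (abs_real_inner_le_norm _ _).trans
    (mul_le_mul_of_nonneg_right (norm_sub_le _ _) (norm_nonneg _))

theorem norm_toH10_le_of_bounded (φ : H2H10 Ω) :
    ‖toH10 φ‖ ≤ ‖fnOf (toH10 φ)‖ + ‖laplacianOf φ‖ := by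
  have h1 := (le_abs_self _).trans (inner_toH10_le φ (toH10 φ))
  rw [real_inner_self_eq_norm_sq] at h1
  have h2 := mul_le_mul_of_nonneg_left (norm_fnOf_le (toH10 φ))
    (add_nonneg (norm_nonneg (fnOf (toH10 φ))) (norm_nonneg (laplacianOf φ)))
  have := le_div_of_mul_sq_le one_pos (norm_nonneg (toH10 φ))
    (add_nonneg (norm_nonneg (fnOf (toH10 φ))) (norm_nonneg (laplacianOf φ))) (by linarith)
  rwa [div_one] at this

/-- Green's formula bounds `⟨φ_k, φ_k - g⟩` in `H₀¹` by `C` times the `L²`-distance. The rest of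
`‖φ_k - g‖²` is the weak term, so no bound on the full Hessian is needed. -/
theorem tendsto_toH10_of_weak {ι : Type*} {l : Filter ι} {φ : ι → H2H10 Ω} {g : H10 Ω} {C : ℝ}
    (hC : ∀ᶠ k in l, ‖fnOf (toH10 (φ k))‖ + ‖laplacianOf (φ k)‖ ≤ C)
    (hw : Tendsto (fun k => inner ℝ g (toH10 (φ k) - g)) l (𝓝 0))
    (hf : Tendsto (fun k => fnOf (toH10 (φ k))) l (𝓝 (fnOf g))) :
    Tendsto (fun k => toH10 (φ k)) l (𝓝 g) := by
  rw [tendsto_iff_norm_sub_tendsto_zero]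
  suffices hsq : Tendsto (fun k => ‖toH10 (φ k) - g‖ ^ 2) l (𝓝 0) by
    have := hsq.sqrt
    simpa [Real.sqrt_sq (norm_nonneg _)] using this
  have h1 : Tendsto (fun k => inner ℝ (toH10 (φ k)) (toH10 (φ k) - g)) l (𝓝 0) := by
    have h2 : Tendsto (fun k => C * ‖fnOf (toH10 (φ k)) - fnOf g‖) l (𝓝 0) := by
      simpa using (tendsto_iff_norm_sub_tendsto_zero.1 hf).const_mul C
    refine squeeze_zero_norm' ?_ h2
    filter_upwards [hC] with k hk
    rw [← fnOf_sub]
    exact (inner_toH10_le _ _).trans (mul_le_mul_of_nonneg_right hk (norm_nonneg _))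
  have h3 := h1.sub hw
  rw [sub_zero] at h3
  refine h3.congr fun k => ?_
  rw [← real_inner_self_eq_norm_sq, ← inner_sub_left]

theorem tendsto_toH10 {ι : Type*} {l : Filter ι} {φ : ι → H2H10 Ω} {φ₀ : H2H10 Ω} {C : ℝ}
    (hC : ∀ᶠ k in l, ‖laplacianOf (φ k)‖ ≤ C)
    (hf : Tendsto (fun k => fnOf (toH10 (φ k))) l (𝓝 (fnOf (toH10 φ₀)))) :
    Tendsto (fun k => toH10 (φ k)) l (𝓝 (toH10 φ₀)) := by
  refine tendsto_toH10_of_weak (C := ‖fnOf (toH10 φ₀)‖ + 1 + C) ?_ ?_ hf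
  · filter_upwards [hC, hf.norm.eventually_le_const (lt_add_one _)] with k h1 h2
    linarith
  · simp only [inner_toH10, fnOf_sub]
    have := (tendsto_const_nhds (x := fnOf (toH10 φ₀) - laplacianOf φ₀)).inner (𝕜 := ℝ)
      (hf.sub_const (fnOf (toH10 φ₀)))
    simpa using this

/-- The limit is only claimed in `H₀¹`; the later comparison never needs it to be an admissible
control. -/
theorem exists_tendsto_toH10_subseq (hΩb : Bornology.IsBounded Ω) {φ : ℕ → H2H10 Ω} {C : ℝ}
    (hC : ∀ᶠ k in atTop, ‖fnOf (toH10 (φ k))‖ + ‖laplacianOf (φ k)‖ ≤ C) :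
    ∃ (g : H10 Ω) (σ : ℕ → ℕ), StrictMono σ ∧ Tendsto (fun k => toH10 (φ (σ k))) atTop (𝓝 g) := by
  obtain ⟨N, hN⟩ := eventually_atTop.1 hC
  have hb : ∀ k, ‖toH10 (φ (k + N))‖ ≤ C := fun k =>
    (norm_toH10_le_of_bounded _).trans (hN _ (by omega))
  obtain ⟨g, σ, hσ, hw⟩ := exists_weaklyTendsto_of_bounded hb
  refine ⟨g, fun k => σ k + N, fun i j hij => by simpa using hσ hij, ?_⟩
  refine tendsto_toH10_of_weak (C := C) (Eventually.of_forall fun k => hN _ (Nat.le_add_left _ _)) ?_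
    (hw.tendsto_fnOf hΩb fun k => hb _)
  have := (hw g).sub_const (inner ℝ g g)
  rw [sub_self] at this
  refine this.congr fun k => ?_
  rw [inner_sub_right, real_inner_comm]

/-! ### Penalization along moving obstacles -/

theorem exists_penalizedState_map (ha : a.Admissible Ω) (f : L2 Ω) :
    ∃ S : ℝ → H10 Ω → H10 Ω, ∀ δ > 0, ∀ φ, IsPenalizedState a f δ φ (S δ φ) := by
  have : ∀ (δ : ℝ) (φ : H10 Ω), ∃ y, 0 < δ → IsPenalizedState a f δ φ y := fun δ φ => by
    by_cases h : 0 < δ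
    · obtain ⟨y, hy⟩ := exists_isPenalizedState ha f h φ
      exact ⟨y, fun _ => hy⟩
    · exact ⟨0, fun h' => absurd h' h⟩
  choose S hS using this
  exact ⟨S, fun δ hδ φ => hS δ φ hδ⟩

/-- The penalization error tends to zero along convergent sequences of obstacles. -/
theorem tendsto_penalizedState_sub (hΩ : IsOpen Ω) (hΩb : Bornology.IsBounded Ω)
    (ha : a.Admissible Ω) {d : ℕ → ℝ} (hd : Tendsto d atTop (𝓝[>] 0)) {φ : ℕ → H2H10 Ω}
    {g : H10 Ω} (hφ : Tendsto (fun k => toH10 (φ k)) atTop (𝓝 g)) {y t : ℕ → H10 Ω}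
    (hy : ∀ᶠ k in atTop, IsPenalizedState a f (d k) (toH10 (φ k)) (y k))
    (ht : ∀ k, IsObstacleState a f (toH10 (φ k)) (t k)) :
    Tendsto (fun k => y k - t k) atTop (𝓝 0) := by
  obtain ⟨M, m, hB⟩ := ha.exists_isCoerciveForm
  obtain ⟨S, hS⟩ := exists_penalizedState_map ha f
  have hL : 0 ≤ M / m := div_nonneg hB.nonneg hB.pos.le
  have hdpos : ∀ᶠ k in atTop, 0 < d k := hd.eventually eventually_mem_nhdsWithin
  rw [Metric.tendsto_atTop']
  intro ε hε
  set η := ε / (4 * (M / m + 1)) with hη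
  have hηpos : 0 < η := by positivity
  have hLη : M / m * η ≤ ε / 4 := by
    have : (M / m + 1) * η = ε / 4 := by rw [hη]; field_simp
    nlinarith
  -- The obstacle is frozen at index `N`, an element of `H²`, where convergence is known. The two
  -- Lipschitz estimates transfer it to later indices, each costing at most `ε / 4`.
  obtain ⟨N, hN⟩ := (Metric.cauchySeq_iff'.1 hφ.cauchySeq) η hηpos
  have h1 : Tendsto (fun k => S (d k) (toH10 (φ N))) atTop (𝓝 (t N)) :=
    (tendsto_penalizedState hΩ hΩb ha (fun δ hδ => hS δ hδ _) (ht N)).comp hd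
  have h2 := (tendsto_iff_norm_sub_tendsto_zero.1 h1).eventually_lt_const
    (show 0 < ε / 4 by positivity)
  obtain ⟨N', hN'⟩ := eventually_atTop.1 ((h2.and hy).and hdpos)
  refine ⟨max N N', fun k hk => ?_⟩
  obtain ⟨⟨h3, h4⟩, h5⟩ := hN' k ((le_max_right _ _).trans hk.le)
  have h6 := (hN k ((le_max_left _ _).trans hk.le)).le
  rw [dist_eq_norm] at h6
  have e1 := (h4.norm_sub_le hB h5 (hS _ h5 (toH10 (φ N)))).trans
    ((mul_le_mul_of_nonneg_left h6 hL).trans hLη)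
  have e2 := ((ht k).norm_sub_le hB (ht N)).trans ((mul_le_mul_of_nonneg_left h6 hL).trans hLη)
  rw [dist_zero_right]
  have e3 : y k - t k = (y k - S (d k) (toH10 (φ N))) + (S (d k) (toH10 (φ N)) - t N) -
      (t k - t N) := by abel
  rw [e3]
  linarith [norm_sub_le ((y k - S (d k) (toH10 (φ N))) + (S (d k) (toH10 (φ N)) - t N)) (t k - t N),
    norm_add_le (y k - S (d k) (toH10 (φ N))) (S (d k) (toH10 (φ N)) - t N)]

/-! ### Convergence of the penalized optimal pairs -/

section Convergence

variable {ν : ℝ} {Uad : Set (H2H10 Ω)} {φs : H2H10 Ω} {ys : H10 Ω} {φ : ℝ → H2H10 Ω}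
  {y : ℝ → H10 Ω}

theorem tendsto_cost_fixed {ι : Type*} {l : Filter ι} {u : ι → H10 Ω} {u₀ : H10 Ω}
    (hu : Tendsto u l (𝓝 u₀)) : Tendsto (fun k => cost ν z φs (u k)) l (𝓝 (cost ν z φs u₀)) := by
  have h := ((continuous_fnOf.tendsto _).comp hu).sub_const z
  exact ((h.norm.pow 2).const_mul _).add_const _

/-- `φ*` itself competes in the penalized problem, and its penalized cost tends to the optimal cost.
-/
theorem exists_bound_of_isPenalizedOptimal (hΩ : IsOpen Ω) (hΩb : Bornology.IsBounded Ω)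
    (ha : a.Admissible Ω) (hν : 0 < ν) (hopt : IsOptimal a f z ν Uad φs ys)
    (hφ : ∀ δ > 0, IsPenalizedOptimal a f z ν Uad φs δ (φ δ) (y δ)) :
    ∃ B, ∀ᶠ δ in 𝓝[>] 0, ‖fnOf (toH10 (φ δ))‖ + ‖laplacianOf (φ δ)‖ ≤ B ∧
      ‖fnOf (y δ) - z‖ ≤ B := by
  obtain ⟨S, hS⟩ := exists_penalizedState_map ha f
  have h1 := tendsto_cost_fixed (ν := ν) (z := z) (φs := φs)
    (tendsto_penalizedState hΩ hΩb ha (fun δ hδ => hS δ hδ (toH10 φs)) hopt.2.1)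
  set Q := cost ν z φs ys + 1 with hQ
  have h2 : ∀ᶠ δ in 𝓝[>] 0, cost ν z φs (S δ (toH10 φs)) < Q :=
    h1.eventually_lt_const (lt_add_one _)
  refine ⟨√(2 * Q) + ‖fnOf (toH10 φs)‖ + √(2 * Q / ν), ?_⟩
  filter_upwards [h2, eventually_mem_nhdsWithin] with δ h2 hδ
  have h3 := (hφ δ hδ).2.2 φs hopt.1 _ (hS δ hδ (toH10 φs))
  rw [sub_self, norm_zero, zero_pow two_ne_zero, mul_zero, add_zero] at h3
  have h4 := h3.trans h2.le
  rw [cost] at h4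
  have p1 := sq_nonneg ‖fnOf (y δ) - z‖
  have p2 := mul_nonneg (half_pos hν).le (sq_nonneg ‖laplacianOf (φ δ)‖)
  have p3 := sq_nonneg ‖fnOf (toH10 (φ δ)) - fnOf (toH10 φs)‖
  have q1 : ‖fnOf (y δ) - z‖ ≤ √(2 * Q) := Real.le_sqrt_of_sq_le (by linarith)
  have q2 : ‖fnOf (toH10 (φ δ)) - fnOf (toH10 φs)‖ ≤ √(2 * Q) :=
    Real.le_sqrt_of_sq_le (by linarith)
  have q3 : ‖laplacianOf (φ δ)‖ ≤ √(2 * Q / ν) := by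
    refine Real.le_sqrt_of_sq_le ?_
    rw [le_div_iff₀ hν]
    linarith
  have q4 : ‖fnOf (toH10 (φ δ))‖ ≤ ‖fnOf (toH10 (φ δ)) - fnOf (toH10 φs)‖ + ‖fnOf (toH10 φs)‖ := by
    have := norm_add_le (fnOf (toH10 (φ δ)) - fnOf (toH10 φs)) (fnOf (toH10 φs))
    rwa [sub_add_cancel] at this
  have q5 := norm_nonneg (fnOf (toH10 φs))
  have q6 := Real.sqrt_nonneg (2 * Q / ν)
  constructor <;> linarith

/-- Let `t` be the true obstacle state of `φ^δ`. Optimality of `φ^δ` against `φ*`, and of `φ*`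
against `φ^δ`, bounds `½‖φ^δ - φ*‖²` by two penalization errors of the cost. In the one at `φ^δ` the
Laplacian terms cancel, leaving only `y^δ - t`, which vanishes along subsequences. -/
theorem tendsto_fnOf_penalizedOptimal (hΩ : IsOpen Ω) (hΩb : Bornology.IsBounded Ω)
    (ha : a.Admissible Ω) (hν : 0 < ν) (hopt : IsOptimal a f z ν Uad φs ys)
    (hφ : ∀ δ > 0, IsPenalizedOptimal a f z ν Uad φs δ (φ δ) (y δ)) :
    Tendsto (fun δ => fnOf (toH10 (φ δ))) (𝓝[>] 0) (𝓝 (fnOf (toH10 φs))) := by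
  obtain ⟨B, hB⟩ := exists_bound_of_isPenalizedOptimal hΩ hΩb ha hν hopt hφ
  obtain ⟨S, hS⟩ := exists_penalizedState_map ha f
  have h1 := tendsto_cost_fixed (ν := ν) (z := z) (φs := φs)
    (tendsto_penalizedState hΩ hΩb ha (fun δ hδ => hS δ hδ (toH10 φs)) hopt.2.1)
  refine tendsto_of_subseq_tendsto fun d hd => ?_
  obtain ⟨g, σ, hσ, hg⟩ := exists_tendsto_toH10_subseq hΩb (φ := fun k => φ (d k)) (C := B)
    ((hd.eventually hB).mono fun k h => h.1)
  refine ⟨σ, ?_⟩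
  have hdσ : Tendsto (fun k => d (σ k)) atTop (𝓝[>] 0) := hd.comp hσ.tendsto_atTop
  have hpos : ∀ᶠ k in atTop, 0 < d (σ k) := hdσ.eventually eventually_mem_nhdsWithin
  choose t ht using fun k => exists_isObstacleState hΩ hΩb ha f (φ (d (σ k)))
  have h2 := tendsto_penalizedState_sub hΩ hΩb ha hdσ hg (y := fun k => y (d (σ k))) (t := t)
    (hpos.mono fun k hk => (hφ _ hk).2.1) ht
  have h3 : Tendsto (fun k => ‖fnOf (y (d (σ k))) - fnOf (t k)‖) atTop (𝓝 0) := by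
    refine squeeze_zero (fun k => norm_nonneg _) (fun k => ?_) (tendsto_zero_iff_norm_tendsto_zero.1 h2)
    rw [← fnOf_sub]
    exact norm_fnOf_le _
  have h4 := (h1.comp hdσ).sub_const (cost ν z φs ys)
  rw [sub_self] at h4
  -- The product bounds `‖t - z‖² - ‖y - z‖²`, by `‖t - z‖ ≤ B + ‖y - t‖`.
  have h5 := h4.add (h3.mul (h3.const_add (2 * B)))
  have h6 := (h5.const_mul 2).sqrt
  simp only [add_zero, zero_mul, mul_zero, Real.sqrt_zero] at h6
  rw [tendsto_iff_norm_sub_tendsto_zero]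
  refine squeeze_zero' (Eventually.of_forall fun k => norm_nonneg _) ?_ h6
  filter_upwards [hpos, hdσ.eventually hB] with k hk hBk
  refine Real.le_sqrt_of_sq_le ?_
  have e1 := (hφ _ hk).2.2 φs hopt.1 _ (hS _ hk (toH10 φs))
  rw [sub_self, norm_zero, zero_pow two_ne_zero, mul_zero, add_zero] at e1
  have e2 := hopt.2.2 _ (hφ _ hk).1 _ (ht k)
  have e3 : cost ν z (φ (d (σ k))) (t k) - cost ν z (φ (d (σ k))) (y (d (σ k))) ≤
      ‖fnOf (y (d (σ k))) - fnOf (t k)‖ * (2 * B + ‖fnOf (y (d (σ k))) - fnOf (t k)‖) := by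
    simp only [cost]
    have q1 : ‖fnOf (t k) - z‖ ≤
        ‖fnOf (y (d (σ k))) - z‖ + ‖fnOf (y (d (σ k))) - fnOf (t k)‖ := by
      have := norm_sub_le (fnOf (y (d (σ k))) - z) (fnOf (y (d (σ k))) - fnOf (t k))
      rwa [sub_sub_sub_cancel_left] at this
    have q2 := hBk.2
    have q3 := norm_nonneg (fnOf (t k) - z)
    have q4 := norm_nonneg (fnOf (y (d (σ k))) - z)
    have q5 := norm_nonneg (fnOf (y (d (σ k))) - fnOf (t k))
    nlinarith [mul_le_mul_of_nonneg_left q2 q5, pow_le_pow_left₀ q3 q1 2, mul_nonneg q5 q4]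
  simp only [Function.comp_apply]
  linarith

theorem tendsto_penalizedOptimal (hΩ : IsOpen Ω) (hΩb : Bornology.IsBounded Ω)
    (ha : a.Admissible Ω) (hν : 0 < ν) (hopt : IsOptimal a f z ν Uad φs ys)
    (hφ : ∀ δ > 0, IsPenalizedOptimal a f z ν Uad φs δ (φ δ) (y δ)) :
    Tendsto (fun δ => toH10 (φ δ)) (𝓝[>] 0) (𝓝 (toH10 φs)) ∧ Tendsto y (𝓝[>] 0) (𝓝 ys) := by
  obtain ⟨C, hC⟩ := exists_bound_of_isPenalizedOptimal hΩ hΩb ha hν hopt hφ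
  have h1 : Tendsto (fun δ => toH10 (φ δ)) (𝓝[>] 0) (𝓝 (toH10 φs)) :=
    tendsto_toH10 (hC.mono fun δ h => (le_add_of_nonneg_left (norm_nonneg _)).trans h.1)
      (tendsto_fnOf_penalizedOptimal hΩ hΩb ha hν hopt hφ)
  refine ⟨h1, ?_⟩
  obtain ⟨M, m, hB⟩ := ha.exists_isCoerciveForm
  obtain ⟨S, hS⟩ := exists_penalizedState_map ha f
  have h2 := tendsto_penalizedState hΩ hΩb ha (fun δ hδ => hS δ hδ (toH10 φs)) hopt.2.1
  have h3 : Tendsto (fun δ => y δ - S δ (toH10 φs)) (𝓝[>] 0) (𝓝 0) := by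
    have h4 := (tendsto_iff_norm_sub_tendsto_zero.1 h1).const_mul (M / m)
    rw [mul_zero] at h4
    refine squeeze_zero_norm' ?_ h4
    filter_upwards [eventually_mem_nhdsWithin] with δ hδ
    exact (hφ δ hδ).2.1.norm_sub_le hB hδ (hS δ hδ _)
  simpa using h3.add h2

end Convergence

end ObstacleControl

namespace ObstacleControl

variable {n : ℕ} {Ω : Set (EuclideanSpace ℝ (Fin n))} {a : Coeffs n} {f z : L2 Ω}

/-! ### The adjoint state -/

/-- Test with `p`: the form and the weighted term are both nonnegative, so each is bounded by the
right-hand side. -/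
theorem IsAdjointState.bounds {M m : ℝ} (hB : a.IsCoerciveForm Ω M m) {δ : ℝ} (hδ : 0 < δ)
    {φ y p : H10 Ω} (h : IsAdjointState a z δ φ y p) :
    ‖p‖ ≤ ‖fnOf y - z‖ / m ∧
      inner ℝ (mulL (betaDeriv_memLp hδ (fnOf (y - φ))) (fnOf p)) (fnOf p) ≤
        ‖fnOf y - z‖ * ‖p‖ := by
  have h1 := (isAdjointState_iff hδ).1 h p
  have h2 : 0 ≤ inner ℝ (mulL (betaDeriv_memLp hδ (fnOf (y - φ))) (fnOf p)) (fnOf p) := by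
    rw [inner_mulL]
    refine integral_nonneg fun x => ?_
    rw [mul_assoc]
    exact mul_nonneg (betaDeriv_nonneg hδ _) (mul_self_nonneg _)
  have h3 := hB.coercive p
  have h4 := (real_inner_le_norm (fnOf y - z) (fnOf p)).trans
    (mul_le_mul_of_nonneg_left (norm_fnOf_le p) (norm_nonneg _))
  have h5 : 0 ≤ m * ‖p‖ ^ 2 := mul_nonneg hB.pos.le (sq_nonneg _)
  exact ⟨le_div_of_mul_sq_le hB.pos (norm_nonneg p) (norm_nonneg _) (by linarith), by linarith⟩

/-- Pointwise `|β_δ(w) p| ≤ β_δ'(w) |w| |p|`. Young's inequality with weight `β_δ'(w)` splits the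
product, and `β_δ'(w) w² ≤ 2 β_δ(w) w` absorbs the second half. -/
theorem abs_inner_betaL_le {δ : ℝ} (hδ : 0 < δ) (w p : L2 Ω) {τ : ℝ} (hτ : 0 < τ) :
    |inner ℝ (betaL hδ w) p| ≤
      τ * inner ℝ (mulL (betaDeriv_memLp hδ w) p) p + inner ℝ (betaL hδ w) w / τ := by
  rw [L2_inner_eq, L2_inner_eq, L2_inner_eq, ← integral_const_mul, ← integral_div,
    ← integral_add ((L2_integrable_mul _ _).const_mul _) ((L2_integrable_mul _ _).div_const _),
    ← Real.norm_eq_abs]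
  refine norm_integral_le_of_norm_le
    (((L2_integrable_mul _ _).const_mul _).add ((L2_integrable_mul _ _).div_const _)) ?_
  filter_upwards [coeFn_betaL hδ w, coeFn_mulL (betaDeriv_memLp hδ w) p] with x h1 h2
  simp only [h1, h2]
  set b := betaDeriv δ (w x)
  have hb : 0 ≤ b := betaDeriv_nonneg hδ _
  have e1 : ‖beta δ (w x) * p x‖ ≤ b * |w x| * |p x| := by
    rw [norm_mul, Real.norm_eq_abs, Real.norm_eq_abs]
    exact mul_le_mul_of_nonneg_right (abs_beta_le hδ _) (abs_nonneg _)
  have e2 := betaDeriv_mul_sq_le hδ (w x)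
  have e3 : b * |w x| * |p x| ≤ τ * (b * p x * p x) + b * w x ^ 2 / 2 / τ := by
    have q : 0 ≤ b * (τ * |p x| - |w x| / 2) ^ 2 / τ := by positivity
    have q2 : b * (τ * |p x| - |w x| / 2) ^ 2 / τ =
        τ * (b * |p x| ^ 2) + b * |w x| ^ 2 / 4 / τ - b * |w x| * |p x| := by
      field_simp; ring
    rw [q2, sq_abs, sq_abs] at q
    have q3 : b * w x ^ 2 / 4 / τ ≤ b * w x ^ 2 / 2 / τ := by
      have : 0 ≤ b * w x ^ 2 := by positivity
      gcongr
      norm_num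
    have q4 : b * p x * p x = b * p x ^ 2 := by ring
    rw [q4]
    linarith
  have e4 : b * w x ^ 2 / 2 / τ ≤ beta δ (w x) * w x / τ := by
    refine div_le_div_of_nonneg_right ?_ hτ.le
    linarith
  linarith

/-- A bounded family that converges when tested against a dense set converges weakly. -/
theorem weaklyTendsto_of_denseRange {ι E H : Type*} [NormedAddCommGroup H] [InnerProductSpace ℝ H]
    {T : E → H} (hT : DenseRange T) {u : ι → H} {l : Filter ι} {u₀ : H} {C : ℝ}
    (hC : ∀ᶠ k in l, ‖u k‖ ≤ C)
    (h : ∀ v, Tendsto (fun k => inner ℝ (u k) (T v)) l (𝓝 (inner ℝ u₀ (T v)))) :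
    WeaklyTendsto u l u₀ := by
  intro w
  rw [Metric.tendsto_nhds]
  intro ε hε
  set D := |C| + ‖u₀‖ + 1 with hD
  have hDpos : 0 < D := by positivity
  obtain ⟨v, hv⟩ := hT.exists_dist_lt w (show 0 < ε / (2 * D) by positivity)
  rw [dist_eq_norm] at hv
  filter_upwards [hC, Metric.tendsto_nhds.1 (h v) (ε / 2) (half_pos hε)] with k h1 h2
  rw [Real.dist_eq] at h2 ⊢
  have e : inner ℝ (u k) w - inner ℝ u₀ w =
      (inner ℝ (u k) (T v) - inner ℝ u₀ (T v)) + inner ℝ (u k - u₀) (w - T v) := by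
    simp only [inner_sub_left, inner_sub_right]
    ring
  have h3 : ‖u k - u₀‖ ≤ D := by
    have := norm_sub_le (u k) u₀
    linarith [le_abs_self C]
  have h4 : |inner ℝ (u k - u₀) (w - T v)| ≤ ε / 2 := by
    refine (abs_real_inner_le_norm _ _).trans ?_
    refine (mul_le_mul h3 hv.le (norm_nonneg _) hDpos.le).trans_eq ?_
    field_simp
  rw [e]
  linarith [abs_add_le (inner ℝ (u k) (T v) - inner ℝ u₀ (T v)) (inner ℝ (u k - u₀) (w - T v))]

/-- Complementarity, from the competitors `φ` and `2y - φ`. -/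
theorem IsObstacleState.form_sub_eq (ha : a.Admissible Ω) {φ y : H10 Ω}
    (h : IsObstacleState a f φ y) : a.form y (y - φ) = inner ℝ f (fnOf (y - φ)) := by
  obtain ⟨M, m, hB⟩ := ha.exists_isCoerciveForm
  have h1 := h.2 φ (Eventually.of_forall fun x => le_rfl)
  have h2 := h.2 (y + (y - φ)) (by
    filter_upwards [h.1, Lp.coeFn_add (fnOf y) (fnOf (y - φ)),
      Lp.coeFn_sub (fnOf y) (fnOf φ)] with x h1 h2 h3
    rw [fnOf_add, h2, Pi.add_apply, fnOf_sub, h3, Pi.sub_apply]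
    linarith)
  rw [add_sub_cancel_left] at h2
  rw [hB.form_sub_right, fnOf_sub, inner_sub_right] at h1
  refine le_antisymm ?_ h2
  rw [hB.form_sub_right, fnOf_sub, inner_sub_right]
  linarith

/-! ### First variation of the penalized cost -/

/-- The remainder is quadratic only in `L¹`, while `p` need not be bounded. So `p` is split into a
bounded test function, which takes the quadratic bound, and an error of size `ε δ / 2`, which meets
the linear `L²` bound `2 / δ`. -/
theorem abs_inner_beta_remainder_le {δ : ℝ} (hδ : 0 < δ) (w : L2 Ω) (p : H10 Ω) {ε : ℝ}
    (hε : 0 < ε) : ∃ K, ∀ w' : L2 Ω,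
      |inner ℝ (betaL hδ w' - betaL hδ w - mulL (betaDeriv_memLp hδ w) (w' - w)) (fnOf p)| ≤
        ε * ‖w' - w‖ + K * ‖w' - w‖ ^ 2 := by
  obtain ⟨q, hq, hpq⟩ := H10.exists_test_near p (show 0 < ε * δ / 2 by positivity)
  obtain ⟨Q, hQ⟩ := hq.1.continuous.bounded_above_of_compact_support hq.2.1
  refine ⟨1 / δ * Q, fun w' => ?_⟩
  set h := w' - w with hh
  set r := betaL hδ w' - betaL hδ w - mulL (betaDeriv_memLp hδ w) h with hr
  have hrx : ∀ᵐ x ∂(volume.restrict Ω), r x =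
      beta δ (w' x) - beta δ (w x) - betaDeriv δ (w x) * (w' x - w x) ∧ h x = w' x - w x := by
    filter_upwards [Lp.coeFn_sub (betaL hδ w' - betaL hδ w) (mulL (betaDeriv_memLp hδ w) h),
      Lp.coeFn_sub (betaL hδ w') (betaL hδ w), coeFn_betaL hδ w', coeFn_betaL hδ w,
      coeFn_mulL (betaDeriv_memLp hδ w) h, Lp.coeFn_sub w' w] with x e1 e2 e3 e4 e5 e6
    rw [hr, e1, Pi.sub_apply, e2, Pi.sub_apply, e3, e4, e5, hh, e6, Pi.sub_apply]
    exact ⟨rfl, rfl⟩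
  have h1 : ‖r‖ ≤ 2 / δ * ‖h‖ := by
    refine Lp.norm_le_mul_norm_of_ae_le_mul ?_
    filter_upwards [hrx] with x ⟨e1, e2⟩
    rw [e1, e2]
    exact beta_remainder' hδ _ _
  have h2 : |inner ℝ r hq.toL2| ≤ 1 / δ * Q * ‖h‖ ^ 2 := by
    rw [← real_inner_self_eq_norm_sq, L2_inner_eq, L2_inner_eq, ← integral_const_mul,
      ← Real.norm_eq_abs]
    refine norm_integral_le_of_norm_le ((L2_integrable_mul _ _).const_mul _) ?_
    filter_upwards [hrx, hq.coeFn_toL2] with x ⟨e1, e2⟩ e3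
    rw [e1, e2, e3, norm_mul]
    have := mul_le_mul (beta_remainder hδ (w' x) (w x)) (hQ x) (norm_nonneg _) (by positivity)
    rw [Real.norm_eq_abs]
    refine this.trans_eq ?_
    ring
  have h3 : inner ℝ r (fnOf p) = inner ℝ r (fnOf (p - hq.toH10)) + inner ℝ r hq.toL2 := by
    rw [fnOf_sub, inner_sub_right, IsTest.fnOf_toH10]
    ring
  have h4 : |inner ℝ r (fnOf (p - hq.toH10))| ≤ ε * ‖h‖ := by
    refine (abs_real_inner_le_norm _ _).trans ?_
    refine (mul_le_mul h1 ((norm_fnOf_le _).trans hpq.le) (norm_nonneg _) (by positivity)).trans_eq ?_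
    field_simp
  rw [h3]
  exact (abs_add_le _ _).trans (add_le_add h4 h2)

/-- Divide by `|t|` for both signs of `t` and let `t → 0` with `ε` fixed, since `K` may depend on
`ε`; only then let `ε → 0`. -/
theorem eq_zero_of_forall_quadratic {G c : ℝ}
    (h : ∀ ε > 0, ∃ K, ∀ t : ℝ, 0 ≤ t * G + c * ε * |t| + K * t ^ 2) : G = 0 := by
  have key : ∀ ε > 0, |G| ≤ c * ε := fun ε hε => by
    obtain ⟨K, hK⟩ := h ε hε
    have h1 : ∀ s : ℝ, 0 < s → |G| ≤ c * ε + K * s := fun s hs => by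
      have e1 := hK s
      have e2 := hK (-s)
      rw [abs_neg, abs_of_pos hs] at e2
      rw [abs_of_pos hs] at e1
      refine abs_le'.2 ⟨?_, ?_⟩ <;> refine le_of_mul_le_mul_left ?_ hs <;> nlinarith
    have h2 : Tendsto (fun s : ℝ => c * ε + K * s) (𝓝[>] 0) (𝓝 (c * ε + K * 0)) :=
      Tendsto.mono_left (Continuous.tendsto (by fun_prop) 0) nhdsWithin_le_nhds
    rw [mul_zero, add_zero] at h2
    exact ge_of_tendsto h2 (eventually_nhdsWithin_of_forall h1)
  have h2 : Tendsto (fun s : ℝ => c * s) (𝓝[>] 0) (𝓝 (c * 0)) :=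
    Tendsto.mono_left (Continuous.tendsto (by fun_prop) 0) nhdsWithin_le_nhds
  rw [mul_zero] at h2
  exact abs_nonpos_iff.1 (ge_of_tendsto h2 (eventually_nhdsWithin_of_forall key))

theorem inner_mulL_comm {α : Type*} [MeasurableSpace α] {μ : Measure α} {b : α → ℝ}
    (hb : MemLp b ⊤ μ) (u v : Lp ℝ 2 μ) : inner ℝ (mulL hb u) v = inner ℝ (mulL hb v) u := by
  rw [inner_mulL, inner_mulL]
  exact integral_congr_ae (Eventually.of_forall fun x => by ring)

set_option maxHeartbeats 2000000 in
/-- The optimality system of the penalized problem without control constraints. -/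
theorem IsPenalizedOptimal.form_adjoint_eq (ha : a.Admissible Ω) {ν δ : ℝ} (hδ : 0 < δ)
    {φs φ : H2H10 Ω} {y p : H10 Ω} (h : IsPenalizedOptimal a f z ν Set.univ φs δ φ y)
    (hp : IsAdjointState a z δ (toH10 φ) y p) (ψ : H2H10 Ω) :
    a.form (toH10 ψ) p = inner ℝ (fnOf y - z) (fnOf (toH10 ψ)) +
      ν * inner ℝ (laplacianOf φ) (laplacianOf ψ) +
      inner ℝ (fnOf (toH10 φ) - fnOf (toH10 φs)) (fnOf (toH10 ψ)) := by
  obtain ⟨M, m, hB⟩ := ha.exists_isCoerciveForm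
  rw [isAdjointState_iff hδ] at hp
  set b := mulL (betaDeriv_memLp hδ (fnOf (y - toH10 φ))) with hb
  -- `G` is the derivative of the reduced penalized cost in direction `ψ`, with the state derivative
  -- eliminated by the adjoint equation.
  set G := inner ℝ (b (fnOf p)) (fnOf (toH10 ψ)) +
    ν * inner ℝ (laplacianOf φ) (laplacianOf ψ) +
    inner ℝ (fnOf (toH10 φ) - fnOf (toH10 φs)) (fnOf (toH10 ψ)) with hG
  suffices hG0 : G = 0 by
    have := hp (toH10 ψ)
    linarith
  set L := M / m * ‖toH10 ψ‖ with hL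
  have hL0 : 0 ≤ L := mul_nonneg (div_nonneg hB.nonneg hB.pos.le) (norm_nonneg _)
  set N := L + ‖toH10 ψ‖ with hN
  refine eq_zero_of_forall_quadratic (c := N) fun ε hε => ?_
  obtain ⟨K, hK⟩ := abs_inner_beta_remainder_le hδ (fnOf (y - toH10 φ)) p hε
  refine ⟨1 / 2 * L ^ 2 + |K| * N ^ 2 + ν / 2 * ‖laplacianOf ψ‖ ^ 2 +
    1 / 2 * ‖fnOf (toH10 ψ)‖ ^ 2, fun t => ?_⟩
  obtain ⟨yt, hyt⟩ := exists_isPenalizedState ha f hδ (toH10 (φ + t • ψ))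
  have hopt := h.2.2 (φ + t • ψ) trivial yt hyt
  set D := yt - y with hD
  have hDn : ‖D‖ ≤ L * |t| := by
    have := hyt.norm_sub_le hB hδ h.2.1
    rw [toH10_add, toH10_smul, add_sub_cancel_left, norm_smul, Real.norm_eq_abs] at this
    rw [hL]
    linarith
  have hwt : fnOf (yt - toH10 (φ + t • ψ)) - fnOf (y - toH10 φ) = fnOf D - t • fnOf (toH10 ψ) := by
    simp only [hD, toH10_add, toH10_smul, fnOf_sub, fnOf_add, fnOf_smul]
    abel
  have hwn : ‖fnOf D - t • fnOf (toH10 ψ)‖ ≤ N * |t| := by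
    refine (norm_sub_le _ _).trans ?_
    rw [norm_smul, Real.norm_eq_abs, hN, add_mul]
    refine add_le_add ((norm_fnOf_le D).trans hDn) ?_
    rw [mul_comm]
    exact mul_le_mul_of_nonneg_right (norm_fnOf_le _) (abs_nonneg t)
  have hR := hK (fnOf (yt - toH10 (φ + t • ψ)))
  rw [hwt] at hR
  have hR2 : |inner ℝ (betaL hδ (fnOf (yt - toH10 (φ + t • ψ))) - betaL hδ (fnOf (y - toH10 φ)) -
      b (fnOf D - t • fnOf (toH10 ψ))) (fnOf p)| ≤ N * ε * |t| + |K| * N ^ 2 * t ^ 2 := by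
    refine hR.trans ?_
    have e1 := mul_le_mul_of_nonneg_left hwn hε.le
    have e2 := pow_le_pow_left₀ (norm_nonneg _) hwn 2
    rw [mul_pow, sq_abs] at e2
    have e3 := mul_le_mul (le_abs_self K) e2 (sq_nonneg _) (abs_nonneg K)
    linarith
  have hadj := hp D
  have hst : a.form D p + inner ℝ (betaL hδ (fnOf (yt - toH10 (φ + t • ψ))) -
      betaL hδ (fnOf (y - toH10 φ))) (fnOf p) = 0 := by
    have e1 := (isPenalizedState_iff hδ).1 hyt p
    have e2 := (isPenalizedState_iff hδ).1 h.2.1 p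
    rw [hD, hB.form_sub_left, inner_sub_left]
    linarith
  -- The adjoint equation tested with `D` and the difference of state equations tested with `p`
  -- share `a(D, p)`; eliminating it leaves the linear term and the remainder.
  have hyz : inner ℝ (fnOf y - z) (fnOf D) = t * inner ℝ (b (fnOf p)) (fnOf (toH10 ψ)) -
      inner ℝ (betaL hδ (fnOf (yt - toH10 (φ + t • ψ))) - betaL hδ (fnOf (y - toH10 φ)) -
      b (fnOf D - t • fnOf (toH10 ψ))) (fnOf p) := by
    have c1 : inner ℝ (b (fnOf D)) (fnOf p) = inner ℝ (b (fnOf p)) (fnOf D) :=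
      inner_mulL_comm _ _ _
    have c2 : inner ℝ (b (fnOf (toH10 ψ))) (fnOf p) = inner ℝ (b (fnOf p)) (fnOf (toH10 ψ)) :=
      inner_mulL_comm _ _ _
    rw [inner_sub_left (betaL hδ (fnOf (yt - toH10 (φ + t • ψ))) - betaL hδ (fnOf (y - toH10 φ))),
      map_sub, map_smul, inner_sub_left (b (fnOf D)), real_inner_smul_left, c1, c2]
    linarith
  have n1 : ‖fnOf yt - z‖ ^ 2 = ‖fnOf y - z‖ ^ 2 + 2 * inner ℝ (fnOf y - z) (fnOf D) +
      ‖fnOf D‖ ^ 2 := by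
    have : fnOf yt - z = (fnOf y - z) + fnOf D := by rw [hD, fnOf_sub]; abel
    rw [this, norm_add_sq_real]
  have n2 : ‖laplacianOf (φ + t • ψ)‖ ^ 2 = ‖laplacianOf φ‖ ^ 2 +
      2 * (t * inner ℝ (laplacianOf φ) (laplacianOf ψ)) + t ^ 2 * ‖laplacianOf ψ‖ ^ 2 := by
    rw [laplacianOf_add, laplacianOf_smul, norm_add_sq_real, inner_smul_right, norm_smul, mul_pow,
      Real.norm_eq_abs, sq_abs]
  have n3 : ‖fnOf (toH10 (φ + t • ψ)) - fnOf (toH10 φs)‖ ^ 2 =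
      ‖fnOf (toH10 φ) - fnOf (toH10 φs)‖ ^ 2 +
      2 * (t * inner ℝ (fnOf (toH10 φ) - fnOf (toH10 φs)) (fnOf (toH10 ψ))) +
      t ^ 2 * ‖fnOf (toH10 ψ)‖ ^ 2 := by
    have : fnOf (toH10 (φ + t • ψ)) - fnOf (toH10 φs) =
        (fnOf (toH10 φ) - fnOf (toH10 φs)) + t • fnOf (toH10 ψ) := by
      rw [toH10_add, toH10_smul, fnOf_add, fnOf_smul]; abel
    rw [this, norm_add_sq_real, inner_smul_right, norm_smul, mul_pow, Real.norm_eq_abs, sq_abs]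
  have n4 : ‖fnOf D‖ ^ 2 ≤ L ^ 2 * t ^ 2 := by
    rw [← sq_abs t, ← mul_pow]
    exact pow_le_pow_left₀ (norm_nonneg _) ((norm_fnOf_le D).trans hDn) 2
  rw [cost, cost, n1, n2, n3, hyz] at hopt
  have n5 := (abs_le.1 hR2).1
  have n6 : t * G = t * inner ℝ (b (fnOf p)) (fnOf (toH10 ψ)) +
    ν * (t * inner ℝ (laplacianOf φ) (laplacianOf ψ)) +
    t * inner ℝ (fnOf (toH10 φ) - fnOf (toH10 φs)) (fnOf (toH10 ψ)) := by
    rw [hG]; ring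
  linarith

/-- A test function as an element of `H²(Ω) ∩ H₀¹(Ω)`. -/
noncomputable def IsTest.toH2H10 {ψ : EuclideanSpace ℝ (Fin n) → ℝ} (h : IsTest Ω ψ) : H2H10 Ω :=
  ⟨WithLp.toLp 2 (h.toH10, WithLp.toLp 2 fun q : Fin n × Fin n =>
    ((h.partial_isTest q.1).partial_isTest q.2).toL2), fun i j =>
      H10.hasWeakPartial (h.partial_isTest i).toH10 j⟩

theorem IsTest.exists_fnOf_eq_laplacianOf {ψ : EuclideanSpace ℝ (Fin n) → ℝ} (h : IsTest Ω ψ) :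
    ∃ v : H10 Ω, fnOf v = laplacianOf h.toH2H10 := by
  refine ⟨∑ i, ((h.partial_isTest i).partial_isTest i).toH10, ?_⟩
  rw [← fnL_apply, map_sum, laplacianOf_eq]
  rfl

end ObstacleControl

namespace ObstacleControl

variable {n : ℕ} {Ω : Set (EuclideanSpace ℝ (Fin n))} {a : Coeffs n} {f z : L2 Ω}

/-! ### Passage to the limit -/

section Limit

variable {ν : ℝ} {φs : H2H10 Ω} {ys : H10 Ω} {ξs : L2 Ω} {φ : ℝ → H2H10 Ω} {y p : ℝ → H10 Ω}

/-- The pairing equals `(f, q) - a(y, q)` with `y` strongly and `q` weakly convergent, so no `L²`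
bound on `ξ^δ` is required. -/
theorem tendsto_xiPairing (ha : a.Admissible Ω) {ι : Type*} {l : Filter ι} {d : ι → ℝ}
    (hd : Tendsto d l (𝓝[>] 0))
    (hξs : ∀ v : H10 Ω, a.form ys v + inner ℝ ξs (fnOf v) = inner ℝ f (fnOf v))
    (hst : ∀ δ > 0, IsPenalizedState a f δ (toH10 (φ δ)) (y δ))
    (hy : Tendsto y (𝓝[>] 0) (𝓝 ys)) {q : ι → H10 Ω} {q₀ : H10 Ω}
    (hq : WeaklyTendsto q l q₀) {C : ℝ} (hC : ∀ᶠ k in l, ‖q k‖ ≤ C) :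
    Tendsto (fun k => xiPairing (d k) (toH10 (φ (d k))) (y (d k)) (fnOf (q k))) l
      (𝓝 (inner ℝ ξs (fnOf q₀))) := by
  have h1 := hq.apply₂ hC (hy.comp hd) (Coeffs.formL ha)
  have h2 := hq.apply ((innerSL ℝ f).comp fnL)
  have h3 := h2.sub h1
  have e : inner ℝ ξs (fnOf q₀) = inner ℝ f (fnOf q₀) - a.form ys q₀ := by
    linarith [hξs q₀]
  rw [Coeffs.formL_apply] at h3
  rw [e]
  refine h3.congr' ?_
  filter_upwards [hd.eventually eventually_mem_nhdsWithin] with k hk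
  rw [Coeffs.formL_apply, xiPairing_eq hk]
  have := (isPenalizedState_iff hk).1 (hst _ hk) (q k)
  change inner ℝ f (fnOf (q k)) - a.form (y (d k)) (q k) = _
  linarith

theorem tendsto_xiPairing_fixed (ha : a.Admissible Ω)
    (hξs : ∀ v : H10 Ω, a.form ys v + inner ℝ ξs (fnOf v) = inner ℝ f (fnOf v))
    (hst : ∀ δ > 0, IsPenalizedState a f δ (toH10 (φ δ)) (y δ))
    (hy : Tendsto y (𝓝[>] 0) (𝓝 ys)) (v : H10 Ω) :
    Tendsto (fun δ => xiPairing δ (toH10 (φ δ)) (y δ) (fnOf v)) (𝓝[>] 0)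
      (𝓝 (inner ℝ ξs (fnOf v))) := by
  have h := tendsto_xiPairing ha (d := fun δ => δ) tendsto_id hξs hst hy (q := fun _ => v)
    (q₀ := v) (fun w => tendsto_const_nhds) (C := ‖v‖) (Eventually.of_forall fun _ => le_rfl)
  exact h

theorem tendsto_xiPairing_self (ha : a.Admissible Ω)
    (hys : IsObstacleState a f (toH10 φs) ys)
    (hst : ∀ δ > 0, IsPenalizedState a f δ (toH10 (φ δ)) (y δ))
    (hφ : Tendsto (fun δ => toH10 (φ δ)) (𝓝[>] 0) (𝓝 (toH10 φs)))
    (hy : Tendsto y (𝓝[>] 0) (𝓝 ys)) :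
    Tendsto (fun δ => xiPairing δ (toH10 (φ δ)) (y δ) (fnOf (y δ - toH10 (φ δ)))) (𝓝[>] 0)
      (𝓝 0) := by
  have h0 := hy.sub hφ
  have h1 := ha.tendsto_form hy h0
  have h2 := (tendsto_const_nhds (x := f)).inner (𝕜 := ℝ) ((continuous_fnOf.tendsto _).comp h0)
  have h3 := h2.sub h1
  rw [hys.form_sub_eq ha, sub_self] at h3
  refine h3.congr' ?_
  filter_upwards [eventually_mem_nhdsWithin] with δ hδ
  rw [xiPairing_eq hδ]
  have := (isPenalizedState_iff hδ).1 (hst _ hδ) (y δ - toH10 (φ δ))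
  change inner ℝ f (fnOf (y δ - toH10 (φ δ))) - a.form (y δ) (y δ - toH10 (φ δ)) = _
  linarith

theorem exists_adjoint_bounds (ha : a.Admissible Ω)
    (hp : ∀ δ > 0, IsAdjointState a z δ (toH10 (φ δ)) (y δ) (p δ))
    (hy : Tendsto y (𝓝[>] 0) (𝓝 ys)) :
    ∃ C, 0 < C ∧ ∀ᶠ δ in 𝓝[>] 0, ‖p δ‖ ≤ C ∧ ∀ hδ : 0 < δ,
      inner ℝ (mulL (betaDeriv_memLp hδ (fnOf (y δ - toH10 (φ δ)))) (fnOf (p δ)))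
        (fnOf (p δ)) ≤ C := by
  obtain ⟨M, m, hB⟩ := ha.exists_isCoerciveForm
  have h1 := (((continuous_fnOf.tendsto _).comp hy).sub_const z).norm
  set Y := ‖fnOf ys - z‖ + 1 with hY
  have hYpos : 0 < Y := by positivity
  have h2 : ∀ᶠ δ in 𝓝[>] 0, ‖fnOf (y δ) - z‖ ≤ Y :=
    h1.eventually_le_const (lt_add_one _)
  have hm := hB.pos
  refine ⟨Y / m + Y * (Y / m), by positivity, ?_⟩
  filter_upwards [h2, eventually_mem_nhdsWithin] with δ h2 hδ
  obtain ⟨b1, b2⟩ := (hp δ hδ).bounds hB hδ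
  have b3 : ‖p δ‖ ≤ Y / m := b1.trans (div_le_div_of_nonneg_right h2 hm.le)
  have b4 : ‖fnOf (y δ) - z‖ * ‖p δ‖ ≤ Y * (Y / m) :=
    mul_le_mul h2 b3 (norm_nonneg _) hYpos.le
  have b5 : 0 < Y / m := by positivity
  have b6 : 0 < Y * (Y / m) := by positivity
  exact ⟨by linarith, fun _ => b2.trans (by linarith)⟩

/-- The choice `τ = ε / (2C)` keeps the weighted integral of `p²` below `ε / 2`; with `τ` fixed, the
complementarity term is eventually below `ε / 2` too. -/
theorem tendsto_xiPairing_adjoint (ha : a.Admissible Ω)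
    (hys : IsObstacleState a f (toH10 φs) ys)
    (hst : ∀ δ > 0, IsPenalizedState a f δ (toH10 (φ δ)) (y δ))
    (hp : ∀ δ > 0, IsAdjointState a z δ (toH10 (φ δ)) (y δ) (p δ))
    (hφ : Tendsto (fun δ => toH10 (φ δ)) (𝓝[>] 0) (𝓝 (toH10 φs)))
    (hy : Tendsto y (𝓝[>] 0) (𝓝 ys)) :
    Tendsto (fun δ => xiPairing δ (toH10 (φ δ)) (y δ) (fnOf (p δ))) (𝓝[>] 0) (𝓝 0) := by
  obtain ⟨C, hC, hb⟩ := exists_adjoint_bounds ha hp hy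
  have hE := tendsto_xiPairing_self ha hys hst hφ hy
  rw [Metric.tendsto_nhds]
  intro ε hε
  set τ := ε / (2 * C) with hτ
  have hτpos : 0 < τ := by positivity
  have hE2 := hE.div_const τ
  rw [zero_div] at hE2
  filter_upwards [hb, hE2.eventually_lt_const (half_pos hε), eventually_mem_nhdsWithin]
    with δ h1 h2 hδ
  rw [xiPairing_eq hδ] at h2
  rw [Real.dist_eq, sub_zero, xiPairing_eq hδ]
  refine (abs_inner_betaL_le hδ _ _ hτpos).trans_lt ?_
  have h3 := mul_le_mul_of_nonneg_left (h1.2 hδ) hτpos.le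
  have h4 : τ * C = ε / 2 := by rw [hτ]; field_simp
  linarith

theorem weaklyTendsto_betaL (hΩ : IsOpen Ω) (ha : a.Admissible Ω)
    (hξs : ∀ v : H10 Ω, a.form ys v + inner ℝ ξs (fnOf v) = inner ℝ f (fnOf v))
    (hst : ∀ δ > 0, IsPenalizedState a f δ (toH10 (φ δ)) (y δ))
    (hφ : Tendsto (fun δ => toH10 (φ δ)) (𝓝[>] 0) (𝓝 (toH10 φs)))
    (hy : Tendsto y (𝓝[>] 0) (𝓝 ys)) {B : ℝ} (hB : ∀ᶠ δ in 𝓝[>] 0, ‖φ δ‖ ≤ B) (g : L2 Ω) :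
    Tendsto (fun δ => xiPairing δ (toH10 (φ δ)) (y δ) g) (𝓝[>] 0) (𝓝 (inner ℝ ξs g)) := by
  obtain ⟨C, hC0, hC⟩ := ha.exists_norm_betaL_le hΩ
  let Ξ : ℝ → L2 Ω := fun δ => if hδ : 0 < δ then betaL hδ (fnOf (y δ - toH10 (φ δ))) else 0
  have hΞ : ∀ δ, ∀ hδ : 0 < δ, Ξ δ = betaL hδ (fnOf (y δ - toH10 (φ δ))) := fun δ hδ =>
    dif_pos hδ
  have hpos : ∀ᶠ δ : ℝ in 𝓝[>] 0, 0 < δ := eventually_mem_nhdsWithin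
  have hbd : ∀ᶠ δ in 𝓝[>] 0, ‖Ξ δ‖ ≤ ‖f‖ + C * (B + (‖ys - toH10 φs‖ + 1)) := by
    filter_upwards [hpos, hB, (hy.sub hφ).norm.eventually_le_const (lt_add_one _)] with δ h1 h2 h3
    rw [hΞ δ h1]
    refine (hC h1 f (φ δ) (y δ) (hst δ h1)).trans ?_
    gcongr
  have hw : WeaklyTendsto Ξ (𝓝[>] 0) ξs := by
    refine weaklyTendsto_of_denseRange (fnOf_denseRange hΩ) hbd fun v => ?_
    have h1 := tendsto_xiPairing_fixed ha hξs hst hy v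
    refine h1.congr' ?_
    filter_upwards [hpos] with δ hδ
    rw [hΞ δ hδ]
    exact xiPairing_eq hδ _ _ _
  refine (hw g).congr' ?_
  filter_upwards [hpos] with δ hδ
  rw [hΞ δ hδ, xiPairing_eq hδ]

theorem exists_weaklyTendsto_adjoint_subseq {C : ℝ} (hb : ∀ᶠ δ in 𝓝[>] 0, ‖p δ‖ ≤ C)
    {d : ℕ → ℝ} (hd : Tendsto d atTop (𝓝[>] 0)) :
    ∃ (q : H10 Ω) (σ : ℕ → ℕ), StrictMono σ ∧ WeaklyTendsto (fun k => p (d (σ k))) atTop q :=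
  exists_weaklyTendsto_of_eventually_bounded (u := fun k => p (d k)) (hd.eventually hb)

/-- The only delicate term is `(Δφ^δ, Δψ)`, as `Δφ^δ` is merely bounded. Since `Δψ` is again a test
function, Green's formula rewrites it through `φ^δ`, which converges in `H₀¹`. -/
theorem exists_tendsto_form_adjoint (ha : a.Admissible Ω)
    (hφo : ∀ δ > 0, IsPenalizedOptimal a f z ν Set.univ φs δ (φ δ) (y δ))
    (hp : ∀ δ > 0, IsAdjointState a z δ (toH10 (φ δ)) (y δ) (p δ))
    (hφ : Tendsto (fun δ => toH10 (φ δ)) (𝓝[>] 0) (𝓝 (toH10 φs)))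
    (hy : Tendsto y (𝓝[>] 0) (𝓝 ys)) {ψ : EuclideanSpace ℝ (Fin n) → ℝ} (hψ : IsTest Ω ψ) :
    ∃ c : ℝ, Tendsto (fun δ => a.form hψ.toH10 (p δ)) (𝓝[>] 0) (𝓝 c) := by
  obtain ⟨v, hv⟩ := hψ.exists_fnOf_eq_laplacianOf
  have hf : Tendsto (fun δ => fnOf (toH10 (φ δ))) (𝓝[>] 0) (𝓝 (fnOf (toH10 φs))) :=
    (continuous_fnOf.tendsto _).comp hφ
  have hfy : Tendsto (fun δ => fnOf (y δ)) (𝓝[>] 0) (𝓝 (fnOf ys)) :=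
    (continuous_fnOf.tendsto _).comp hy
  have t1 := (hfy.sub_const z).inner (𝕜 := ℝ) (tendsto_const_nhds (x := fnOf hψ.toH10))
  have t2 := ((hf.inner (𝕜 := ℝ) (tendsto_const_nhds (x := fnOf v))).sub
    (hφ.inner (𝕜 := ℝ) (tendsto_const_nhds (x := v)))).const_mul ν
  have t3 := (hf.sub_const (fnOf (toH10 φs))).inner (𝕜 := ℝ)
    (tendsto_const_nhds (x := fnOf hψ.toH10))
  refine ⟨_, ((t1.add t2).add t3).congr' ?_⟩
  filter_upwards [eventually_mem_nhdsWithin] with δ hδ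
  have e := (hφo δ hδ).form_adjoint_eq ha hδ (hp δ hδ) hψ.toH2H10
  have e2 := inner_toH10 (φ δ) v
  have e0 : toH10 hψ.toH2H10 = hψ.toH10 := rfl
  rw [inner_sub_left] at e2
  rw [← hv, e0] at e
  have e3 : inner ℝ (laplacianOf (φ δ)) (fnOf v) =
    inner ℝ (fnOf (toH10 (φ δ))) (fnOf v) - inner ℝ (toH10 (φ δ)) v := by linarith
  rw [e, e3]

theorem eq_of_forall_form_test_eq (ha : a.Admissible Ω) {q q' : H10 Ω}
    (h : ∀ ψ (hψ : IsTest Ω ψ), a.form hψ.toH10 q = a.form hψ.toH10 q') : q = q' := by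
  obtain ⟨M, m, hB⟩ := ha.exists_isCoerciveForm
  have hc : ∀ q : H10 Ω, Continuous fun u : H10 Ω => a.form u q := fun q =>
    continuous_iff_continuousAt.2 fun u =>
      ha.tendsto_form (u := fun u => u) (v := fun _ => q) tendsto_id tendsto_const_nhds
  have h1 : ∀ u : H10 Ω, a.form u q = a.form u q' := fun u =>
    H10.closed_induction (P := fun u => a.form u q = a.form u q') (isClosed_eq (hc q) (hc q')) h u
  have h2 := hB.coercive (q - q')
  rw [hB.form_sub_right, h1, sub_self] at h2
  have h3 : ‖q - q'‖ ^ 2 ≤ 0 := nonpos_of_mul_nonpos_right h2 hB.pos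
  exact sub_eq_zero.1 (norm_eq_zero.1 (pow_eq_zero_iff two_ne_zero |>.1
    (le_antisymm h3 (sq_nonneg _))))

/-- Any two sequential weak limits have the same values `a(ψ, ·)` on test functions, hence coincide
by density and coercivity; boundedness then gives convergence of the family. -/
theorem exists_weaklyTendsto_adjoint (ha : a.Admissible Ω) {C : ℝ}
    (hb : ∀ᶠ δ in 𝓝[>] 0, ‖p δ‖ ≤ C)
    (hlim : ∀ ψ (hψ : IsTest Ω ψ), ∃ c : ℝ,
      Tendsto (fun δ => a.form hψ.toH10 (p δ)) (𝓝[>] 0) (𝓝 c)) :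
    ∃ ps, WeaklyTendsto p (𝓝[>] 0) ps := by
  have huniq : ∀ (d d' : ℕ → ℝ), Tendsto d atTop (𝓝[>] 0) → Tendsto d' atTop (𝓝[>] 0) →
      ∀ q q', WeaklyTendsto (fun k => p (d k)) atTop q →
      WeaklyTendsto (fun k => p (d' k)) atTop q' → q = q' := fun d d' hd hd' q q' hq hq' => by
    refine eq_of_forall_form_test_eq ha fun ψ hψ => ?_
    obtain ⟨c, hc⟩ := hlim ψ hψ
    have h2 := hq.apply (Coeffs.formL ha hψ.toH10)
    have h3 := hq'.apply (Coeffs.formL ha hψ.toH10)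
    simp only [Coeffs.formL_apply] at h2 h3
    rw [tendsto_nhds_unique h2 (hc.comp hd), tendsto_nhds_unique h3 (hc.comp hd')]
  have hd0 : Tendsto (fun k : ℕ => (1 : ℝ) / (k + 1)) atTop (𝓝[>] 0) :=
    tendsto_nhdsWithin_iff.2 ⟨tendsto_one_div_add_atTop_nhds_zero_nat,
      Eventually.of_forall fun k => Set.mem_Ioi.2 Nat.one_div_pos_of_nat⟩
  obtain ⟨ps, σ, hσ, hps⟩ := exists_weaklyTendsto_adjoint_subseq hb hd0
  refine ⟨ps, fun w => tendsto_of_subseq_tendsto fun d hd => ?_⟩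
  obtain ⟨q, τ, hτ, hq⟩ := exists_weaklyTendsto_adjoint_subseq hb hd
  refine ⟨τ, ?_⟩
  have := huniq (fun k => d (τ k)) (fun k => 1 / ((σ k : ℕ) + 1)) (hd.comp hτ.tendsto_atTop)
    (hd0.comp hσ.tendsto_atTop) q ps hq hps
  rw [← this]
  exact hq w

end Limit

end ObstacleControl

/-! ### Assembly of the limit statements -/

theorem mainTheorem9 {n : ℕ} (Ω : Set (EuclideanSpace ℝ (Fin n))) (hΩ : IsOpen Ω)
    (hΩb : Bornology.IsBounded Ω) (a : Coeffs n) (ha : a.Admissible Ω)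
    (f z : L2 Ω) (ν : ℝ) (hν : 0 < ν)
    (Uad : Set (H2H10 Ω)) (hUc : IsClosed Uad) (hUconv : Convex ℝ Uad)
    (φs : H2H10 Ω) (ys : H10 Ω)
    (hopt : IsOptimal a f z ν Uad φs ys)
    (φ : ℝ → H2H10 Ω) (y p : ℝ → H10 Ω)
    (hφ : ∀ δ > 0, IsPenalizedOptimal a f z ν Uad φs δ (φ δ) (y δ))
    (hp : ∀ δ > 0, IsAdjointState a z δ (toH10 (φ δ)) (y δ) (p δ)) :
    ∃ ξs : L2 Ω,
      -- `ξ* ≤ 0` and `A y* + ξ* = f`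
      (∀ᵐ x ∂(volume.restrict Ω), ξs x ≤ 0) ∧
      (∀ v : H10 Ω, a.form ys v + inner ℝ ξs (fnOf v) = inner ℝ f (fnOf v)) ∧
      -- `ξ^δ → ξ*` tested against `H₀¹(Ω)`
      (∀ v : H10 Ω,
        Tendsto (fun δ => xiPairing δ (toH10 (φ δ)) (y δ) (fnOf v)) (𝓝[>] 0)
          (𝓝 (inner ℝ ξs (fnOf v)))) ∧
      -- `ξ^δ → ξ*` weakly in `L²(Ω)` when `‖Δφ‖` controls the `H²`-norm on the admissible set
      ((∃ C : ℝ, ∀ φ' ∈ Uad, ‖φ'‖ ≤ C * (1 + ‖laplacianOf φ'‖)) →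
        ∀ g : L2 Ω,
          Tendsto (fun δ => xiPairing δ (toH10 (φ δ)) (y δ) g) (𝓝[>] 0)
            (𝓝 (inner ℝ ξs g))) ∧
      -- the pairing `(ξ^δ, p^δ)` tends to `0` along the whole family
      Tendsto (fun δ => xiPairing δ (toH10 (φ δ)) (y δ) (fnOf (p δ))) (𝓝[>] 0)
        (𝓝 0) ∧
      -- `(p^δ)` is weakly relatively sequentially compact in `H₀¹(Ω)` as `δ → 0`
      (∀ d : ℕ → ℝ, Tendsto d atTop (𝓝[>] 0) →
        ∃ (ps : H10 Ω) (σ : ℕ → ℕ), StrictMono σ ∧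
          WeaklyTendsto (fun k => p (d (σ k))) atTop ps) ∧
      -- along every sequence with `p^δ → p*` weakly, `(ξ^δ, p^δ) → ⟨ξ*, p*⟩ = 0`
      (∀ d : ℕ → ℝ, Tendsto d atTop (𝓝[>] 0) → ∀ ps : H10 Ω,
        WeaklyTendsto (fun k => p (d k)) atTop ps →
          Tendsto (fun k => xiPairing (d k) (toH10 (φ (d k))) (y (d k))
            (fnOf (p (d k)))) atTop (𝓝 (inner ℝ ξs (fnOf ps))) ∧
          inner ℝ ξs (fnOf ps) = 0) ∧
      -- if all of `H²(Ω) ∩ H₀¹(Ω)` is admissible, the whole family `p^δ` converges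
      (Uad = Set.univ → ∃ ps : H10 Ω,
        WeaklyTendsto p (𝓝[>] 0) ps ∧
        Tendsto (fun δ => xiPairing δ (toH10 (φ δ)) (y δ) (fnOf (p δ))) (𝓝[>] 0)
          (𝓝 (inner ℝ ξs (fnOf ps))) ∧
        inner ℝ ξs (fnOf ps) = 0) := by

  have hst : ∀ δ > 0, IsPenalizedState a f δ (toH10 (φ δ)) (y δ) := fun δ hδ => (hφ δ hδ).2.1
  obtain ⟨hφl, hyl⟩ := tendsto_penalizedOptimal hΩ hΩb ha hν hopt hφ
  obtain ⟨B, hB⟩ := exists_bound_of_isPenalizedOptimal hΩ hΩb ha hν hopt hφ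
  obtain ⟨ξs, hξ0, hξs⟩ := hopt.2.1.exists_multiplier hΩ hΩb ha
  obtain ⟨C, -, hb⟩ := exists_adjoint_bounds ha hp hyl
  have hpb : ∀ᶠ δ in 𝓝[>] 0, ‖p δ‖ ≤ C := hb.mono fun δ h => h.1
  have hadj := tendsto_xiPairing_adjoint ha hopt.2.1 hst hp hφl hyl
  refine ⟨ξs, hξ0, hξs, fun v => ?_, ?_, hadj, fun d hd => ?_, fun d hd ps hps => ?_, fun hU => ?_⟩
  · exact tendsto_xiPairing_fixed ha hξs hst hyl v
  · rintro ⟨K, hK⟩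
    refine weaklyTendsto_betaL hΩ ha hξs hst hφl hyl (B := |K| * (1 + B)) ?_
    filter_upwards [hB, eventually_mem_nhdsWithin] with δ h1 hδ
    have h2 : ‖laplacianOf (φ δ)‖ ≤ B := (le_add_of_nonneg_left (norm_nonneg _)).trans h1.1
    refine (hK _ (hφ δ hδ).1).trans ?_
    refine mul_le_mul (le_abs_self K) (by linarith) (by positivity) (abs_nonneg K)
  · exact exists_weaklyTendsto_adjoint_subseq hpb hd
  · have h1 := tendsto_xiPairing ha hd hξs hst hyl hps
      (hd.eventually hpb)
    -- The same pairings tend to `⟨ξ*, p*⟩` by weak-strong convergence and to `0` by the adjoint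
    -- estimate.
    exact ⟨h1, tendsto_nhds_unique h1 (hadj.comp hd)⟩
  · subst hU
    obtain ⟨ps, hps⟩ := exists_weaklyTendsto_adjoint ha hpb fun ψ hψ =>
      exists_tendsto_form_adjoint ha hφ hp hφl hyl hψ
    have h1 := tendsto_xiPairing ha (d := fun δ => δ) tendsto_id hξs hst hyl hps hpb
    exact ⟨ps, hps, h1, tendsto_nhds_unique h1 hadj⟩
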